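/- Let $H$ be an $N\times N$ GUE matrix, i.e. a random Hermitian matrix with density proportional to $e^{-\frac N2\operatorname{Tr}H^2}$ with respect to Lebesgue measure on Hermitian matrices, and let $J=H+i\gamma\,\mathrm{diag}(1,0,\dots,0)$ with eigenvalues $z_j=X_j+iY_j$ ($1\le j\le N$, counted with algebraic multiplicity). Let $\rho_N(X,Y)=\big\langle\frac1N\sum_{j=1}^N\delta(X-X_j)\,\delta(Y-Y_j)\big\rangle$ denote the mean eigenvalue density of $J$ in the open upper half-plane $Y>0$, i.e. the continuous function satisfying $$\Big\langle \tfrac1N\sum_{j=1}^N f(X_j,Y_j)\Big\rangle=\iint f(X,Y)\,\rho_N(X,Y)\,dX\,dY$$ for every continuous real-valued function $f$ with compact support in $\{Y>0\}$, where $\langle\cdot\rangle$ is the average over $H$. Fix $\alpha\in\mathbb R$ and let $\gamma=\gamma_N=1+\alpha N^{-1/3}$. Then for all sufficiently large $N$ the density $\rho_N$ exists, and for every fixed $q\in\mathbb R$ and $m>0$ the rescaled density $$\tilde p_N(q,m)=\frac{N}{N^{2/3}}\,\rho_N\!\left(\frac q{N^{1/3}},\frac m{N^{1/3}}\right)$$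 satisfies $$\lim_{N\to\infty}\tilde p_N(q,m)=\tilde p(q,m):=\frac1{4\pi m}\left[\frac1m+\frac{q^2}4+\left(\frac{3m}2-\alpha\right)^2\right]\exp\!\left(-m\left[\frac{q^2}4+\left(\alpha-\frac m2\right)^2\right]\right).$$ Moreover, for every $m>0$ the function $q\mapsto\tilde p(q,m)$ is integrable over $\mathbb R$ and $$\int_{-\infty}^{\infty}\tilde p(q,m)\,dq=\frac1{2\sqrt\pi}\,\frac{\frac3{2m}+\left(\frac{3m}2-\alpha\right)^2}{m^{3/2}}\,e^{-m\left(\alpha-\frac m2\right)^2}.$$ -/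

import Mathlib

open MeasureTheory Filter Topology

noncomputable section

namespace RankOneGUE

/-- The independent real and complex entries of an `N × N` Hermitian matrix: the real diagonal
entries and the complex entries strictly above the diagonal. The `volume` of this product space is
the standard Lebesgue measure on Hermitian matrices. -/
abbrev HermitianCoords (N : ℕ) : Type :=
  (Fin N → ℝ) × ({p : Fin N × Fin N // p.1 < p.2} → ℂ)

/-- The Hermitian matrix with given diagonal and strictly upper triangular entries. -/
def hermitianMatrix {N : ℕ} (x : HermitianCoords N) : Matrix (Fin N) (Fin N) ℂ :=
  Matrix.of fun i j =>
    if h : i < j then x.2 ⟨(i, j), h⟩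
    else if h : j < i then star (x.2 ⟨(j, i), h⟩)
    else (x.1 i : ℂ)

/-- The unnormalised GUE weight `exp (-(N/2) Tr H²)` (the trace is real). -/
def gueWeight (N : ℕ) (x : HermitianCoords N) : ℝ :=
  Real.exp (-((N : ℝ) / 2) * (hermitianMatrix x * hermitianMatrix x).trace.re)

/-- The GUE probability measure, `const × exp (-(N/2) Tr H²) dH`. -/
def gue (N : ℕ) : Measure (HermitianCoords N) :=
  (∫⁻ x, ENNReal.ofReal (gueWeight N x))⁻¹ •
    volume.withDensity fun x => ENNReal.ofReal (gueWeight N x)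

/-- `J = H + i γ diag(1, 0, …, 0)`. -/
def deformedMatrix {N : ℕ} (γ : ℝ) (x : HermitianCoords N) : Matrix (Fin N) (Fin N) ℂ :=
  hermitianMatrix x +
    Complex.I • Matrix.diagonal fun i : Fin N => if (i : ℕ) = 0 then (γ : ℂ) else 0

/-- The linear statistic `∑ⱼ f (Xⱼ, Yⱼ)` over the eigenvalues `Xⱼ + i Yⱼ` of `J`, counted with
algebraic multiplicity. -/
def eigenvalueSum {N : ℕ} (γ : ℝ) (f : ℝ × ℝ → ℝ) (x : HermitianCoords N) : ℝ :=
  ((deformedMatrix γ x).charpoly.roots.map fun z => f (z.re, z.im)).sum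

/-- The open upper half-plane, as a set of pairs `(X, Y)`. -/
def upperHalf : Set (ℝ × ℝ) := {p | 0 < p.2}

/-- `ρ` is the mean eigenvalue density `⟨N⁻¹ ∑ⱼ δ(X - Xⱼ) δ(Y - Yⱼ)⟩` of `J` in the open upper
half-plane: the Dirac masses are tested against continuous compactly supported functions, and the
pointwise values are those of the continuous version (which is unique). -/
def IsMeanEigenvalueDensity (N : ℕ) (γ : ℝ) (ρ : ℝ × ℝ → ℝ) : Prop :=
  ContinuousOn ρ upperHalf ∧
    ∀ f : ℝ × ℝ → ℝ, Continuous f → HasCompactSupport f → tsupport f ⊆ upperHalf →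
      ∫ x, (1 / (N : ℝ)) * eigenvalueSum γ f x ∂(gue N) = ∫ p, f p * ρ p

/-- The critical coupling `γ = 1 + α N^{-1/3}`. -/
def criticalGamma (α : ℝ) (N : ℕ) : ℝ := 1 + α / (N : ℝ) ^ (1 / 3 : ℝ)

/-- The rescaled density `(N / N^{2/3}) ρ (q / N^{1/3}, m / N^{1/3})`. -/
def rescaledDensity (N : ℕ) (ρ : ℝ × ℝ → ℝ) (q m : ℝ) : ℝ :=
  (N : ℝ) / (N : ℝ) ^ (2 / 3 : ℝ) *
    ρ (q / (N : ℝ) ^ (1 / 3 : ℝ), m / (N : ℝ) ^ (1 / 3 : ℝ))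

/-- The limiting rescaled density of the extreme eigenvalues. -/
def limitDensity (α q m : ℝ) : ℝ :=
  1 / (4 * Real.pi * m) * (1 / m + q ^ 2 / 4 + (3 * m / 2 - α) ^ 2) *
    Real.exp (-m * (q ^ 2 / 4 + (α - m / 2) ^ 2))

/-- The limiting rescaled density of the imaginary parts of the extreme eigenvalues. -/
def limitImDensity (α m : ℝ) : ℝ :=
  1 / (2 * Real.sqrt Real.pi) * ((3 / (2 * m) + (3 * m / 2 - α) ^ 2) / m ^ (3 / 2 : ℝ)) *
    Real.exp (-m * (α - m / 2) ^ 2)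

end RankOneGUE

end

/-! Let N = n + 2 and split H into its corner entry a, the rest b of its first row, and the
complementary block H' of size n + 1. By the Schur complement, a non-real z is an eigenvalue of J
exactly when g(z) = a + iγ, where g(z) = z - b(z - H')⁻¹b* (`secular`) involves neither a nor γ
(`eval_charpoly_deformedMatrix`). If γ is integrated along with a, the point w = a + iγ sweeps a
region of the plane. The area formula for the holomorphic map g then turns the sum over eigenvalues
into an integral of |g'(z)|² times the weight of g(z) (`lintegral_line_eigenvalueSum`). This is a
Kac–Rice formula.

For fixed z = x + iy, the substitution b = u(z - H') gives Im g(z) = y(1 + |u|²), so prescribing γ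
prescribes |u|². Unitary invariance rotates u onto the first axis. An affine change of the corner
and first row of H' then reduces the integrand to the Gaussian mean of |det(z - H' - i(γ -
y)e₁e₁ᵀ)|² (`lintegral_radialIntegrand`). The formula obtained holds for almost every γ. Both sides
are continuous in γ, so it holds for every γ > 0 (`integral_eigenvalueSum_of_nonneg`).

The second moment of the deformed determinant expands into correlations of the characteristic
polynomials of H' and of its lower right block. Bordering gives recursions in the size for these,
solved by Christoffel–Darboux kernels of Hermite polynomials (`hermite_closed_form`). Mehler's
formula, proved by matching a four-step recursion with a first-order differential equation, rewrites
the kernels as Taylor coefficients, hence as one contour integral (`deformedMoment_eq_taylorCoeff`).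

Put δ = N^(-1/3), x = qδ, y = mδ and t = exp(-ζ) on the contour. The leading exponent is N(y²/ζ +
ζ), with saddle ζ = y and fluctuations ζ = mδ - iδ²s. The divergent constants cancel against the
factor (1 - y/γ)^n because γ = 1 + αδ. The exponent converges to the limiting one minus s²/m
(`tendsto_saddleExponent`). Bounds uniform over the whole circle (`re_saddleExponent_le`,
`norm_saddleAmplitude_le`) allow dominated convergence, and a Gaussian integral in s gives the limit
density (`re_integral_limitIntegrand`). A continuous density is unique on the open half-plane, so
the limit holds for any choice of densities. The marginal in q is a Gaussian integral as well. -/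

noncomputable section
namespace RankOneGUE

/-! ### Bordered decomposition of a Hermitian matrix -/

/-- The strictly upper triangular positions of an `(n+1) × (n+1)` matrix: those in the first row,
and those of the lower right `n × n` block. -/
def upperIndexEquiv (n : ℕ) : (Fin n ⊕ {p : Fin n × Fin n // p.1 < p.2}) ≃
    {p : Fin (n + 1) × Fin (n + 1) // p.1 < p.2} :=
  Equiv.ofBijective
    (Sum.elim (fun j => ⟨(0, j.succ), Fin.succ_pos j⟩)
      (fun p => ⟨(p.1.1.succ, p.1.2.succ), Fin.succ_lt_succ_iff.2 p.2⟩)) (by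
    constructor
    · rintro (i | ⟨⟨i, j⟩, h⟩) (k | ⟨⟨k, l⟩, h'⟩) <;>
        simp [Fin.ext_iff]
    · rintro ⟨⟨i, j⟩, h⟩
      obtain ⟨j, rfl⟩ := Fin.exists_succ_eq.2 (Fin.ne_zero_of_lt h)
      rcases Fin.eq_zero_or_eq_succ i with rfl | ⟨i, rfl⟩
      · exact ⟨Sum.inl j, rfl⟩
      · exact ⟨Sum.inr ⟨(i, j), Fin.succ_lt_succ_iff.1 h⟩, rfl⟩)

/-- Splitting a Hermitian matrix into its corner entry, the rest of its first row, and the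
complementary block. -/
def bordered (n : ℕ) : ℝ × (Fin n → ℂ) × HermitianCoords n ≃ᵐ HermitianCoords (n + 1) :=
  let e₁ : ℝ × (Fin n → ℂ) × HermitianCoords n ≃ᵐ
      (ℝ × (Fin n → ℝ)) × ((Fin n → ℂ) × ({p : Fin n × Fin n // p.1 < p.2} → ℂ)) :=
    { toFun := fun t => ((t.1, t.2.2.1), (t.2.1, t.2.2.2))
      invFun := fun t => (t.1.1, t.2.1, t.1.2, t.2.2)
      left_inv := fun _ => rfl
      right_inv := fun _ => rfl
      measurable_toFun := by eta_expand; dsimp; fun_prop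
      measurable_invFun := by eta_expand; dsimp; fun_prop }
  e₁.trans (MeasurableEquiv.prodCongr (MeasurableEquiv.piFinSuccAbove (fun _ => ℝ) 0).symm
    ((MeasurableEquiv.sumPiEquivProdPi
      (fun _ : Fin n ⊕ {p : Fin n × Fin n // p.1 < p.2} => ℂ)).symm.trans
      (MeasurableEquiv.piCongrLeft (fun _ => ℂ) (upperIndexEquiv n))))

variable {n : ℕ}

lemma bordered_fst_zero (a : ℝ) (b : Fin n → ℂ) (x : HermitianCoords n) :
    (bordered n (a, b, x)).1 0 = a := rfl

lemma bordered_fst_succ (a : ℝ) (b : Fin n → ℂ) (x : HermitianCoords n) (i : Fin n) :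
    (bordered n (a, b, x)).1 i.succ = x.1 i := rfl

lemma bordered_snd_inl (a : ℝ) (b : Fin n → ℂ) (x : HermitianCoords n) (j : Fin n) :
    (bordered n (a, b, x)).2 (upperIndexEquiv n (Sum.inl j)) = b j := 
  Equiv.piCongrLeft_apply_apply (fun _ => ℂ) (upperIndexEquiv n) _ (Sum.inl j)

lemma bordered_snd_inr (a : ℝ) (b : Fin n → ℂ) (x : HermitianCoords n)
    (p : {p : Fin n × Fin n // p.1 < p.2}) :
    (bordered n (a, b, x)).2 (upperIndexEquiv n (Sum.inr p)) = x.2 p := 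
  Equiv.piCongrLeft_apply_apply (fun _ => ℂ) (upperIndexEquiv n) _ (Sum.inr p)

/-- Bordering only permutes and regroups factors of a product of Lebesgue measures, so the proof is
a composition of standard reassociations and swaps. -/
lemma measurePreserving_bordered : MeasurePreserving (bordered n) := by
  have h₁ : MeasurePreserving (fun t : ℝ × (Fin n → ℂ) × HermitianCoords n =>
      ((t.1, t.2.2.1), (t.2.1, t.2.2.2))) := by
    have A : MeasurePreserving (fun t : (Fin n → ℂ) × HermitianCoords n => (t.2.1, (t.1, t.2.2)))
        volume volume := by
      have B := (measurePreserving_prodAssoc (volume : Measure (Fin n → ℝ))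
        (volume : Measure (Fin n → ℂ))
        (volume : Measure ({p : Fin n × Fin n // p.1 < p.2} → ℂ)))
      have C := (Measure.measurePreserving_swap (μ := (volume : Measure (Fin n → ℂ)))
        (ν := (volume : Measure (Fin n → ℝ)))).prod
        (MeasurePreserving.id (volume : Measure ({p : Fin n × Fin n // p.1 < p.2} → ℂ)))
      have D := (measurePreserving_prodAssoc (volume : Measure (Fin n → ℂ))
        (volume : Measure (Fin n → ℝ))
        (volume : Measure ({p : Fin n × Fin n // p.1 < p.2} → ℂ))).symm
      exact B.comp (C.comp D)
    have E := (MeasurePreserving.id (volume : Measure ℝ)).prod A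
    have F := (measurePreserving_prodAssoc (volume : Measure ℝ) (volume : Measure (Fin n → ℝ))
        (volume : Measure ((Fin n → ℂ) × ({p : Fin n × Fin n // p.1 < p.2} → ℂ)))).symm
    exact F.comp E
  have h₂ := (volume_preserving_piFinSuccAbove (fun _ : Fin (n+1) => ℝ) 0).symm
  have h₃ := (volume_measurePreserving_sumPiEquivProdPi_symm
      (fun _ : Fin n ⊕ {p : Fin n × Fin n // p.1 < p.2} => ℂ))
  have h₄ := volume_measurePreserving_piCongrLeft (fun _ => ℂ) (upperIndexEquiv n)
  exact (h₂.prod (h₄.comp h₃)).comp h₁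

/-- The quadratic form `b M b*`. -/
def rowForm (M : Matrix (Fin n) (Fin n) ℂ) (b : Fin n → ℂ) : ℂ := b ⬝ᵥ M.mulVec (star b)

lemma hermitianMatrix_apply_of_lt (x : HermitianCoords n) {i j : Fin n} (h : i < j) :
    hermitianMatrix x i j = x.2 ⟨(i, j), h⟩ := by
  simp [hermitianMatrix, h]

lemma hermitianMatrix_apply_of_gt (x : HermitianCoords n) {i j : Fin n} (h : j < i) :
    hermitianMatrix x i j = star (x.2 ⟨(j, i), h⟩) := by
  simp [hermitianMatrix, h, h.le.not_gt]

lemma hermitianMatrix_apply_self (x : HermitianCoords n) (i : Fin n) :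
    hermitianMatrix x i i = x.1 i := by
  simp [hermitianMatrix]

lemma isHermitian_hermitianMatrix (x : HermitianCoords n) : (hermitianMatrix x).IsHermitian := by
  ext i j
  rw [Matrix.conjTranspose_apply]
  rcases lt_trichotomy i j with h | rfl | h
  · rw [hermitianMatrix_apply_of_lt x h, hermitianMatrix_apply_of_gt x h, star_star]
  · simp [hermitianMatrix_apply_self]
  · rw [hermitianMatrix_apply_of_lt x h, hermitianMatrix_apply_of_gt x h]

section entries
variable (a : ℝ) (b : Fin n → ℂ) (x : HermitianCoords n)

lemma hermitianMatrix_bordered_zero_zero : hermitianMatrix (bordered n (a, b, x)) 0 0 = a := by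
  rw [hermitianMatrix_apply_self, bordered_fst_zero]

lemma hermitianMatrix_bordered_zero_succ (j : Fin n) :
    hermitianMatrix (bordered n (a, b, x)) 0 j.succ = b j := by
  rw [hermitianMatrix_apply_of_lt _ (Fin.succ_pos j)]
  exact bordered_snd_inl a b x j

lemma hermitianMatrix_bordered_succ_zero (j : Fin n) :
    hermitianMatrix (bordered n (a, b, x)) j.succ 0 = star (b j) := by
  rw [hermitianMatrix_apply_of_gt _ (Fin.succ_pos j)]
  exact congrArg star (bordered_snd_inl a b x j)

lemma hermitianMatrix_bordered_succ_succ (i j : Fin n) :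
    hermitianMatrix (bordered n (a, b, x)) i.succ j.succ = hermitianMatrix x i j := by
  rcases lt_trichotomy i j with h | rfl | h
  · rw [hermitianMatrix_apply_of_lt x h,
      hermitianMatrix_apply_of_lt _ (Fin.succ_lt_succ_iff.2 h)]
    exact bordered_snd_inr a b x ⟨(i, j), h⟩
  · rw [hermitianMatrix_apply_self, hermitianMatrix_apply_self, bordered_fst_succ]
  · rw [hermitianMatrix_apply_of_gt x h,
      hermitianMatrix_apply_of_gt _ (Fin.succ_lt_succ_iff.2 h)]
    exact congrArg star (bordered_snd_inr a b x ⟨(j, i), h⟩)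

end entries

/-- The quadratic form `Tr H²` in coordinates. -/
def traceSq (x : HermitianCoords n) : ℝ :=
  ∑ i, x.1 i ^ 2 + 2 * ∑ p, Complex.normSq (x.2 p)

/-- The squared Euclidean norm of a complex vector. -/
def sqNorm (b : Fin n → ℂ) : ℝ := ∑ i, Complex.normSq (b i)

lemma traceSq_bordered (a : ℝ) (b : Fin n → ℂ) (x : HermitianCoords n) :
    traceSq (bordered n (a, b, x)) = a ^ 2 + 2 * sqNorm b + traceSq x := by
  simp only [traceSq, sqNorm]
  rw [Fin.sum_univ_succ, ← (upperIndexEquiv n).sum_comp, Fintype.sum_sum_type]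
  simp only [bordered_fst_zero, bordered_fst_succ, bordered_snd_inl, bordered_snd_inr]
  ring

/-- Induction on the size by bordering: each off-diagonal entry meets its conjugate twice in the
trace, which accounts for the factor 2 in `traceSq`. -/
lemma trace_hermitianMatrix_sq : ∀ {n : ℕ} (x : HermitianCoords n),
    (hermitianMatrix x * hermitianMatrix x).trace = traceSq x := by
  intro n
  induction n with
  | zero => intro x; simp [traceSq, Matrix.trace]
  | succ n ih =>
    intro x
    obtain ⟨⟨a, b, x⟩, rfl⟩ := (bordered n).surjective x
    rw [traceSq_bordered, Matrix.trace, Fin.sum_univ_succ]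
    simp only [Matrix.diag_apply, Matrix.mul_apply, Fin.sum_univ_succ,
      hermitianMatrix_bordered_zero_zero, hermitianMatrix_bordered_zero_succ,
      hermitianMatrix_bordered_succ_zero, hermitianMatrix_bordered_succ_succ]
    have h := ih x
    simp only [Matrix.trace, Matrix.diag_apply, Matrix.mul_apply] at h
    rw [Finset.sum_add_distrib, h]
    have h2 : ∀ i, star (b i) * b i = (Complex.normSq (b i) : ℂ) := fun i => by
      rw [Complex.normSq_eq_conj_mul_self]; rfl
    have h3 : ∀ i, b i * star (b i) = (Complex.normSq (b i) : ℂ) := fun i => by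
      rw [mul_comm, h2]
    simp only [h2, h3, sqNorm]
    push_cast
    ring

end RankOneGUE
end

/-! ### Radial integration on complex space -/

noncomputable section
namespace RankOneGUE
variable {n : ℕ}

-- Polar coordinates followed by the substitution of the squared radius: half of the angle 2π is
-- absorbed by d(r²) = 2r dr, leaving the constant density π.
open Set in
lemma lintegral_normSq_complex (F : ℝ → ENNReal) (hF : Measurable F) :
    ∫⁻ u : ℂ, F (Complex.normSq u) = ∫⁻ r in Ioi (0 : ℝ), ENNReal.ofReal Real.pi * F r := by
  rw [← Complex.lintegral_comp_polarCoord_symm, polarCoord_target, Measure.volume_eq_prod,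
    ← Measure.prod_restrict, lintegral_prod _ (by
      simp only [Complex.normSq_eq_norm_sq, Complex.norm_polarCoord_symm, sq_abs]; fun_prop)]
  simp only [Complex.normSq_eq_norm_sq, Complex.norm_polarCoord_symm, sq_abs, lintegral_const,
    Measure.restrict_apply MeasurableSet.univ, univ_inter, Real.volume_Ioo, smul_eq_mul]
  have h := lintegral_image_eq_lintegral_abs_deriv_mul (s := Ioi (0 : ℝ)) (f := fun r => r ^ 2)
    (f' := fun r => 2 * r) measurableSet_Ioi
    (fun x _ => by simpa using (hasDerivAt_pow 2 x).hasDerivWithinAt)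
    (fun a ha b hb hab => by
      exact (pow_left_inj₀ (le_of_lt ha) (le_of_lt hb) two_ne_zero).1 hab)
    (fun r => ENNReal.ofReal Real.pi * F r)
  have him : (fun r : ℝ => r ^ 2) '' Ioi 0 = Ioi 0 := by
    ext t
    constructor
    · rintro ⟨r, hr, rfl⟩
      exact pow_pos (mem_Ioi.1 hr) 2
    · intro ht
      exact ⟨√t, Real.sqrt_pos.2 ht, Real.sq_sqrt (le_of_lt ht)⟩
  rw [him] at h
  rw [h]
  refine setLIntegral_congr_fun measurableSet_Ioi fun r hr => ?_
  have hr : 0 < r := hr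
  have : ENNReal.ofReal |2 * r| = ENNReal.ofReal r * 2 := by
    rw [abs_of_pos (by positivity), mul_comm 2 r, ENNReal.ofReal_mul hr.le]; simp
  have h2 : ENNReal.ofReal (Real.pi - -Real.pi) = ENNReal.ofReal Real.pi * 2 := by
    rw [sub_neg_eq_add, ← mul_two, ENNReal.ofReal_mul Real.pi_pos.le]; simp
  simp only [this, h2]
  ring

lemma continuous_sqNorm : Continuous (sqNorm : (Fin n → ℂ) → ℝ) := by
  unfold sqNorm
  exact continuous_finsetSum _ fun i _ => Complex.continuous_normSq.comp (continuous_apply i)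

@[fun_prop]
lemma measurable_sqNorm : Measurable (sqNorm : (Fin n → ℂ) → ℝ) := continuous_sqNorm.measurable

lemma sqNorm_nonneg (b : Fin n → ℂ) : 0 ≤ sqNorm b :=
  Finset.sum_nonneg fun _ _ => Complex.normSq_nonneg _

open Set in
/-- The radial part of Lebesgue measure on `ℂⁿ⁺¹`, in the variable `r = |u|²`. -/
lemma lintegral_sqNorm (n : ℕ) (F : ℝ → ENNReal) (hF : Measurable F) :
    ∫⁻ u : Fin (n + 1) → ℂ, F (sqNorm u) =
      ∫⁻ r in Ioi (0 : ℝ), ENNReal.ofReal (Real.pi ^ (n + 1) / n.factorial * r ^ n) * F r := by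
  induction n generalizing F with
  | zero =>
    have h0 : MeasurePreserving (MeasurableEquiv.funUnique (Fin 1) ℂ) := by
      convert volume_preserving_funUnique (Fin 1) ℂ <;> rfl
    rw [zero_add, h0.symm.lintegral_map_equiv]
    have : ∀ u : ℂ, sqNorm ((MeasurableEquiv.funUnique (Fin 1) ℂ).symm u) = Complex.normSq u := by
      intro u; simp [sqNorm]
    simp only [this]
    rw [lintegral_normSq_complex F hF]
    simp
  | succ n ih =>
    rw [(volume_preserving_piFinSuccAbove (fun _ : Fin (n+2) => ℂ) 0).symm.lintegral_map_equiv]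
    have : ∀ u : ℂ × (Fin (n + 1) → ℂ),
        sqNorm ((MeasurableEquiv.piFinSuccAbove (fun _ : Fin (n+2) => ℂ) 0).symm u) =
          Complex.normSq u.1 + sqNorm u.2 := by
      intro u
      rw [sqNorm, Fin.sum_univ_succ]
      rfl
    simp only [this]
    have hm := Complex.continuous_normSq.measurable
    rw [Measure.volume_eq_prod, lintegral_prod _ (by fun_prop)]
    have h1 : ∀ u : ℂ, ∫⁻ v : Fin (n + 1) → ℂ, F (Complex.normSq u + sqNorm v) =
        ∫⁻ r in Ioi (0 : ℝ), ENNReal.ofReal (Real.pi ^ (n + 1) / n.factorial * r ^ n) *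
          F (Complex.normSq u + r) := fun u =>
      ih (fun r => F (Complex.normSq u + r)) (by fun_prop)
    simp only [h1]
    rw [lintegral_normSq_complex (fun s => ∫⁻ r in Ioi (0 : ℝ),
      ENNReal.ofReal (Real.pi ^ (n + 1) / n.factorial * r ^ n) * F (s + r))
      (by apply Measurable.lintegral_prod_right'
            (f := fun p : ℝ × ℝ =>
              ENNReal.ofReal (Real.pi ^ (n + 1) / n.factorial * p.2 ^ n) * F (p.1 + p.2))
          fun_prop)]
    have h2 : ∀ s : ℝ, ENNReal.ofReal Real.pi * ∫⁻ r in Ioi (0 : ℝ),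
        ENNReal.ofReal (Real.pi ^ (n + 1) / n.factorial * r ^ n) * F (s + r) =
        ∫⁻ r in Ioi (0 : ℝ), ENNReal.ofReal (Real.pi ^ (n + 2) / n.factorial * r ^ n) *
          F (s + r) := by
      intro s
      rw [← lintegral_const_mul _ (by fun_prop)]
      congr 1; ext r
      rw [← mul_assoc, ← ENNReal.ofReal_mul Real.pi_pos.le]
      congr 2; ring
    simp only [h2]
    rw [lintegral_lintegral_swap (by fun_prop)]
    -- Translating s by r turns the convolution into an integral over t > r. Exchanging the order
    -- once more leaves ∫ rⁿ dr over 0 < r < t, which raises the power and supplies the new factor n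
    -- + 1 of the factorial.
    have h3 : ∀ r : ℝ, ∫⁻ s in Ioi (0 : ℝ),
        ENNReal.ofReal (Real.pi ^ (n + 2) / n.factorial * r ^ n) * F (s + r) =
        ∫⁻ t, (Ioi r).indicator (fun t =>
          ENNReal.ofReal (Real.pi ^ (n + 2) / n.factorial * r ^ n) * F t) t := by
      intro r
      rw [← lintegral_indicator measurableSet_Ioi, ← lintegral_add_right_eq_self
        ((Ioi r).indicator _) r]
      congr 1; ext s
      simp [indicator]
    simp only [h3]
    rw [lintegral_lintegral_swap (by
      have : (fun p : ℝ × ℝ => (Ioi p.1).indicator (fun t =>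
          ENNReal.ofReal (Real.pi ^ (n + 2) / n.factorial * p.1 ^ n) * F t) p.2) =
        {p : ℝ × ℝ | p.1 < p.2}.indicator (fun p =>
          ENNReal.ofReal (Real.pi ^ (n + 2) / n.factorial * p.1 ^ n) * F p.2) := by
        ext p; simp [indicator]
      refine AEMeasurable.congr (f := {p : ℝ × ℝ | p.1 < p.2}.indicator (fun p =>
          ENNReal.ofReal (Real.pi ^ (n + 2) / n.factorial * p.1 ^ n) * F p.2)) ?_
          (by rw [← this]; rfl)
      exact (Measurable.indicator (by fun_prop)
        (measurableSet_lt measurable_fst measurable_snd)).aemeasurable)]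
    rw [← lintegral_indicator measurableSet_Ioi]
    congr 1; ext t
    by_cases ht : 0 < t
    · have h4 : ∀ r ∈ Ioi (0:ℝ), (Ioi r).indicator (fun t =>
          ENNReal.ofReal (Real.pi ^ (n + 2) / n.factorial * r ^ n) * F t) t =
          (Iio t).indicator (fun r => 
          ENNReal.ofReal (Real.pi ^ (n + 2) / n.factorial * r ^ n) * F t) r := by
        intro r _; simp [indicator]
      rw [setLIntegral_congr_fun measurableSet_Ioi h4, lintegral_indicator measurableSet_Iio,
        Measure.restrict_restrict measurableSet_Iio, Iio_inter_Ioi,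
        lintegral_mul_const _ (by fun_prop), indicator_of_mem (mem_Ioi.2 ht)]
      congr 1
      rw [← ofReal_integral_eq_lintegral_ofReal]
      · rw [← integral_Ioc_eq_integral_Ioo, 
          ← intervalIntegral.integral_of_le ht.le, intervalIntegral.integral_const_mul,
              integral_pow]
        congr 1
        rw [Nat.factorial_succ]
        push_cast
        field_simp
        simp
      · exact (Continuous.integrableOn_Icc (by fun_prop)).mono_set Ioo_subset_Icc_self
      · filter_upwards [ae_restrict_mem measurableSet_Ioo] with r hr
        have := hr.1
        simp only [Pi.zero_apply]; positivity
    · rw [indicator_of_notMem (by simpa using ht)]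
      rw [← lintegral_zero (μ := volume.restrict (Ioi (0:ℝ)))]
      refine setLIntegral_congr_fun measurableSet_Ioi fun r hr => ?_
      have hr : 0 < r := hr
      rw [indicator_of_notMem]
      simp only [mem_Ioi, not_lt] at ht ⊢
      linarith

end RankOneGUE
end

/-! ### Gaussian measures, their masses and unitary invariance -/

noncomputable section
namespace RankOneGUE
variable {n : ℕ}

/-- The unnormalised Gaussian measure `exp (-(κ/2) Tr H²) dH`. -/
def hermitianGaussian (κ : ℝ) (n : ℕ) : Measure (HermitianCoords n) :=
  volume.withDensity fun x => ENNReal.ofReal (Real.exp (-(κ / 2) * traceSq x))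

/-- The unnormalised Gaussian measure `exp (-(κ/2) a²) da` on the line. -/
def lineGaussian (κ : ℝ) : Measure ℝ :=
  volume.withDensity fun a => ENNReal.ofReal (Real.exp (-(κ / 2) * a ^ 2))

/-- The unnormalised Gaussian measure `exp (-κ |b|²) db` on `ℂⁿ`. -/
def rowGaussian (κ : ℝ) (n : ℕ) : Measure (Fin n → ℂ) :=
  volume.withDensity fun b => ENNReal.ofReal (Real.exp (-κ * sqNorm b))

lemma continuous_traceSq : Continuous (traceSq : HermitianCoords n → ℝ) := by
  unfold traceSq
  refine Continuous.add ?_ (continuous_const.mul ?_)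
  · exact continuous_finsetSum _ fun i _ => by fun_prop
  · exact continuous_finsetSum _ fun i _ => Complex.continuous_normSq.comp (by fun_prop)

@[fun_prop]
lemma measurable_traceSq : Measurable (traceSq : HermitianCoords n → ℝ) :=
  continuous_traceSq.measurable

lemma traceSq_nonneg (x : HermitianCoords n) : 0 ≤ traceSq x := by
  unfold traceSq
  have := Finset.sum_nonneg (s := Finset.univ) fun i _ => sq_nonneg (x.1 i)
  have := Finset.sum_nonneg (s := Finset.univ) fun i _ => Complex.normSq_nonneg (x.2 i)
  linarith

instance (κ : ℝ) (n : ℕ) : SFinite (hermitianGaussian κ n) := by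
  unfold hermitianGaussian; infer_instance

instance (κ : ℝ) : SFinite (lineGaussian κ) := by
  unfold lineGaussian; infer_instance

instance (κ : ℝ) (n : ℕ) : SFinite (rowGaussian κ n) := by
  unfold rowGaussian; infer_instance

/-- Off-diagonal entries count twice in Tr H², so the weight factors with exp(-κa²/2) on the corner
but exp(-κ|b|²) on the row. -/
lemma measurePreserving_bordered_gaussian (κ : ℝ) (n : ℕ) :
    MeasurePreserving (bordered n)
      ((lineGaussian κ).prod ((rowGaussian κ n).prod (hermitianGaussian κ n)))
      (hermitianGaussian κ (n + 1)) := by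
  refine ⟨(bordered n).measurable, ?_⟩
  unfold lineGaussian rowGaussian hermitianGaussian
  rw [prod_withDensity (by fun_prop) (by fun_prop), prod_withDensity (by fun_prop) (by fun_prop)]
  refine Measure.ext_of_lintegral _ fun f hf => ?_
  rw [lintegral_map hf (bordered n).measurable,
    lintegral_withDensity_eq_lintegral_mul _ (by fun_prop) (by fun_prop),
    lintegral_withDensity_eq_lintegral_mul _ (by fun_prop) hf,
    measurePreserving_bordered.lintegral_map_equiv]
  refine lintegral_congr fun ⟨a, b, x⟩ => ?_
  simp only [Pi.mul_apply, traceSq_bordered]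
  rw [← ENNReal.ofReal_mul (by positivity), ← ENNReal.ofReal_mul (by positivity),
    ← Real.exp_add, ← Real.exp_add]
  ring_nf

lemma lineGaussian_univ {κ : ℝ} (hκ : 0 < κ) :
    lineGaussian κ Set.univ = ENNReal.ofReal √(2 * Real.pi / κ) := by
  rw [lineGaussian, withDensity_apply _ MeasurableSet.univ, Measure.restrict_univ,
    ← ofReal_integral_eq_lintegral_ofReal (integrable_exp_neg_mul_sq (by positivity))
      (ae_of_all _ fun _ => by positivity), integral_gaussian]
  congr 2; field_simp

lemma integral_pow_mul_exp_neg {κ : ℝ} (hκ : 0 < κ) (j : ℕ) :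
    ∫ r in Set.Ioi (0 : ℝ), r ^ j * Real.exp (-κ * r) = j.factorial / κ ^ (j + 1) := by
  have h := Real.integral_rpow_mul_exp_neg_mul_Ioi (a := j + 1) (r := κ) (by positivity) hκ
  rw [Real.Gamma_nat_eq_factorial] at h
  have h2 : (1 / κ) ^ ((j : ℝ) + 1) = 1 / κ ^ (j + 1) := by
    rw [← Nat.cast_add_one, Real.rpow_natCast, div_pow, one_pow]
  rw [h2] at h
  rw [show (j.factorial : ℝ) / κ ^ (j + 1) = 1 / κ ^ (j + 1) * j.factorial by ring, ← h]
  refine setIntegral_congr_fun measurableSet_Ioi fun r _ => ?_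
  simp

lemma integrableOn_pow_mul_exp_neg {κ : ℝ} (hκ : 0 < κ) (j : ℕ) :
    IntegrableOn (fun r : ℝ => r ^ j * Real.exp (-κ * r)) (Set.Ioi 0) := by
  -- The Bochner integral of a non-integrable function is 0 by convention, whereas the formula
  -- already proved gives a positive value.
  by_contra h
  have h2 := integral_pow_mul_exp_neg hκ j
  rw [integral_undef h] at h2
  have : 0 < (j.factorial : ℝ) / κ ^ (j + 1) := by positivity
  linarith

lemma lintegral_pow_mul_exp_neg {κ : ℝ} (hκ : 0 < κ) (j : ℕ) :
    ∫⁻ r in Set.Ioi (0 : ℝ), ENNReal.ofReal (r ^ j * Real.exp (-κ * r)) =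
      ENNReal.ofReal (j.factorial / κ ^ (j + 1)) := by
  rw [← integral_pow_mul_exp_neg hκ j, ofReal_integral_eq_lintegral_ofReal
    (integrableOn_pow_mul_exp_neg hκ j)]
  filter_upwards [ae_restrict_mem measurableSet_Ioi] with r hr
  have : 0 < r := hr
  simp only [Pi.zero_apply]; positivity

/-- The moments of `|b|²` under the Gaussian measure. -/
lemma lintegral_sqNorm_pow_rowGaussian {κ : ℝ} (hκ : 0 < κ) (n j : ℕ) :
    ∫⁻ b, ENNReal.ofReal (sqNorm b ^ j) ∂(rowGaussian κ (n + 1)) =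
      ENNReal.ofReal ((Real.pi / κ) ^ (n + 1) * ((n + j).factorial / n.factorial / κ ^ j)) := by
  rw [rowGaussian, lintegral_withDensity_eq_lintegral_mul _ (by fun_prop) (by fun_prop)]
  simp only [Pi.mul_apply]
  rw [lintegral_sqNorm n (fun r => ENNReal.ofReal (Real.exp (-κ * r)) * ENNReal.ofReal (r ^ j))
    (by fun_prop)]
  have : ∀ r ∈ Set.Ioi (0 : ℝ), ENNReal.ofReal (Real.pi ^ (n + 1) / n.factorial * r ^ n) *
      (ENNReal.ofReal (Real.exp (-κ * r)) * ENNReal.ofReal (r ^ j)) =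
      ENNReal.ofReal (Real.pi ^ (n + 1) / n.factorial) *
        ENNReal.ofReal (r ^ (n + j) * Real.exp (-κ * r)) := by
    intro r hr
    have hr : 0 < r := hr
    rw [← ENNReal.ofReal_mul (by positivity), ← ENNReal.ofReal_mul (by positivity),
      ← ENNReal.ofReal_mul (by positivity)]
    congr 1; ring
  rw [setLIntegral_congr_fun measurableSet_Ioi this, lintegral_const_mul _ (by fun_prop),
    lintegral_pow_mul_exp_neg hκ, ← ENNReal.ofReal_mul (by positivity)]
  congr 1
  rw [div_pow, pow_add κ (n + j) 1, pow_add κ n j, pow_add κ n 1]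
  field_simp

lemma rowGaussian_univ {κ : ℝ} (hκ : 0 < κ) (n : ℕ) :
    rowGaussian κ n Set.univ = ENNReal.ofReal ((Real.pi / κ) ^ n) := by
  cases n with
  | zero =>
    rw [rowGaussian, withDensity_apply _ MeasurableSet.univ, Measure.restrict_univ]
    have h : ∀ b : Fin 0 → ℂ, sqNorm b = 0 := fun b => by simp [sqNorm]
    simp only [h]
    simp [volume_pi]
  | succ n =>
    have := lintegral_sqNorm_pow_rowGaussian hκ n 0
    have h0 : (n.factorial : ℝ) ≠ 0 := by positivity
    simpa [div_self h0] using this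

lemma hermitianGaussian_univ_succ {κ : ℝ} (hκ : 0 < κ) (n : ℕ) :
    hermitianGaussian κ (n + 1) Set.univ =
      ENNReal.ofReal (√(2 * Real.pi / κ) * (Real.pi / κ) ^ n) * hermitianGaussian κ n Set.univ := by
  rw [← (measurePreserving_bordered_gaussian κ n).measure_preimage
      MeasurableSet.univ.nullMeasurableSet,
    Set.preimage_univ, ← Set.univ_prod_univ, Measure.prod_prod, ← Set.univ_prod_univ,
    Measure.prod_prod, lineGaussian_univ hκ, rowGaussian_univ hκ, ← mul_assoc,
    ← ENNReal.ofReal_mul (by positivity)]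

lemma hermitianGaussian_univ {κ : ℝ} (hκ : 0 < κ) : ∀ n : ℕ, ∃ Z : ℝ, 0 < Z ∧
    hermitianGaussian κ n Set.univ = ENNReal.ofReal Z
  | 0 => by
    refine ⟨1, one_pos, ?_⟩
    rw [hermitianGaussian, withDensity_apply _ MeasurableSet.univ, Measure.restrict_univ]
    have h : ∀ x : HermitianCoords 0, traceSq x = 0 := fun b => by simp [traceSq]
    simp only [h]
    simp [volume_pi, Measure.volume_eq_prod]
    rw [← Set.univ_prod_univ, Measure.prod_prod]
    simp
  | n + 1 => by
    obtain ⟨Z, hZ, h⟩ := hermitianGaussian_univ hκ n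
    refine ⟨√(2 * Real.pi / κ) * (Real.pi / κ) ^ n * Z, by positivity, ?_⟩
    rw [hermitianGaussian_univ_succ hκ, h, ← ENNReal.ofReal_mul (by positivity)]

/-- The total mass of the Gaussian measure on Hermitian matrices. -/
def gaussianMass (κ : ℝ) (n : ℕ) : ℝ := (hermitianGaussian κ n).real Set.univ

lemma hermitianGaussian_univ_eq {κ : ℝ} (hκ : 0 < κ) (n : ℕ) :
    hermitianGaussian κ n Set.univ = ENNReal.ofReal (gaussianMass κ n) := by
  obtain ⟨Z, hZ, h⟩ := hermitianGaussian_univ hκ n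
  rw [gaussianMass, measureReal_def, h, ENNReal.toReal_ofReal hZ.le]

lemma gaussianMass_pos {κ : ℝ} (hκ : 0 < κ) (n : ℕ) : 0 < gaussianMass κ n := by
  obtain ⟨Z, hZ, h⟩ := hermitianGaussian_univ hκ n
  rwa [gaussianMass, measureReal_def, h, ENNReal.toReal_ofReal hZ.le]

lemma gaussianMass_succ {κ : ℝ} (hκ : 0 < κ) (n : ℕ) :
    gaussianMass κ (n + 1) = √(2 * Real.pi / κ) * (Real.pi / κ) ^ n * gaussianMass κ n := by
  rw [gaussianMass, measureReal_def, hermitianGaussian_univ_succ hκ, ENNReal.toReal_mul,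
    ENNReal.toReal_ofReal (by positivity)]
  rfl

/-- Coordinates of a Hermitian matrix. -/
def coordsOf (M : Matrix (Fin n) (Fin n) ℂ) : HermitianCoords n :=
  (fun i => (M i i).re, fun p => M p.1.1 p.1.2)

lemma hermitianMatrix_coordsOf {M : Matrix (Fin n) (Fin n) ℂ} (hM : M.IsHermitian) :
    hermitianMatrix (coordsOf M) = M := by
  ext i j
  rcases lt_trichotomy i j with h | rfl | h
  · rw [hermitianMatrix_apply_of_lt _ h]; rfl
  · rw [hermitianMatrix_apply_self]
    exact hM.coe_re_apply_self i
  · rw [hermitianMatrix_apply_of_gt _ h]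
    exact hM.apply i j

lemma hermitianMatrix_add (x y : HermitianCoords n) :
    hermitianMatrix (x + y) = hermitianMatrix x + hermitianMatrix y := by
  ext i j
  simp only [hermitianMatrix, Matrix.of_apply, Matrix.add_apply]
  split_ifs <;> simp

lemma hermitianMatrix_smul (c : ℝ) (x : HermitianCoords n) :
    hermitianMatrix (c • x) = (c : ℂ) • hermitianMatrix x := by
  ext i j
  simp only [hermitianMatrix, Matrix.of_apply, Matrix.smul_apply]
  split_ifs <;> simp

/-- Conjugation by a matrix, in coordinates. -/
def conjCoords (U : Matrix (Fin n) (Fin n) ℂ) : HermitianCoords n →ₗ[ℝ] HermitianCoords n where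
  toFun x := coordsOf (U * hermitianMatrix x * star U)
  map_add' x y := by
    rw [hermitianMatrix_add, mul_add, add_mul]
    ext <;> simp [coordsOf]
  map_smul' c x := by
    rw [hermitianMatrix_smul, mul_smul_comm, smul_mul_assoc]
    ext <;> simp [coordsOf]

lemma hermitianMatrix_conjCoords (U : Matrix (Fin n) (Fin n) ℂ) (x : HermitianCoords n) :
    hermitianMatrix (conjCoords U x) = U * hermitianMatrix x * star U :=
  hermitianMatrix_coordsOf (Matrix.isHermitian_mul_mul_conjTranspose U
    (isHermitian_hermitianMatrix x))

lemma traceSq_conjCoords {U : Matrix (Fin n) (Fin n) ℂ} (hU : star U * U = 1)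
    (x : HermitianCoords n) : traceSq (conjCoords U x) = traceSq x := by
  have h : (traceSq (conjCoords U x) : ℂ) = traceSq x := by
    rw [← trace_hermitianMatrix_sq, ← trace_hermitianMatrix_sq, hermitianMatrix_conjCoords]
    rw [show U * hermitianMatrix x * star U * (U * hermitianMatrix x * star U) =
      U * (hermitianMatrix x * (star U * U) * hermitianMatrix x * star U) by noncomm_ring,
      Matrix.trace_mul_comm, hU, mul_one, mul_assoc, hU, mul_one]
  exact_mod_cast h

lemma eq_zero_of_traceSq_eq_zero {x : HermitianCoords n} (h : traceSq x = 0) : x = 0 := by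
  unfold traceSq at h
  have h1 := Finset.sum_nonneg (s := Finset.univ) fun i _ => sq_nonneg (x.1 i)
  have h2 := Finset.sum_nonneg (s := Finset.univ) fun i _ => Complex.normSq_nonneg (x.2 i)
  have h3 : ∑ i, x.1 i ^ 2 = 0 := by linarith
  have h4 : ∑ i, Complex.normSq (x.2 i) = 0 := by linarith
  rw [Finset.sum_eq_zero_iff_of_nonneg fun i _ => sq_nonneg _] at h3
  rw [Finset.sum_eq_zero_iff_of_nonneg fun i _ => Complex.normSq_nonneg _] at h4
  ext i
  · simpa using h3 i
  · exact Complex.normSq_eq_zero.1 (h4 i (Finset.mem_univ _))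

instance (n : ℕ) : (volume : Measure (HermitianCoords n)).IsAddHaarMeasure := by
  have h1 : (volume : Measure (Fin n → ℝ)).IsAddHaarMeasure := inferInstance
  have h2 : (volume : Measure ({p : Fin n × Fin n // p.1 < p.2} → ℂ)).IsAddHaarMeasure :=
    Measure.pi.isAddHaarMeasure _
  exact Measure.prod.instIsAddHaarMeasure _ _

/-- The Gaussian measure is invariant under unitary conjugation. -/
lemma measurePreserving_conjCoords {κ : ℝ} (hκ : 0 < κ) {U : Matrix (Fin n) (Fin n) ℂ}
    (hU : star U * U = 1) :
    MeasurePreserving (conjCoords U) (hermitianGaussian κ n) (hermitianGaussian κ n) := by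
  have hcont : Continuous (conjCoords U) := LinearMap.continuous_of_finiteDimensional _
  have hinj : Function.Injective (conjCoords U) := by
    rw [injective_iff_map_eq_zero]
    intro x hx
    apply eq_zero_of_traceSq_eq_zero
    rw [← traceSq_conjCoords hU, hx]
    simp [traceSq]
  have hdet : LinearMap.det (conjCoords U) ≠ 0 :=
    (LinearEquiv.isUnit_det' (LinearEquiv.ofInjectiveEndo _ hinj)).ne_zero
  have hmap := Measure.map_linearMap_addHaar_eq_smul_addHaar
    (volume : Measure (HermitianCoords n)) hdet
  set c : ENNReal := ENNReal.ofReal |(LinearMap.det (conjCoords U))⁻¹| with hc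
  have key : (hermitianGaussian κ n).map (conjCoords U) = c • hermitianGaussian κ n := by
    refine Measure.ext_of_lintegral _ fun f hf => ?_
    rw [lintegral_map hf hcont.measurable, lintegral_smul_measure, hermitianGaussian,
      lintegral_withDensity_eq_lintegral_mul _ (by fun_prop) (g := fun x => f (conjCoords U x))
        (hf.comp hcont.measurable),
      lintegral_withDensity_eq_lintegral_mul _ (by fun_prop) hf, ← lintegral_smul_measure, ← hmap,
      lintegral_map (by fun_prop) hcont.measurable]
    refine lintegral_congr fun x => ?_
    simp only [Pi.mul_apply, traceSq_conjCoords hU]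
  refine ⟨hcont.measurable, ?_⟩
  -- The Jacobian need not be computed: the total mass is finite and positive and is unchanged by
  -- pushing forward, which forces the constant to be 1.
  have hone : c = 1 := by
    have h := congrArg (fun μ => μ Set.univ) key
    simp only [Measure.map_apply hcont.measurable MeasurableSet.univ, Set.preimage_univ,
      Measure.smul_apply, smul_eq_mul] at h
    rw [hermitianGaussian_univ_eq hκ n] at h
    have h0 : ENNReal.ofReal (gaussianMass κ n) ≠ 0 := by
      simpa using gaussianMass_pos hκ n
    have := (ENNReal.mul_left_inj (a := 1) (b := c) h0 ENNReal.ofReal_ne_top).1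
      (by rw [one_mul]; exact h)
    exact this.symm
  rw [key, hone, one_smul]

end RankOneGUE
end

/-! ### Rotating the row vector; Schur complements -/

noncomputable section
namespace RankOneGUE
variable {n : ℕ}

/-- Every row vector is a multiple of the first basis vector, up to a unitary. -/
lemma exists_unitary_vecMul_eq (b : Fin (n + 1) → ℂ) :
    ∃ U : Matrix (Fin (n + 1)) (Fin (n + 1)) ℂ, star U * U = 1 ∧
      Matrix.vecMul b U = Pi.single 0 ((√(sqNorm b) : ℝ) : ℂ) := by
  by_cases hb : b = 0
  · subst hb
    exact ⟨1, by simp, by simp [sqNorm]⟩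
  set r : ℝ := √(sqNorm b) with hr
  have hr2 : r ^ 2 = sqNorm b := Real.sq_sqrt (sqNorm_nonneg b)
  have hr0 : r ≠ 0 := by
    intro h0
    rw [h0] at hr2
    apply hb
    have h3 : ∑ i, Complex.normSq (b i) = 0 := by rw [← sqNorm, ← hr2]; simp
    rw [Finset.sum_eq_zero_iff_of_nonneg fun i _ => Complex.normSq_nonneg _] at h3
    ext i
    exact Complex.normSq_eq_zero.1 (h3 i (Finset.mem_univ _))
  have hrc : (r : ℂ) ≠ 0 := by exact_mod_cast hr0
  -- The conjugate of b, normalised. Once v is completed to an orthonormal basis forming the columns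
  -- of U, the j-th entry of bU is r⟨v, eⱼ⟩, which vanishes for j ≠ 0.
  let v : EuclideanSpace ℂ (Fin (n + 1)) := WithLp.toLp 2 fun i => star (b i) / r
  have hbb : ∑ i, b i * star (b i) = (r : ℂ) ^ 2 := by
    have : (r : ℂ) ^ 2 = ((sqNorm b : ℝ) : ℂ) := by rw [← hr2]; push_cast; rfl
    rw [this, sqNorm]; push_cast
    refine Finset.sum_congr rfl fun i _ => ?_
    exact Complex.mul_conj (b i)
  have hnorm : ‖v‖ = 1 := by
    rw [EuclideanSpace.norm_eq, Real.sqrt_eq_one]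
    have : ∀ i, ‖v i‖ ^ 2 = Complex.normSq (b i) / r ^ 2 := by
      intro i
      simp [v, Complex.normSq_eq_norm_sq, div_pow]
    simp only [this]
    rw [← Finset.sum_div, ← sqNorm, hr2, div_self]
    rw [← hr2]; exact pow_ne_zero 2 hr0
  have hon : Orthonormal ℂ (({0} : Set (Fin (n + 1))).domRestrict fun _ => v) := by
    refine ⟨fun i => hnorm, fun i j hij => ?_⟩
    exact absurd (Subsingleton.elim i j) hij
  obtain ⟨e, he⟩ := hon.exists_orthonormalBasis_extension_of_card_eq (by simp)
  have he0 : e 0 = v := he 0 rfl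
  refine ⟨Matrix.of fun i j => e j i, ?_, ?_⟩
  · ext j k
    have := orthonormal_iff_ite.1 e.orthonormal j k
    rw [Matrix.one_apply, ← this, Matrix.mul_apply, PiLp.inner_apply]
    refine Finset.sum_congr rfl fun i _ => ?_
    simp [mul_comm]
  · have hin : ∀ j, inner ℂ (e 0) (e j) = (Matrix.vecMul b (Matrix.of fun i j => e j i)) j / r := by
      intro j
      rw [he0, PiLp.inner_apply, Matrix.vecMul, dotProduct, Finset.sum_div]
      refine Finset.sum_congr rfl fun i _ => ?_
      simp [v]; ring
    ext j
    have h1 := hin j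
    rw [orthonormal_iff_ite.1 e.orthonormal 0 j, eq_div_iff hrc] at h1
    rw [← h1]
    by_cases hj : j = 0
    · subst hj; simp
    · simp [hj, Ne.symm hj]

/-- The matrix `z - H`. -/
def shifted (x : HermitianCoords n) (z : ℂ) : Matrix (Fin n) (Fin n) ℂ :=
  Matrix.scalar (Fin n) z - hermitianMatrix x

/-- The characteristic polynomial `det (z - H)`. -/
def charDet (x : HermitianCoords n) (z : ℂ) : ℂ := (shifted x z).det

/-- Hermitian matrices have real spectrum: a null vector v of z - H makes v*Hv real and equal to
z|v|², so (Im z)|v|² = 0. -/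
lemma charDet_ne_zero (x : HermitianCoords n) {z : ℂ} (hz : z.im ≠ 0) : charDet x z ≠ 0 := by
  intro h
  obtain ⟨v, hv, h⟩ := Matrix.exists_mulVec_eq_zero_iff.2 h
  have h1 : (hermitianMatrix x).mulVec v = z • v := by
    rw [shifted, Matrix.sub_mulVec, sub_eq_zero] at h
    rw [← h]; ext i; simp [Matrix.mulVec_diagonal]
  have h2 := (isHermitian_hermitianMatrix x).im_star_dotProduct_mulVec_self v
  rw [h1, dotProduct_smul, smul_eq_mul] at h2
  have h3 : star v ⬝ᵥ v = ((sqNorm v : ℝ) : ℂ) := by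
    rw [dotProduct, sqNorm]; push_cast
    refine Finset.sum_congr rfl fun i _ => ?_
    exact (Complex.normSq_eq_conj_mul_self).symm
  rw [h3] at h2
  have h4 : z.im * sqNorm v = 0 := by simpa using h2
  have h5 : ∑ i, Complex.normSq (v i) = 0 := (mul_eq_zero.1 h4).resolve_left hz
  rw [Finset.sum_eq_zero_iff_of_nonneg fun i _ => Complex.normSq_nonneg _] at h5
  exact hv (funext fun i => Complex.normSq_eq_zero.1 (h5 i (Finset.mem_univ _)))

lemma star_charDet (x : HermitianCoords n) (z : ℂ) : star (charDet x z) = charDet x (star z) := by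
  rw [charDet, ← Matrix.det_conjTranspose, charDet, shifted, shifted, Matrix.conjTranspose_sub,
    (isHermitian_hermitianMatrix x).eq]
  congr 2
  simp [Matrix.scalar_apply, Matrix.diagonal_conjTranspose]

/-- Schur complement with respect to the lower right block. Writing it with the adjugate removes the
division by det A, so every term becomes polynomial in the entries. -/
lemma det_eq_of_bordered (M : Matrix (Fin (n + 1)) (Fin (n + 1)) ℂ)
    {A : Matrix (Fin n) (Fin n) ℂ} (hMA : ∀ i j, M i.succ j.succ = A i j) (hA : A.det ≠ 0) :
    M.det = M 0 0 * A.det -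
      (fun j : Fin n => M 0 j.succ) ⬝ᵥ A.adjugate.mulVec (fun i : Fin n => M i.succ 0) := by
  let e : Fin 1 ⊕ Fin n ≃ Fin (n + 1) := Equiv.ofBijective (Sum.elim (fun _ => 0) Fin.succ) (by
    constructor
    · rintro (i | i) (j | j) <;> simp [Fin.ext_iff]
    · intro i
      rcases Fin.eq_zero_or_eq_succ i with rfl | ⟨i, rfl⟩
      · exact ⟨Sum.inl 0, rfl⟩
      · exact ⟨Sum.inr i, rfl⟩)
  have hM : M.submatrix e e = Matrix.fromBlocks (Matrix.of fun _ _ => M 0 0)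
      (Matrix.of fun _ j => M 0 j.succ) (Matrix.of fun i _ => M i.succ 0) A := by
    ext (i | i) (j | j)
    · rfl
    · rfl
    · rfl
    · exact hMA i j
  have : Invertible A := Matrix.invertibleOfIsUnitDet A (isUnit_iff_ne_zero.2 hA)
  rw [← Matrix.det_submatrix_equiv_self e, hM, Matrix.det_fromBlocks₂₂, Matrix.det_fin_one,
    Matrix.sub_apply, mul_sub]
  have hadj : A.adjugate = A.det • ⅟A := by
    rw [Matrix.invOf_eq_nonsing_inv, Matrix.inv_def, smul_smul, Ring.mul_inverse_cancel _
      (isUnit_iff_ne_zero.2 hA), one_smul]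
  congr 1
  · simp [mul_comm]
  · rw [hadj, Matrix.smul_mulVec, dotProduct_smul, smul_eq_mul, Matrix.mul_assoc]
    rfl

lemma shifted_zero_zero (a : ℝ) (b : Fin n → ℂ) (x : HermitianCoords n) (z : ℂ) :
    shifted (bordered n (a, b, x)) z 0 0 = z - a := by
  simp [shifted, hermitianMatrix_bordered_zero_zero]

lemma shifted_zero_succ (a : ℝ) (b : Fin n → ℂ) (x : HermitianCoords n) (z : ℂ) (j : Fin n) :
    shifted (bordered n (a, b, x)) z 0 j.succ = - b j := by
  simp [shifted, hermitianMatrix_bordered_zero_succ,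
      Matrix.diagonal_apply_ne _ (Fin.succ_ne_zero j).symm]

lemma shifted_succ_zero (a : ℝ) (b : Fin n → ℂ) (x : HermitianCoords n) (z : ℂ) (j : Fin n) :
    shifted (bordered n (a, b, x)) z j.succ 0 = - star (b j) := by
  simp [shifted, hermitianMatrix_bordered_succ_zero]

lemma shifted_succ_succ (a : ℝ) (b : Fin n → ℂ) (x : HermitianCoords n) (z : ℂ) (i j : Fin n) :
    shifted (bordered n (a, b, x)) z i.succ j.succ = shifted x z i j := by
  simp [shifted, hermitianMatrix_bordered_succ_succ, Matrix.diagonal_apply]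

lemma charDet_bordered (a : ℝ) (b : Fin n → ℂ) (x : HermitianCoords n) {z : ℂ} (hz : z.im ≠ 0) :
    charDet (bordered n (a, b, x)) z =
      (z - a) * charDet x z - rowForm (shifted x z).adjugate b := by
  rw [charDet, det_eq_of_bordered _ (shifted_succ_succ a b x z) (charDet_ne_zero x hz)]
  simp only [shifted_zero_zero, shifted_zero_succ, shifted_succ_zero]
  congr 1
  rw [rowForm]
  change (-b) ⬝ᵥ Matrix.mulVec _ (-star b) = _
  rw [Matrix.mulVec_neg, neg_dotProduct_neg]

lemma adjugate_shifted_bordered_zero_zero (a : ℝ) (b : Fin n → ℂ) (x : HermitianCoords n) (z : ℂ) :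
    (shifted (bordered n (a, b, x)) z).adjugate 0 0 = charDet x z := by
  rw [Matrix.adjugate_fin_succ_eq_det_submatrix, charDet]
  simp only [Fin.val_zero, add_zero, pow_zero, one_mul]
  congr 1
  ext i j
  simp [shifted_succ_succ]

lemma shifted_conjCoords {U : Matrix (Fin n) (Fin n) ℂ} (hU : star U * U = 1)
    (x : HermitianCoords n) (z : ℂ) :
    shifted (conjCoords U x) z = U * shifted x z * star U := by
  have hU' : U * star U = 1 := mul_eq_one_comm.1 hU
  rw [shifted, shifted, hermitianMatrix_conjCoords, mul_sub, sub_mul,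
    ← (Matrix.scalar_commute z (fun r => Commute.all z r) U).eq, mul_assoc (Matrix.scalar (Fin n)
        z), hU', mul_one]

lemma charDet_conjCoords {U : Matrix (Fin n) (Fin n) ℂ} (hU : star U * U = 1)
    (x : HermitianCoords n) (z : ℂ) : charDet (conjCoords U x) z = charDet x z := by
  have hU' : U * star U = 1 := mul_eq_one_comm.1 hU
  rw [charDet, shifted_conjCoords hU, Matrix.det_mul, Matrix.det_mul, mul_right_comm,
    ← Matrix.det_mul, hU', Matrix.det_one, one_mul, charDet]

/-- The adjugate reverses products, and the adjugate of a unitary is its determinant times its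
adjoint; the two determinant phases cancel. -/
lemma adjugate_shifted_conjCoords {U : Matrix (Fin n) (Fin n) ℂ} (hU : star U * U = 1)
    (x : HermitianCoords n) (z : ℂ) :
    (shifted (conjCoords U x) z).adjugate = U * (shifted x z).adjugate * star U := by
  have hU' : U * star U = 1 := mul_eq_one_comm.1 hU
  have h1 : U.adjugate = U.det • star U := by
    have := congrArg (· * star U) (Matrix.adjugate_mul U)
    simpa [mul_assoc, hU'] using this
  have h2 : (star U).adjugate = (star U).det • U := by
    have := congrArg (· * U) (Matrix.adjugate_mul (star U))
    simpa [mul_assoc, hU] using this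
  have h3 : (star U).det * U.det = 1 := by rw [← Matrix.det_mul, hU, Matrix.det_one]
  rw [shifted_conjCoords hU, Matrix.adjugate_mul_distrib, Matrix.adjugate_mul_distrib, h1, h2,
    smul_mul_assoc, mul_smul_comm, mul_smul_comm, smul_smul, h3, one_smul, mul_assoc]

lemma rowForm_conj (U A : Matrix (Fin n) (Fin n) ℂ) (b : Fin n → ℂ) :
    rowForm (U * A * star U) b = rowForm A (Matrix.vecMul b U) := by
  rw [rowForm, rowForm, ← Matrix.mulVec_mulVec, ← Matrix.mulVec_mulVec, Matrix.dotProduct_mulVec,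
    Matrix.star_vecMul]
  rfl

lemma rowForm_single (A : Matrix (Fin n) (Fin n) ℂ) (i : Fin n) (c : ℂ) :
    rowForm A (Pi.single i c) = Complex.normSq c * A i i := by
  rw [rowForm, single_dotProduct]
  have : star (Pi.single i c : Fin n → ℂ) = Pi.single i (star c) := by
    ext j; by_cases h : j = i
    · subst h; simp
    · simp [h]
  rw [this, Matrix.mulVec_single, Complex.normSq_eq_conj_mul_self]
  simp; ring

end RankOneGUE
end

/-! ### Polynomial growth, integrability, and the rotated quadratic form -/

noncomputable section
namespace RankOneGUE
variable {n : ℕ}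

/-- The lower right block of a Hermitian matrix. -/
def minor (y : HermitianCoords (n + 1)) : HermitianCoords n :=
  (fun i => y.1 i.succ, fun p => y.2 (upperIndexEquiv n (Sum.inr p)))

lemma minor_bordered (a : ℝ) (b : Fin n → ℂ) (x : HermitianCoords n) :
    minor (bordered n (a, b, x)) = x := by
  ext i
  · rfl
  · exact bordered_snd_inr a b x i

@[fun_prop]
lemma continuous_minor : Continuous (minor : HermitianCoords (n + 1) → HermitianCoords n) := by
  unfold minor; fun_prop

lemma norm_minor_le (y : HermitianCoords (n + 1)) : ‖minor y‖ ≤ ‖y‖ := by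
  rw [Prod.norm_def, Prod.norm_def]
  refine max_le_max ?_ ?_
  · exact (pi_norm_le_iff_of_nonneg (norm_nonneg _)).2 fun i => norm_le_pi_norm y.1 _
  · exact (pi_norm_le_iff_of_nonneg (norm_nonneg _)).2 fun i => norm_le_pi_norm y.2 _

/-- Continuous functions of polynomial growth. -/
def PolyGrowth {E : Type*} [NormedAddCommGroup E] (f : E → ℂ) : Prop :=
  Continuous f ∧ ∃ (C : ℝ) (k : ℕ), 0 ≤ C ∧ ∀ x, ‖f x‖ ≤ C * (1 + ‖x‖) ^ k

lemma PolyGrowth.mul {E : Type*} [NormedAddCommGroup E] {f g : E → ℂ} (hf : PolyGrowth f)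
    (hg : PolyGrowth g) : PolyGrowth fun x => f x * g x := by
  obtain ⟨hf, C, k, hC, h⟩ := hf
  obtain ⟨hg, C', k', hC', h'⟩ := hg
  refine ⟨hf.mul hg, C * C', k + k', by positivity, fun x => ?_⟩
  rw [norm_mul, pow_add]
  calc ‖f x‖ * ‖g x‖ ≤ (C * (1 + ‖x‖) ^ k) * (C' * (1 + ‖x‖) ^ k') :=
        mul_le_mul (h x) (h' x) (norm_nonneg _) (by positivity)
    _ = _ := by ring

lemma norm_sq_le_traceSq (x : HermitianCoords n) : ‖x‖ ^ 2 ≤ traceSq x := by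
  have h1 := Finset.sum_nonneg (s := Finset.univ) fun i _ => sq_nonneg (x.1 i)
  have h2 := Finset.sum_nonneg (s := Finset.univ) fun i _ => Complex.normSq_nonneg (x.2 i)
  have h : ‖x‖ ≤ √(traceSq x) := by
    rw [Prod.norm_def]
    refine max_le ?_ ?_
    · refine (pi_norm_le_iff_of_nonneg (Real.sqrt_nonneg _)).2 fun i => Real.le_sqrt_of_sq_le ?_
      have := Finset.single_le_sum (f := fun i => x.1 i ^ 2) (fun i _ => sq_nonneg _)
        (Finset.mem_univ i)
      rw [Real.norm_eq_abs, sq_abs, traceSq]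
      linarith
    · refine (pi_norm_le_iff_of_nonneg (Real.sqrt_nonneg _)).2 fun i => Real.le_sqrt_of_sq_le ?_
      have := Finset.single_le_sum (f := fun i => Complex.normSq (x.2 i))
        (fun i _ => Complex.normSq_nonneg _) (Finset.mem_univ i)
      rw [← Complex.normSq_eq_norm_sq, traceSq]
      linarith
  calc ‖x‖ ^ 2 ≤ √(traceSq x) ^ 2 := by gcongr
    _ = traceSq x := Real.sq_sqrt (traceSq_nonneg x)

/-- Half of the Gaussian exponent absorbs the polynomial, and the other half is again a Gaussian of
finite mass, with parameter κ/2. -/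
lemma PolyGrowth.integrable {κ : ℝ} (hκ : 0 < κ) {f : HermitianCoords n → ℂ} (hf : PolyGrowth f) :
    Integrable f (hermitianGaussian κ n) := by
  obtain ⟨hc, C, k, hC, h⟩ := hf
  refine ⟨hc.measurable.aestronglyMeasurable, ?_⟩
  rw [HasFiniteIntegral, hermitianGaussian, lintegral_withDensity_eq_lintegral_mul _ (by fun_prop)
    (by fun_prop)]
  set B : ℝ := C * k.factorial * Real.exp (1 + 1 / κ) with hB
  have hbound : ∀ x : HermitianCoords n,
      Real.exp (-(κ / 2) * traceSq x) * ‖f x‖ ≤ B * Real.exp (-((κ / 2) / 2) * traceSq x) := by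
    intro x
    -- A power is at most k! times the exponential, and ‖x‖ ≤ 1/κ + κ‖x‖²/4 by completing the
    -- square; the coefficient κ/4 is exactly half of κ/2.
    have h1 : (1 + ‖x‖) ^ k ≤ k.factorial * Real.exp (1 + ‖x‖) := by
      have := Real.pow_div_factorial_le_exp (1 + ‖x‖) (by positivity) k
      rwa [div_le_iff₀ (by positivity), mul_comm] at this
    have h2 : ‖x‖ ≤ 1 / κ + κ / 4 * traceSq x := by
      have := norm_sq_le_traceSq x
      have h3 : ‖x‖ ≤ 1 / κ + κ / 4 * ‖x‖ ^ 2 := by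
        have : 0 ≤ (1 - κ / 2 * ‖x‖) ^ 2 / κ := by positivity
        have h4 : (1 - κ / 2 * ‖x‖) ^ 2 / κ = 1 / κ - ‖x‖ + κ / 4 * ‖x‖ ^ 2 := by
          field_simp; ring
        linarith
      have h5 : κ / 4 * ‖x‖ ^ 2 ≤ κ / 4 * traceSq x := by gcongr
      linarith
    calc Real.exp (-(κ / 2) * traceSq x) * ‖f x‖
        ≤ Real.exp (-(κ / 2) * traceSq x) * (C * (k.factorial * Real.exp (1 + ‖x‖))) := by
          gcongr; exact (h x).trans (by gcongr)
      _ ≤ Real.exp (-(κ / 2) * traceSq x) *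
          (C * (k.factorial * Real.exp ((1 + 1 / κ) + κ / 4 * traceSq x))) := by
          have h3 : Real.exp (1 + ‖x‖) ≤ Real.exp ((1 + 1 / κ) + κ / 4 * traceSq x) :=
            Real.exp_le_exp.2 (by linarith)
          gcongr _ * (_ * (_ * ?_))
      _ = B * (Real.exp (-(κ / 2) * traceSq x) * Real.exp (κ / 4 * traceSq x)) := by
          rw [Real.exp_add, hB]; ring
      _ = _ := by rw [← Real.exp_add]; congr 2; ring
  have hfin : ∫⁻ x : HermitianCoords n,
      ENNReal.ofReal (Real.exp (-((κ / 2) / 2) * traceSq x)) < ⊤ := by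
    have := hermitianGaussian_univ_eq (half_pos hκ) n
    rw [hermitianGaussian, withDensity_apply _ MeasurableSet.univ, Measure.restrict_univ] at this
    rw [this]; exact ENNReal.ofReal_lt_top
  calc _ ≤ ∫⁻ x : HermitianCoords n, ENNReal.ofReal B *
        ENNReal.ofReal (Real.exp (-((κ / 2) / 2) * traceSq x)) := by
        refine lintegral_mono fun x => ?_
        simp only [Pi.mul_apply]
        rw [← ofReal_norm, ← ENNReal.ofReal_mul (by positivity),
          ← ENNReal.ofReal_mul (by positivity)]
        exact ENNReal.ofReal_le_ofReal (hbound x)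
    _ < ⊤ := by
        rw [lintegral_const_mul _ (by fun_prop)]
        exact ENNReal.mul_lt_top ENNReal.ofReal_lt_top hfin

lemma continuous_hermitianMatrix :
    Continuous (hermitianMatrix : HermitianCoords n → Matrix (Fin n) (Fin n) ℂ) := by
  refine continuous_matrix fun i j => ?_
  unfold hermitianMatrix
  simp only [Matrix.of_apply]
  split_ifs
  · fun_prop
  · exact continuous_star.comp (by fun_prop)
  · exact Complex.continuous_ofReal.comp (by fun_prop)

@[fun_prop]
lemma continuous_shifted : Continuous fun p : HermitianCoords n × ℂ => shifted p.1 p.2 := by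
  unfold shifted
  refine Continuous.sub ?_ (continuous_hermitianMatrix.comp continuous_fst)
  simp only [Matrix.scalar_apply]
  exact Continuous.matrix_diagonal (by fun_prop)

lemma continuous_charDet : Continuous fun p : HermitianCoords n × ℂ => charDet p.1 p.2 :=
  continuous_shifted.matrix_det

lemma norm_hermitianMatrix_le (x : HermitianCoords n) (i j : Fin n) :
    ‖hermitianMatrix x i j‖ ≤ ‖x‖ := by
  rcases lt_trichotomy i j with h | rfl | h
  · rw [hermitianMatrix_apply_of_lt x h]
    exact (norm_le_pi_norm x.2 _).trans (norm_snd_le x)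
  · rw [hermitianMatrix_apply_self, Complex.norm_real]
    exact (norm_le_pi_norm x.1 _).trans (norm_fst_le x)
  · rw [hermitianMatrix_apply_of_gt x h, norm_star]
    exact (norm_le_pi_norm x.2 _).trans (norm_snd_le x)

lemma polyGrowth_charDet (z : ℂ) : PolyGrowth fun x : HermitianCoords n => charDet x z := by
  refine ⟨continuous_charDet.comp (by fun_prop : Continuous fun x : HermitianCoords n => (x, z)),
    n.factorial * (1 + ‖z‖) ^ n, n, by positivity, fun x => ?_⟩
  have h := Matrix.det_le (A := shifted x z) (abv := IsAbsoluteValue.toAbsoluteValue (norm : ℂ → ℝ))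
    (x := ‖z‖ + ‖x‖) (fun i j => by
      change ‖shifted x z i j‖ ≤ _
      rw [shifted, Matrix.sub_apply]
      refine (norm_sub_le _ _).trans (add_le_add ?_ (norm_hermitianMatrix_le x i j))
      by_cases hij : i = j
      · subst hij; simp
      · simp [Matrix.diagonal_apply_ne _ hij])
  have h : ‖charDet x z‖ ≤ n.factorial • (‖z‖ + ‖x‖) ^ n := by simpa [charDet] using h
  refine h.trans ?_
  rw [nsmul_eq_mul, mul_assoc, ← mul_pow]
  gcongr
  nlinarith [norm_nonneg z, norm_nonneg x]

lemma polyGrowth_charDet_minor (z : ℂ) :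
    PolyGrowth fun x : HermitianCoords (n + 1) => charDet (minor x) z := by
  obtain ⟨hc, C, k, hC, h⟩ := polyGrowth_charDet (n := n) z
  refine ⟨hc.comp continuous_minor, C, k, hC, fun x => (h _).trans ?_⟩
  gcongr
  exact norm_minor_le x

/-- After a rotation depending on the row `b`, the form `b adj(z - H) b*` becomes `|b|²` times the
characteristic polynomial of the lower right block. -/
lemma exists_rotation {κ : ℝ} (hκ : 0 < κ) (b : Fin (n + 1) → ℂ) :
    ∃ T : HermitianCoords (n + 1) → HermitianCoords (n + 1),
      MeasurePreserving T (hermitianGaussian κ (n + 1)) (hermitianGaussian κ (n + 1)) ∧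
      MeasurableEmbedding T ∧
      ∃ U : Matrix (Fin (n + 1)) (Fin (n + 1)) ℂ, star U * U = 1 ∧ T = conjCoords U ∧
      Matrix.vecMul b U = Pi.single 0 ((√(sqNorm b) : ℝ) : ℂ) ∧
      ∀ x z, charDet (T x) z = charDet x z ∧
        rowForm (shifted (T x) z).adjugate b = sqNorm b * charDet (minor x) z := by
  obtain ⟨U, hU, hb⟩ := exists_unitary_vecMul_eq b
  have hinj : Function.Injective (conjCoords U) := by
    rw [injective_iff_map_eq_zero]
    intro x hx
    apply eq_zero_of_traceSq_eq_zero
    rw [← traceSq_conjCoords hU, hx]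
    simp [traceSq]
  have hcont : Continuous (conjCoords U) := LinearMap.continuous_of_finiteDimensional _
  refine ⟨conjCoords U, measurePreserving_conjCoords hκ hU, hcont.measurableEmbedding hinj,
    U, hU, rfl, hb, fun x z => ⟨charDet_conjCoords hU x z, ?_⟩⟩
  rw [adjugate_shifted_conjCoords hU, rowForm_conj, hb, rowForm_single]
  obtain ⟨⟨a, b', x⟩, rfl⟩ := (bordered n).surjective x
  rw [adjugate_shifted_bordered_zero_zero, minor_bordered, Complex.normSq_ofReal,
    Real.mul_self_sqrt (sqNorm_nonneg b)]

end RankOneGUE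
end

/-! ### Recursions in the size for determinant correlations -/

noncomputable section
namespace RankOneGUE
variable {n : ℕ} {κ : ℝ}

lemma integral_linearCombination {X : Type*} [MeasurableSpace X] {μ : Measure X}
    {f g h k : X → ℂ} (hf : Integrable f μ) (hg : Integrable g μ) (hh : Integrable h μ)
    (hk : Integrable k μ) (c₁ c₂ c₃ c₄ : ℂ) :
    ∫ x, (c₁ * f x + c₂ * g x + c₃ * h x + c₄ * k x) ∂μ =
      c₁ * ∫ x, f x ∂μ + c₂ * ∫ x, g x ∂μ + c₃ * ∫ x, h x ∂μ + c₄ * ∫ x, k x ∂μ := by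
  have h2 : Integrable (fun x => c₁ * f x + c₂ * g x) μ := (hf.const_mul c₁).add (hg.const_mul c₂)
  have h3 : Integrable (fun x => c₁ * f x + c₂ * g x + c₃ * h x) μ := h2.add (hh.const_mul c₃)
  rw [integral_add h3 (hk.const_mul c₄), integral_add h2 (hh.const_mul c₃),
    integral_add (hf.const_mul c₁) (hg.const_mul c₂)]
  simp only [integral_const_mul]

/-- This brings in the mean 0 and variance 1/κ of the standard Gaussian measure. -/
lemma lineGaussian_eq_smul (hκ : 0 < κ) :
    lineGaussian κ = ENNReal.ofReal √(2 * Real.pi / κ) •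
      ProbabilityTheory.gaussianReal 0 κ⁻¹.toNNReal := by
  have hv : κ⁻¹.toNNReal ≠ 0 := by simpa using hκ
  rw [ProbabilityTheory.gaussianReal_of_var_ne_zero _ hv, lineGaussian,
    ← withDensity_smul _ (ProbabilityTheory.measurable_gaussianPDF _ _)]
  congr 1
  ext a
  rw [Pi.smul_apply, smul_eq_mul, ProbabilityTheory.gaussianPDF, ProbabilityTheory.gaussianPDFReal,
    ← ENNReal.ofReal_mul (by positivity), ← mul_assoc]
  congr 1
  have h1 : √(2 * Real.pi / κ) * (√(2 * Real.pi * κ⁻¹))⁻¹ = 1 := by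
    rw [← div_eq_mul_inv]
    exact mul_inv_cancel₀ (by positivity)
  rw [Real.coe_toNNReal _ (inv_pos.2 hκ).le, h1, one_mul]
  congr 1
  field_simp
  ring

lemma integral_lineGaussian (hκ : 0 < κ) (c₀ c₁ c₂ : ℂ) :
    ∫ a, (c₀ + c₁ * (a : ℂ) + c₂ * (a : ℂ) ^ 2) ∂(lineGaussian κ) =
      (√(2 * Real.pi / κ) : ℝ) * (c₀ + c₂ / κ) := by
  have h1 : Integrable (fun a : ℝ => (a : ℂ)) (ProbabilityTheory.gaussianReal 0
      κ⁻¹.toNNReal) := by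
    have := (ProbabilityTheory.memLp_id_gaussianReal (μ := 0) (v := κ⁻¹.toNNReal) 1)
    exact (memLp_one_iff_integrable.1 (by exact_mod_cast this)).ofReal
  have h2 : Integrable (fun a : ℝ => a ^ 2) (ProbabilityTheory.gaussianReal 0
      κ⁻¹.toNNReal) := by
    have := (ProbabilityTheory.memLp_id_gaussianReal (μ := 0) (v := κ⁻¹.toNNReal) 2)
    exact MemLp.integrable_sq (f := fun a : ℝ => a) (by exact_mod_cast this)
  have h2' : Integrable (fun a : ℝ => (a : ℂ) ^ 2) (ProbabilityTheory.gaussianReal 0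
      κ⁻¹.toNNReal) := by
    simpa using h2.ofReal (𝕜 := ℂ)
  rw [lineGaussian_eq_smul hκ, integral_smul_measure, ENNReal.toReal_ofReal (by positivity)]
  have hl := integral_linearCombination (integrable_const (1 : ℂ)) h1 h2' h2' c₀ c₁ c₂ 0
  simp only [mul_one, zero_mul, add_zero] at hl
  rw [hl]
  have e1 : ∫ a : ℝ, (a : ℂ) ∂(ProbabilityTheory.gaussianReal 0 κ⁻¹.toNNReal) = 0 := by
    rw [integral_complex_ofReal, ProbabilityTheory.integral_id_gaussianReal]; simp
  have e2 : ∫ a : ℝ, (a : ℂ) ^ 2 ∂(ProbabilityTheory.gaussianReal 0 κ⁻¹.toNNReal) =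
      (κ⁻¹ : ℝ) := by
    have h := ProbabilityTheory.variance_fun_id_gaussianReal (μ := 0)
      (v := κ⁻¹.toNNReal)
    rw [ProbabilityTheory.variance_eq_integral (by fun_prop)] at h
    simp only [ProbabilityTheory.integral_id_gaussianReal, sub_zero] at h
    have h3 : ∀ a : ℝ, (a : ℂ) ^ 2 = ((a ^ 2 : ℝ) : ℂ) := fun a => by push_cast; rfl
    simp only [h3]
    rw [integral_complex_ofReal, h, Real.coe_toNNReal _ (inv_pos.2 hκ).le]
  rw [e1, e2]
  simp [div_eq_mul_inv]
  ring

lemma integrable_sqNorm_pow (hκ : 0 < κ) (n j : ℕ) :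
    Integrable (fun b => sqNorm b ^ j) (rowGaussian κ (n + 1)) := by
  refine ⟨by fun_prop, ?_⟩
  rw [HasFiniteIntegral]
  have : ∀ b : Fin (n + 1) → ℂ, ‖sqNorm b ^ j‖ₑ = ENNReal.ofReal (sqNorm b ^ j) := fun b => by
    rw [← ofReal_norm, Real.norm_of_nonneg (pow_nonneg (sqNorm_nonneg b) j)]
  simp only [this]
  rw [lintegral_sqNorm_pow_rowGaussian hκ]
  exact ENNReal.ofReal_lt_top

lemma integral_sqNorm_pow (hκ : 0 < κ) (n j : ℕ) :
    ∫ b, sqNorm b ^ j ∂(rowGaussian κ (n + 1)) =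
      (Real.pi / κ) ^ (n + 1) * ((n + j).factorial / n.factorial / κ ^ j) := by
  rw [integral_eq_lintegral_of_nonneg_ae (ae_of_all _ fun b => pow_nonneg (sqNorm_nonneg b) j)
    (by fun_prop), lintegral_sqNorm_pow_rowGaussian hκ, ENNReal.toReal_ofReal (by positivity)]

/-- Under the normalised row measure |b|² is a Gamma variable of shape n + 1 and rate κ, with first
two moments (n+1)/κ and (n+1)(n+2)/κ². -/
lemma integral_rowGaussian (hκ : 0 < κ) (n : ℕ) (c₀ c₁ c₂ : ℂ) :
    ∫ b, (c₀ + c₁ * (sqNorm b : ℂ) + c₂ * (sqNorm b : ℂ) ^ 2) ∂(rowGaussian κ (n + 1)) =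
      ((Real.pi / κ) ^ (n + 1) : ℝ) *
        (c₀ + c₁ * ((n + 1) / κ) + c₂ * ((n + 1) * (n + 2) / κ ^ 2)) := by
  have hi : ∀ j, Integrable (fun b => (sqNorm b : ℂ) ^ j) (rowGaussian κ (n + 1)) := fun j => by
    simpa using (integrable_sqNorm_pow hκ n j).ofReal (𝕜 := ℂ)
  have he : ∀ j, ∫ b, (sqNorm b : ℂ) ^ j ∂(rowGaussian κ (n + 1)) =
      ((Real.pi / κ) ^ (n + 1) * ((n + j).factorial / n.factorial / κ ^ j) : ℝ) := fun j => by
    have h3 : ∀ b : Fin (n + 1) → ℂ, (sqNorm b : ℂ) ^ j = ((sqNorm b ^ j : ℝ) : ℂ) := fun a => by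
      push_cast; rfl
    simp only [h3]
    rw [integral_complex_ofReal, integral_sqNorm_pow hκ]
  have hf : (n.factorial : ℝ) ≠ 0 := by positivity
  have e0 := he 0
  have e1 := he 1
  simp only [pow_one] at e1
  simp only [pow_zero] at e0
  have hl := integral_linearCombination (hi 0) (hi 1) (hi 2) (hi 2) c₀ c₁ c₂ 0
  simp only [pow_one, pow_zero, mul_one, zero_mul, add_zero] at hl
  rw [hl, e1, he 2]
  have f0 : ((n + 0).factorial : ℝ) / n.factorial / 1 = 1 := by
    simp [div_self hf]
  have f1 : ((n + 1).factorial : ℝ) / n.factorial / κ = (n + 1) / κ := by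
    rw [Nat.factorial_succ]; push_cast; field_simp
  have f2 : ((n + 2).factorial : ℝ) / n.factorial / κ ^ 2 = (n + 1) * (n + 2) / κ ^ 2 := by
    rw [Nat.factorial_succ, Nat.factorial_succ]; push_cast; field_simp; ring
  rw [e0, f0, f1, f2]
  push_cast
  ring

lemma integral_bordered {F : HermitianCoords (n + 1) → ℂ}
    (hF : Integrable F (hermitianGaussian κ (n + 1))) :
    ∫ y, F y ∂(hermitianGaussian κ (n + 1)) =
      ∫ a, ∫ b, ∫ x, F (bordered n (a, b, x)) ∂(hermitianGaussian κ n) ∂(rowGaussian κ n)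
        ∂(lineGaussian κ) := by
  have hmp := measurePreserving_bordered_gaussian κ n
  have hF' := (hmp.integrable_comp_emb (bordered n).measurableEmbedding).2 hF
  rw [← hmp.integral_comp (bordered n).measurableEmbedding]
  refine (integral_prod _ hF').trans ?_
  refine integral_congr_ae ?_
  filter_upwards [hF'.prod_right_ae] with a ha
  exact integral_prod _ ha

/-- Correlations of characteristic polynomials of the Gaussian ensemble. -/
def detCorr (κ : ℝ) (n : ℕ) (z w : ℂ) : ℂ :=
  (∫ x, charDet x z * charDet x w ∂(hermitianGaussian κ n)) / gaussianMass κ n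

/-- Correlations of the characteristic polynomials of a Gaussian matrix and of its lower right
block. -/
def detMinorCorr (κ : ℝ) (n : ℕ) (z w : ℂ) : ℂ :=
  (∫ y, charDet y z * charDet (minor y) w ∂(hermitianGaussian κ (n + 1))) / gaussianMass κ (n + 1)

/-- The rotation supplied by `exists_rotation` depends on b but not on the spectral parameter, so a
single change of variables treats the forms at z and at w together. -/
lemma integral_comp_rotation {b : Fin (n + 1) → ℂ} (hκ : 0 < κ)
    (G : ℂ → ℂ → ℂ → ℂ → ℂ) (z w : ℂ) :
    ∫ x, G (charDet x z) (charDet x w) (rowForm (shifted x z).adjugate b)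
      (rowForm (shifted x w).adjugate b) ∂(hermitianGaussian κ (n + 1)) =
    ∫ x, G (charDet x z) (charDet x w) (sqNorm b * charDet (minor x) z)
      (sqNorm b * charDet (minor x) w) ∂(hermitianGaussian κ (n + 1)) := by
  obtain ⟨T, hT, hTe, -, -, -, -, h⟩ := exists_rotation hκ b
  rw [← hT.integral_comp hTe]
  simp only [(h _ _).1, (h _ _).2]

variable {z w : ℂ}

lemma gaussianMass_ne_zero (hκ : 0 < κ) (n : ℕ) : (gaussianMass κ n : ℂ) ≠ 0 := by
  exact_mod_cast (gaussianMass_pos hκ n).ne'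

lemma gaussianMass_succ_complex (hκ : 0 < κ) (n : ℕ) : (gaussianMass κ (n + 1) : ℂ) =
    (√(2 * Real.pi / κ) : ℝ) * ((Real.pi / κ) ^ n : ℝ) * gaussianMass κ n := by
  rw [gaussianMass_succ hκ]; push_cast; ring

lemma integrable_of_minor (hκ : 0 < κ) (z w : ℂ) :
    Integrable (fun y : HermitianCoords (n + 1) => charDet (minor y) z * charDet (minor y) w)
      (hermitianGaussian κ (n + 1)) :=
  ((polyGrowth_charDet_minor z).mul (polyGrowth_charDet_minor w)).integrable hκ

/-- The block of a Gaussian matrix is Gaussian. -/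
lemma integral_minor_minor (hκ : 0 < κ) (z w : ℂ) :
    ∫ y, charDet (minor y) z * charDet (minor y) w ∂(hermitianGaussian κ (n + 1)) =
      detCorr κ n z w * gaussianMass κ (n + 1) := by
  rw [integral_bordered (integrable_of_minor hκ z w)]
  simp only [minor_bordered, integral_const]
  rw [measureReal_def, measureReal_def, lineGaussian_univ hκ, rowGaussian_univ hκ,
    ENNReal.toReal_ofReal (by positivity), ENNReal.toReal_ofReal (by positivity),
    gaussianMass_succ_complex hκ, detCorr]
  have := gaussianMass_ne_zero hκ n
  simp only [Complex.real_smul]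
  field_simp

/-- Expand the determinant at z along the first row. The corner has mean zero, and after rotation
the row contributes |b|² with mean (n+1)/κ. The roles of z and w are exchanged in the last term
because the minor now comes from the factor at z. -/
lemma detMinorCorr_succ (hκ : 0 < κ) (hz : z.im ≠ 0) (n : ℕ) :
    detMinorCorr κ (n + 1) z w =
      z * detCorr κ (n + 1) z w - (n + 1) / κ * detMinorCorr κ n w z := by
  have hi := ((polyGrowth_charDet (n := n + 2) z).mul (polyGrowth_charDet_minor w)).integrable hκ
  have i1 := ((polyGrowth_charDet (n := n + 1) z).mul (polyGrowth_charDet w)).integrable hκ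
  have i2 := ((polyGrowth_charDet (n := n + 1) w).mul (polyGrowth_charDet_minor z)).integrable hκ
  set k1 := ∫ x, charDet x z * charDet x w ∂(hermitianGaussian κ (n + 1)) with hk1
  set l := ∫ y, charDet y w * charDet (minor y) z ∂(hermitianGaussian κ (n + 1)) with hl
  have hin : ∀ (a : ℝ) (b : Fin (n + 1) → ℂ), ∫ x, charDet (bordered (n + 1) (a, b, x)) z *
      charDet (minor (bordered (n + 1) (a, b, x))) w ∂(hermitianGaussian κ (n + 1)) =
      (z - a) * k1 + (-l) * sqNorm b + 0 * (sqNorm b : ℂ) ^ 2 := by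
    intro a b
    simp only [minor_bordered, charDet_bordered _ _ _ hz]
    rw [integral_comp_rotation hκ (fun p q r _ => ((z - a) * p - r) * q) z w]
    have : ∀ x : HermitianCoords (n + 1), ((z - a) * charDet x z - sqNorm b * charDet (minor x) z) *
        charDet x w = (z - a) * (charDet x z * charDet x w) -
        sqNorm b * (charDet x w * charDet (minor x) z) := fun x => by ring
    simp only [this]
    rw [integral_sub (i1.const_mul _) (i2.const_mul _), integral_const_mul, integral_const_mul]
    ring
  have e : ∫ y, charDet y z * charDet (minor y) w ∂(hermitianGaussian κ (n + 2)) =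
      (√(2 * Real.pi / κ) : ℝ) * ((Real.pi / κ) ^ (n + 1) : ℝ) * (z * k1 - (n + 1) / κ * l) := by
    rw [integral_bordered hi]
    simp only [hin, integral_rowGaussian hκ]
    have : ∀ a : ℝ, (((Real.pi / κ) ^ (n + 1) : ℝ) : ℂ) * ((z - a) * k1 + -l * ((n + 1) / κ) +
        0 * ((n + 1) * (n + 2) / κ ^ 2)) =
        ((Real.pi / κ) ^ (n + 1) : ℝ) * (z * k1 - (n + 1) / κ * l) +
        (-((Real.pi / κ) ^ (n + 1) : ℝ) * k1) * a + 0 * (a : ℂ) ^ 2 := fun a => by ring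
    simp only [this]
    rw [integral_lineGaussian hκ]
    ring
  rw [detMinorCorr, e, detCorr, detMinorCorr, ← hk1, ← hl, gaussianMass_succ_complex hκ (n + 1)]
  have h1 := gaussianMass_ne_zero hκ (n + 1)
  have h2 : ((√(2 * Real.pi / κ) : ℝ) : ℂ) ≠ 0 := by
    have : √(2 * Real.pi / κ) ≠ 0 := by positivity
    exact_mod_cast this
  have h3 : (((Real.pi / κ) ^ (n + 1) : ℝ) : ℂ) ≠ 0 := by
    have : (Real.pi / κ) ^ (n + 1) ≠ 0 := by positivity
    exact_mod_cast this
  rw [mul_div_mul_left _ _ (mul_ne_zero h2 h3)]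
  ring

/-- Both determinants are expanded along the first row and multiplied out. The term 1/κ is the
variance of the corner, and the other coefficients are the first two moments of |b|². With
`detMinorCorr_succ` the system of recursions closes. -/
lemma detCorr_succ_succ (hκ : 0 < κ) (hz : z.im ≠ 0) (hw : w.im ≠ 0) (n : ℕ) :
    detCorr κ (n + 2) z w =
      (z * w + 1 / κ) * detCorr κ (n + 1) z w
        - (n + 1) / κ * (z * detMinorCorr κ n z w + w * detMinorCorr κ n w z)
        + (n + 1) * (n + 2) / κ ^ 2 * detCorr κ n z w := by
  have hi := ((polyGrowth_charDet (n := n + 2) z).mul (polyGrowth_charDet w)).integrable hκ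
  have i1 := ((polyGrowth_charDet (n := n + 1) z).mul (polyGrowth_charDet w)).integrable hκ
  have i2 := ((polyGrowth_charDet (n := n + 1) w).mul (polyGrowth_charDet_minor z)).integrable hκ
  have i2' := ((polyGrowth_charDet (n := n + 1) z).mul (polyGrowth_charDet_minor w)).integrable hκ
  have i3 := integrable_of_minor (n := n) hκ z w
  set k1 := ∫ x, charDet x z * charDet x w ∂(hermitianGaussian κ (n + 1)) with hk1
  set l := ∫ y, charDet y w * charDet (minor y) z ∂(hermitianGaussian κ (n + 1)) with hl
  set l' := ∫ y, charDet y z * charDet (minor y) w ∂(hermitianGaussian κ (n + 1)) with hl'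
  set k0 := ∫ y, charDet (minor y) z * charDet (minor y) w ∂(hermitianGaussian κ (n + 1)) with hk0
  have hin : ∀ (a : ℝ) (b : Fin (n + 1) → ℂ), ∫ x, charDet (bordered (n + 1) (a, b, x)) z *
      charDet (bordered (n + 1) (a, b, x)) w ∂(hermitianGaussian κ (n + 1)) =
      (z - a) * (w - a) * k1 + (-((z - a) * l' + (w - a) * l)) * sqNorm b +
        k0 * (sqNorm b : ℂ) ^ 2 := by
    intro a b
    simp only [charDet_bordered _ _ _ hz, charDet_bordered _ _ _ hw]
    rw [integral_comp_rotation hκ (fun p q r s => ((z - a) * p - r) * ((w - a) * q - s)) z w]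
    have : ∀ x : HermitianCoords (n + 1), ((z - a) * charDet x z - sqNorm b * charDet (minor x) z) *
        ((w - a) * charDet x w - sqNorm b * charDet (minor x) w) =
        (z - a) * (w - a) * (charDet x z * charDet x w) +
        (-((z - a) * sqNorm b)) * (charDet x z * charDet (minor x) w) +
        (-((w - a) * sqNorm b)) * (charDet x w * charDet (minor x) z) +
        (sqNorm b : ℂ) ^ 2 * (charDet (minor x) z * charDet (minor x) w) := fun x => by ring
    simp only [this]
    rw [integral_linearCombination i1 i2' i2 i3]
    ring
  have e : ∫ y, charDet y z * charDet y w ∂(hermitianGaussian κ (n + 2)) =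
      (√(2 * Real.pi / κ) : ℝ) * ((Real.pi / κ) ^ (n + 1) : ℝ) * ((z * w + 1 / κ) * k1
        - (n + 1) / κ * (z * l' + w * l) + (n + 1) * (n + 2) / κ ^ 2 * k0) := by
    rw [integral_bordered hi]
    simp only [hin, integral_rowGaussian hκ]
    have : ∀ a : ℝ, (((Real.pi / κ) ^ (n + 1) : ℝ) : ℂ) * ((z - a) * (w - a) * k1 +
        -((z - a) * l' + (w - a) * l) * ((n + 1) / κ) + k0 * ((n + 1) * (n + 2) / κ ^ 2)) =
        ((Real.pi / κ) ^ (n + 1) : ℝ) * (z * w * k1 - (n + 1) / κ * (z * l' + w * l) +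
          (n + 1) * (n + 2) / κ ^ 2 * k0) +
        (((Real.pi / κ) ^ (n + 1) : ℝ) * (-(z + w) * k1 + (l' + l) * ((n + 1) / κ))) * a +
        (((Real.pi / κ) ^ (n + 1) : ℝ) * k1) * (a : ℂ) ^ 2 := fun a => by ring
    simp only [this]
    rw [integral_lineGaussian hκ]
    ring
  rw [detCorr, e, detCorr, detMinorCorr, detMinorCorr, ← hk1, ← hl, ← hl',
    gaussianMass_succ_complex hκ (n + 1)]
  have h0 : detCorr κ n z w = k0 / gaussianMass κ (n + 1) := by
    rw [hk0, integral_minor_minor hκ, mul_div_cancel_right₀ _ (gaussianMass_ne_zero hκ _)]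
  rw [h0]
  have h1 := gaussianMass_ne_zero hκ (n + 1)
  have h2 : ((√(2 * Real.pi / κ) : ℝ) : ℂ) ≠ 0 := by
    have : √(2 * Real.pi / κ) ≠ 0 := by positivity
    exact_mod_cast this
  have h3 : (((Real.pi / κ) ^ (n + 1) : ℝ) : ℂ) ≠ 0 := by
    have : (Real.pi / κ) ^ (n + 1) ≠ 0 := by positivity
    exact_mod_cast this
  rw [mul_div_mul_left _ _ (mul_ne_zero h2 h3)]
  ring

lemma charDet_fin_zero (x : HermitianCoords 0) (z : ℂ) : charDet x z = 1 := by
  simp [charDet]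

lemma detCorr_zero (hκ : 0 < κ) : detCorr κ 0 z w = 1 := by
  have := gaussianMass_ne_zero hκ 0
  rw [detCorr]
  simp only [charDet_fin_zero, mul_one, integral_const, Complex.real_smul]
  exact div_self this

lemma charDet_fin_one (hz : z.im ≠ 0) (a : ℝ) (b : Fin 0 → ℂ) (x : HermitianCoords 0) :
    charDet (bordered 0 (a, b, x)) z = z - a := by
  rw [charDet_bordered _ _ _ hz, charDet_fin_zero]
  simp [rowForm]

lemma detMinorCorr_zero (hκ : 0 < κ) (hz : z.im ≠ 0) : detMinorCorr κ 0 z w = z := by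
  have hi := ((polyGrowth_charDet (n := 1) z).mul (polyGrowth_charDet_minor w)).integrable hκ
  rw [detMinorCorr, integral_bordered hi]
  simp only [minor_bordered, charDet_fin_zero, charDet_fin_one hz, mul_one, integral_const,
    measureReal_def, rowGaussian_univ hκ]
  rw [gaussianMass_succ_complex hκ]
  have h1 : ∀ a : ℝ, (z - a) = z + (-1) * (a : ℂ) + 0 * (a : ℂ) ^ 2 := fun a => by ring
  have h2 : ((√(2 * Real.pi / κ) : ℝ) : ℂ) ≠ 0 := by
    have : √(2 * Real.pi / κ) ≠ 0 := by positivity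
    exact_mod_cast this
  have h3 := gaussianMass_ne_zero hκ 0
  simp only [pow_zero, ENNReal.ofReal_one, ENNReal.toReal_one, one_smul, Complex.real_smul]
  rw [integral_const_mul, integral_congr_ae (ae_of_all _ h1), integral_lineGaussian hκ]
  change (gaussianMass κ 0 : ℂ) * _ / _ = _
  field_simp
  simp

lemma detCorr_one (hκ : 0 < κ) (hz : z.im ≠ 0) (hw : w.im ≠ 0) :
    detCorr κ 1 z w = z * w + 1 / κ := by
  have hi := ((polyGrowth_charDet (n := 1) z).mul (polyGrowth_charDet w)).integrable hκ
  rw [detCorr, integral_bordered hi]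
  simp only [charDet_fin_one hz, charDet_fin_one hw, integral_const,
    measureReal_def, rowGaussian_univ hκ]
  rw [gaussianMass_succ_complex hκ]
  have h1 : ∀ a : ℝ, (z - a) * (w - a) = z * w + (-(z + w)) * (a : ℂ) + 1 * (a : ℂ) ^ 2 :=
    fun a => by ring
  have h2 : ((√(2 * Real.pi / κ) : ℝ) : ℂ) ≠ 0 := by
    have : √(2 * Real.pi / κ) ≠ 0 := by positivity
    exact_mod_cast this
  have h3 := gaussianMass_ne_zero hκ 0
  simp only [pow_zero, ENNReal.ofReal_one, ENNReal.toReal_one, one_smul, Complex.real_smul]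
  rw [integral_const_mul, integral_congr_ae (ae_of_all _ h1), integral_lineGaussian hκ]
  change (gaussianMass κ 0 : ℂ) * _ / _ = _
  field_simp
  simp

end RankOneGUE
end

/-! ### Hermite polynomials and Christoffel–Darboux kernels -/

noncomputable section
namespace RankOneGUE
variable {n : ℕ} {κ : ℝ} {z w : ℂ}

/-- The monic orthogonal polynomials of the weight `exp (-κ x²/2)`. -/
def monicHermite (κ : ℝ) (z : ℂ) : ℕ → ℂ
  | 0 => 1
  | 1 => z
  | k + 2 => z * monicHermite κ z (k + 1) - (k + 1) / κ * monicHermite κ z k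

lemma monicHermite_succ_succ (κ : ℝ) (z : ℂ) (k : ℕ) : monicHermite κ z (k + 2) =
    z * monicHermite κ z (k + 1) - (k + 1) / κ * monicHermite κ z k := rfl

/-- The normalised product of two orthogonal polynomials. -/
def hermiteTerm (κ : ℝ) (z w : ℂ) (k : ℕ) : ℂ :=
  (κ : ℂ) ^ k / k.factorial * (monicHermite κ z k * monicHermite κ w k)

/-- The Christoffel–Darboux kernel. -/
def hermiteKernel (κ : ℝ) (z w : ℂ) (n : ℕ) : ℂ := ∑ k ∈ Finset.range (n + 1), hermiteTerm κ z w k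

lemma hermiteKernel_succ (κ : ℝ) (z w : ℂ) (n : ℕ) :
    hermiteKernel κ z w (n + 1) = hermiteKernel κ z w n + hermiteTerm κ z w (n + 1) :=
  Finset.sum_range_succ _ _

/-- The kernel with one index shifted. -/
def shiftedKernel (κ : ℝ) (z w : ℂ) (n : ℕ) : ℂ :=
  ∑ k ∈ Finset.range (n + 1),
    (κ : ℂ) ^ k / k.factorial * (monicHermite κ z (k + 1) * monicHermite κ w k)

lemma shiftedKernel_succ (κ : ℝ) (z w : ℂ) (n : ℕ) :
    shiftedKernel κ z w (n + 1) = shiftedKernel κ z w n +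
      (κ : ℂ) ^ (n + 1) / (n + 1).factorial *
        (monicHermite κ z (n + 2) * monicHermite κ w (n + 1)) :=
  Finset.sum_range_succ _ _

/-- This is the three-term recurrence summed against the weights: multiplying κᵏ/k! by k/κ gives the
weight of index k - 1, so the lower-order terms rebuild a shifted kernel with z and w exchanged. It
mirrors `detMinorCorr_succ`. -/
lemma shiftedKernel_succ_eq (hκ : κ ≠ 0) (z w : ℂ) (n : ℕ) :
    shiftedKernel κ z w (n + 1) = z * hermiteKernel κ z w (n + 1) - shiftedKernel κ w z n := by
  have hk : (κ : ℂ) ≠ 0 := by exact_mod_cast hκ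
  induction n with
  | zero =>
    simp [shiftedKernel, hermiteKernel, Finset.sum_range_succ, hermiteTerm, monicHermite]
    field_simp
    ring
  | succ n ih =>
    rw [shiftedKernel_succ, ih, hermiteKernel_succ κ z w (n + 1), shiftedKernel_succ κ w z n,
      monicHermite_succ_succ κ z (n + 1), hermiteTerm, Nat.factorial_succ (n + 1)]
    push_cast
    have h1 : ((n + 1).factorial : ℂ) ≠ 0 := by exact_mod_cast (n + 1).factorial_ne_zero
    have h2 : (n : ℂ) + 1 + 1 ≠ 0 := by exact_mod_cast (n + 1).succ_ne_zero
    field_simp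
    ring

/-- The polynomial counterpart of `detCorr_succ_succ` with the factor n!/κⁿ removed. The increment
in n is the identity `key` between single terms, which follows from the three-term recurrences at z
and at w. -/
lemma hermiteKernel_rec (hκ : κ ≠ 0) (z w : ℂ) (n : ℕ) :
    (n + 2) * hermiteKernel κ z w (n + 2) =
      (κ * (z * w) + 1) * hermiteKernel κ z w (n + 1)
        - κ * (z * shiftedKernel κ z w n + w * shiftedKernel κ w z n)
        + (n + 2) * hermiteKernel κ z w n := by
  have hk : (κ : ℂ) ≠ 0 := by exact_mod_cast hκ
  induction n with
  | zero =>
    simp [shiftedKernel, hermiteKernel, Finset.sum_range_succ, hermiteTerm, monicHermite]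
    field_simp
    ring
  | succ n ih =>
    have key : ((n : ℂ) + 3) * hermiteTerm κ z w (n + 3) =
        κ * (z * w) * hermiteTerm κ z w (n + 2)
        - κ * ((κ : ℂ) ^ (n + 1) / (n + 1).factorial) *
          (z * (monicHermite κ z (n + 2) * monicHermite κ w (n + 1)) +
            w * (monicHermite κ w (n + 2) * monicHermite κ z (n + 1)))
        + (n + 2) * hermiteTerm κ z w (n + 1) := by
      simp only [hermiteTerm]
      rw [monicHermite_succ_succ κ z (n + 1), monicHermite_succ_succ κ w (n + 1),
        Nat.factorial_succ (n + 2), Nat.factorial_succ (n + 1)]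
      push_cast
      have h1 : ((n + 1).factorial : ℂ) ≠ 0 := by exact_mod_cast (n + 1).factorial_ne_zero
      have h2 : (n : ℂ) + 1 + 1 ≠ 0 := by exact_mod_cast (n + 1).succ_ne_zero
      have h3 : (n : ℂ) + 2 + 1 ≠ 0 := by exact_mod_cast (n + 2).succ_ne_zero
      field_simp
      ring
    have e1 := hermiteKernel_succ κ z w (n + 2)
    have e2 := hermiteKernel_succ κ z w (n + 1)
    have e3 := hermiteKernel_succ κ z w n
    have e4 := shiftedKernel_succ κ z w n
    have e5 := shiftedKernel_succ κ w z n
    simp only [add_assoc, Nat.reduceAdd] at *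
    push_cast
    rw [e1, e4, e5]
    linear_combination ih + key - e2 * (κ * (z * w)) - e3 * (n + 2)

/-- Determinant correlations and kernels satisfy the same recursions and initial values. The
induction carries two consecutive sizes because the recursion is of second order, and it quantifies
over z and w because the minor correlation exchanges them. -/
lemma hermite_closed_form (hκ : 0 < κ) (n : ℕ) : ∀ {z w : ℂ}, z.im ≠ 0 → w.im ≠ 0 →
    detCorr κ n z w = n.factorial / (κ : ℂ) ^ n * hermiteKernel κ z w n ∧
    detCorr κ (n + 1) z w =
      (n + 1).factorial / (κ : ℂ) ^ (n + 1) * hermiteKernel κ z w (n + 1) ∧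
    detMinorCorr κ n z w = n.factorial / (κ : ℂ) ^ n * shiftedKernel κ z w n := by
  have hk : (κ : ℂ) ≠ 0 := by exact_mod_cast hκ.ne'
  induction n with
  | zero =>
    intro z w hz hw
    refine ⟨?_, ?_, ?_⟩
    · rw [detCorr_zero hκ]; simp [hermiteKernel, hermiteTerm, monicHermite]
    · rw [detCorr_one hκ hz hw]
      simp [hermiteKernel, hermiteTerm, monicHermite, Finset.sum_range_succ]
      field_simp
      ring
    · rw [detMinorCorr_zero hκ hz]; simp [shiftedKernel, monicHermite]
  | succ n ih =>
    intro z w hz hw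
    obtain ⟨h0, h1, h2⟩ := ih hz hw
    have h3 := (ih hw hz).2.2
    have f1 : ((n + 1).factorial : ℂ) = (n + 1) * n.factorial := by
      rw [Nat.factorial_succ]; push_cast; ring
    have f2 : ((n + 2).factorial : ℂ) = (n + 2) * ((n + 1) * n.factorial) := by
      rw [Nat.factorial_succ, Nat.cast_mul, f1]; push_cast; ring
    refine ⟨h1, ?_, ?_⟩
    · rw [detCorr_succ_succ hκ hz hw, h0, h1, h2, h3, f2, f1]
      have := hermiteKernel_rec hκ.ne' z w n
      rw [show ((n : ℂ) + 2) * ((n + 1) * n.factorial) / (κ : ℂ) ^ (n + 1 + 1) *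
        hermiteKernel κ z w (n + 1 + 1) = ((n : ℂ) + 1) * n.factorial / (κ : ℂ) ^ (n + 2) *
        (((n : ℂ) + 2) * hermiteKernel κ z w (n + 2)) by ring_nf, this]
      field_simp
      ring
    · rw [detMinorCorr_succ hκ hz, h1, h3, shiftedKernel_succ_eq hκ.ne', f1]
      field_simp
      ring

/-- The Christoffel–Darboux formula, in summed form. -/
lemma shiftedKernel_sub (hκ : κ ≠ 0) (z w : ℂ) (n : ℕ) :
    shiftedKernel κ z w n - shiftedKernel κ w z n =
      (z - w) * ∑ k ∈ Finset.range (n + 1), hermiteKernel κ z w k := by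
  have hk : (κ : ℂ) ≠ 0 := by exact_mod_cast hκ
  have cd : ∀ k : ℕ, (κ : ℂ) ^ k / k.factorial * (monicHermite κ z (k + 1) * monicHermite κ w k -
      monicHermite κ w (k + 1) * monicHermite κ z k) = (z - w) * hermiteKernel κ z w k := by
    intro k
    induction k with
    | zero => simp [hermiteKernel, hermiteTerm, monicHermite]
    | succ k ih =>
      rw [hermiteKernel_succ, mul_add, ← ih, monicHermite_succ_succ, monicHermite_succ_succ,
        hermiteTerm, Nat.factorial_succ]
      push_cast
      have h1 : (k.factorial : ℂ) ≠ 0 := by exact_mod_cast k.factorial_ne_zero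
      have h2 : (k : ℂ) + 1 ≠ 0 := by exact_mod_cast k.succ_ne_zero
      field_simp
      ring
  rw [Finset.mul_sum, ← Finset.sum_congr rfl fun k _ => cd k, shiftedKernel, shiftedKernel,
    ← Finset.sum_sub_distrib]
  exact Finset.sum_congr rfl fun k _ => by ring

/-- The mean of `|det (z - H - i c e₁e₁ᵀ)|²`, up to normalisation, in terms of orthogonal
polynomials. -/
def deformedMoment (κ : ℝ) (n : ℕ) (c : ℝ) (z : ℂ) : ℂ :=
  n.factorial / (κ : ℂ) ^ n * ((n + 1) / κ * hermiteKernel κ z (star z) (n + 1)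
    + c ^ 2 * hermiteKernel κ z (star z) n
    - 2 * c * z.im * ∑ k ∈ Finset.range (n + 1), hermiteKernel κ z (star z) k)

/-- Expanding the square with w = z̄ gives two diagonal terms and the cross term ic times the
difference of minor correlations. By Christoffel–Darboux that difference carries the factor z - w =
2i Im z, whence the coefficient -2c Im z. -/
lemma integral_normSq_deformed (hκ : 0 < κ) (hz : z.im ≠ 0) (n : ℕ) (c : ℝ) :
    ((∫ y, Complex.normSq (charDet y z - Complex.I * c * charDet (minor y) z)
      ∂(hermitianGaussian κ (n + 1)) : ℝ) : ℂ) =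
      gaussianMass κ (n + 1) * deformedMoment κ n c z := by
  have hk : (κ : ℂ) ≠ 0 := by exact_mod_cast hκ.ne'
  set w := star z with hw
  have hw' : w.im ≠ 0 := by simpa [hw] using hz
  have hpt : ∀ y : HermitianCoords (n + 1),
      ((Complex.normSq (charDet y z - Complex.I * c * charDet (minor y) z) : ℝ) : ℂ) =
      1 * (charDet y z * charDet y w) + (Complex.I * c) * (charDet y z * charDet (minor y) w) +
        (- (Complex.I * c)) * (charDet y w * charDet (minor y) z) +
        (c ^ 2) * (charDet (minor y) z * charDet (minor y) w) := by
    intro y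
    rw [← Complex.mul_conj, map_sub, map_mul, map_mul, Complex.conj_I, Complex.conj_ofReal]
    have h1 : (starRingEnd ℂ) (charDet y z) = charDet y w := star_charDet y z
    have h2 : (starRingEnd ℂ) (charDet (minor y) z) = charDet (minor y) w :=
      star_charDet (minor y) z
    rw [h1, h2]
    linear_combination (-(c : ℂ) ^ 2 * charDet (minor y) z * charDet (minor y) w) * Complex.I_sq
  rw [← integral_complex_ofReal]
  simp only [hpt]
  rw [integral_linearCombination
    (((polyGrowth_charDet (n := n + 1) z).mul (polyGrowth_charDet w)).integrable hκ)
    (((polyGrowth_charDet (n := n + 1) z).mul (polyGrowth_charDet_minor w)).integrable hκ)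
    (((polyGrowth_charDet (n := n + 1) w).mul (polyGrowth_charDet_minor z)).integrable hκ)
    (integrable_of_minor hκ z w)]
  have hZ := gaussianMass_ne_zero hκ (n + 1)
  have c1 := hermite_closed_form hκ n hz hw'
  have c2 := hermite_closed_form hκ n hw' hz
  have m1 : ∫ y, charDet y z * charDet y w ∂(hermitianGaussian κ (n + 1)) =
      gaussianMass κ (n + 1) * detCorr κ (n + 1) z w := by
    rw [detCorr, mul_div_cancel₀ _ hZ]
  have m2 : ∫ y, charDet y z * charDet (minor y) w ∂(hermitianGaussian κ (n + 1)) =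
      gaussianMass κ (n + 1) * detMinorCorr κ n z w := by
    rw [detMinorCorr, mul_div_cancel₀ _ hZ]
  have m3 : ∫ y, charDet y w * charDet (minor y) z ∂(hermitianGaussian κ (n + 1)) =
      gaussianMass κ (n + 1) * detMinorCorr κ n w z := by
    rw [detMinorCorr, mul_div_cancel₀ _ hZ]
  rw [m1, m2, m3, integral_minor_minor hκ, c1.1, c1.2.1, c1.2.2, c2.2.2, deformedMoment, ← hw]
  have f1 : ((n + 1).factorial : ℂ) = (n + 1) * n.factorial := by
    rw [Nat.factorial_succ]; push_cast; ring
  have hzw : z - w = 2 * z.im * Complex.I := by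
    rw [hw]; exact Complex.sub_conj z ▸ by push_cast; ring
  have cd := shiftedKernel_sub hκ.ne' z w n
  rw [hzw] at cd
  rw [f1]
  have hsk : shiftedKernel κ z w n = shiftedKernel κ w z n + 2 * z.im * Complex.I *
    ∑ k ∈ Finset.range (n + 1), hermiteKernel κ z w k := by rw [← cd]; ring
  rw [hsk]
  field_simp
  linear_combination (2 * (n.factorial : ℂ) * (κ : ℂ) ^ (n + 2) * c * z.im *
      ∑ k ∈ Finset.range (n + 1), hermiteKernel κ z w k) *
    Complex.I_sq

end RankOneGUE
end

/-! ### The area formula for holomorphic maps -/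

noncomputable section
namespace RankOneGUE

section AreaFormula
open Set

variable {U : Set ℂ} {g : ℂ → ℂ}

lemma hasFDerivAt_real_of_differentiableOn (hU : IsOpen U) (hg : DifferentiableOn ℂ g U) {z : ℂ}
    (hz : z ∈ U) :
    HasFDerivAt g ((ContinuousLinearMap.toSpanSingleton ℂ (deriv g z)).restrictScalars ℝ) z :=
  ((hg.differentiableAt (hU.mem_nhds hz)).hasDerivAt.hasFDerivAt).restrictScalars ℝ

lemma det_toSpanSingleton_complex (a : ℂ) :
    ((ContinuousLinearMap.toSpanSingleton ℂ a).restrictScalars ℝ).det = Complex.normSq a := by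
  have h : ((ContinuousLinearMap.toSpanSingleton ℂ a).restrictScalars ℝ : ℂ →ₗ[ℝ] ℂ) =
      (LinearMap.toSpanSingleton ℂ ℂ a).restrictScalars ℝ := rfl
  rw [ContinuousLinearMap.det, h, LinearMap.det_restrictScalars, Algebra.norm_complex_apply,
    LinearMap.det_ring]
  simp

/-- Sum of `F` over the preimages of `w` that are regular points. -/
def fiberSum (U : Set ℂ) (g : ℂ → ℂ) (F : ℂ → ENNReal) (w : ℂ) : ENNReal :=
  ∑' z, {z | (z ∈ U ∧ deriv g z ≠ 0) ∧ g z = w}.indicator F z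

/-- The inverse function theorem makes g injective near each regular point; the Lindelöf property
extracts a countable cover, which is then made disjoint. -/
lemma exists_injOn_partition (hU : IsOpen U) (hg : DifferentiableOn ℂ g U) :
    ∃ A : ℕ → Set ℂ, (∀ k, MeasurableSet (A k)) ∧ (∀ k, A k ⊆ U) ∧ (∀ k, InjOn g (A k)) ∧
      Pairwise (Function.onFun Disjoint A) ∧ ⋃ k, A k = {z | z ∈ U ∧ deriv g z ≠ 0} := by
  set V : Set ℂ := {z | z ∈ U ∧ deriv g z ≠ 0} with hV
  have hVo : IsOpen V :=
    (hg.deriv hU).continuousOn.isOpen_inter_preimage hU isOpen_compl_singleton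
  have hloc : ∀ z ∈ V, ∃ N : Set ℂ, IsOpen N ∧ z ∈ N ∧ N ⊆ V ∧ InjOn g N := by
    intro z hz
    have hs : HasStrictDerivAt g (deriv g z) z :=
      (hg.analyticAt (hU.mem_nhds hz.1)).hasStrictDerivAt
    let e := (hs.hasStrictFDerivAt_equiv hz.2).toOpenPartialHomeomorph g
    refine ⟨e.source ∩ V, e.open_source.inter hVo, ⟨?_, hz⟩, inter_subset_right, ?_⟩
    · exact (hs.hasStrictFDerivAt_equiv hz.2).mem_toOpenPartialHomeomorph_source
    · exact e.injOn.mono inter_subset_left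
  choose! N hNo hNm hNV hNi using hloc
  obtain ⟨t, htV, htc, htcov⟩ := TopologicalSpace.countable_cover_nhdsWithin
    (f := N) (s := V) fun z hz => mem_nhdsWithin_of_mem_nhds ((hNo z hz).mem_nhds (hNm z hz))
  rcases t.eq_empty_or_nonempty with rfl | hne
  · refine ⟨fun _ => ∅, by simp, by simp, by simp, fun i j _ => by simp [Function.onFun], ?_⟩
    simp only [mem_empty_iff_false, iUnion_of_empty, iUnion_empty, subset_empty_iff] at htcov
    simp [htcov]
  obtain ⟨s, rfl⟩ := htc.exists_eq_range hne
  have hsV : ∀ k, s k ∈ V := fun k => htV (mem_range_self k)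
  have hsub : ∀ k, disjointed (fun k => N (s k)) k ⊆ N (s k) := disjointed_subset _
  refine ⟨disjointed fun k => N (s k), fun k =>
    MeasurableSet.disjointed (fun k => (hNo _ (hsV k)).measurableSet) k,
    fun k => (hsub k).trans fun z hz => (hNV _ (hsV k) hz).1,
    fun k => (hNi _ (hsV k)).mono (hsub k), disjoint_disjointed _, ?_⟩
  rw [iUnion_disjointed]
  refine subset_antisymm (iUnion_subset fun k => hNV _ (hsV k)) ?_
  simpa using htcov

/-- The area formula for holomorphic functions, counting preimages. -/
lemma lintegral_fiberSum (hU : IsOpen U) (hg : DifferentiableOn ℂ g U) {F : ℂ → ENNReal}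
    (hF : Measurable F) :
    ∫⁻ w, fiberSum U g F w =
      ∫⁻ z in U, ENNReal.ofReal (Complex.normSq (deriv g z)) * F z := by
  obtain ⟨A, hAm, hAU, hAi, hAd, hAV⟩ := exists_injOn_partition hU hg
  set V : Set ℂ := {z | z ∈ U ∧ deriv g z ≠ 0} with hV
  have hVo : IsOpen V :=
    (hg.deriv hU).continuousOn.isOpen_inter_preimage hU isOpen_compl_singleton
  have hfd : ∀ k, ∀ z ∈ A k, HasFDerivWithinAt g
      ((ContinuousLinearMap.toSpanSingleton ℂ (deriv g z)).restrictScalars ℝ) (A k) z :=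
    fun k z hz => (hasFDerivAt_real_of_differentiableOn hU hg (hAU k hz)).hasFDerivWithinAt
  have hemb : ∀ k, MeasurableEmbedding ((A k).domRestrict g) := fun k =>
    measurableEmbedding_of_fderivWithin (hAm k) (hfd k) (hAi k)
  -- F transported by the inverse of the injective branch on the k-th piece and extended by zero, so
  -- that summing over k counts preimages.
  set G : ℕ → ℂ → ENNReal := fun k =>
    Function.extend ((A k).domRestrict g) (fun z => F z) (fun _ => 0) with hG
  have hGm : ∀ k, Measurable (G k) := fun k =>
    (hemb k).measurable_extend (by fun_prop) measurable_const
  have hGmem : ∀ k, ∀ z ∈ A k, G k (g z) = F z := fun k z hz =>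
    (hemb k).injective.extend_apply _ _ (⟨z, hz⟩ : A k)
  have hGout : ∀ k, ∀ w, w ∉ g '' A k → G k w = 0 := by
    intro k w hw
    refine Function.extend_apply' _ _ _ ?_
    rintro ⟨⟨z, hz⟩, rfl⟩
    exact hw ⟨z, hz, rfl⟩
  have hGsum : ∀ k w, G k w = ∑' z, {z | z ∈ A k ∧ g z = w}.indicator F z := by
    intro k w
    by_cases hw : w ∈ g '' A k
    · obtain ⟨z, hz, rfl⟩ := hw
      rw [hGmem k z hz, tsum_eq_single z, indicator_of_mem (by exact ⟨hz, rfl⟩)]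
      intro z' hz'
      refine indicator_of_notMem ?_ _
      rintro ⟨h1, h2⟩
      exact hz' (hAi k h1 hz h2)
    · rw [hGout k w hw]
      symm
      rw [ENNReal.tsum_eq_zero]
      intro z
      refine indicator_of_notMem ?_ _
      rintro ⟨h1, h2⟩
      exact hw ⟨z, h1, h2⟩
  have hGint : ∀ k, ∫⁻ w, G k w =
      ∫⁻ z in A k, ENNReal.ofReal (Complex.normSq (deriv g z)) * F z := by
    intro k
    have h1 := lintegral_image_eq_lintegral_abs_det_fderiv_mul volume (hAm k) (hfd k) (hAi k) (G k)
    have h2 : ∫⁻ w in g '' A k, G k w = ∫⁻ w, G k w :=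
      setLIntegral_eq_of_support_subset fun w hw => by
        by_contra h
        exact hw (hGout k w h)
    rw [← h2, h1]
    refine setLIntegral_congr_fun (hAm k) fun z hz => ?_
    simp only [hGmem k z hz, det_toSpanSingleton_complex,
      abs_of_nonneg (Complex.normSq_nonneg _)]
  have hsum : ∀ w, fiberSum U g F w = ∑' k, G k w := by
    intro w
    simp only [hGsum, fiberSum]
    rw [ENNReal.tsum_comm]
    congr 1; ext z
    by_cases hz : (z ∈ U ∧ deriv g z ≠ 0) ∧ g z = w
    · rw [indicator_of_mem (by exact hz)]
      have hzV : z ∈ ⋃ k, A k := by rw [hAV]; exact hz.1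
      obtain ⟨k, hk⟩ := mem_iUnion.1 hzV
      rw [tsum_eq_single k, indicator_of_mem (by exact ⟨hk, hz.2⟩)]
      intro k' hk'
      refine indicator_of_notMem ?_ _
      rintro ⟨h1, -⟩
      exact (disjoint_left.1 (hAd hk') h1) hk
    · rw [indicator_of_notMem (by exact hz)]
      symm
      rw [ENNReal.tsum_eq_zero]
      intro k
      refine indicator_of_notMem ?_ _
      rintro ⟨h1, h2⟩
      refine hz ⟨?_, h2⟩
      have : z ∈ V := by rw [← hAV]; exact mem_iUnion.2 ⟨k, h1⟩
      exact this
  simp only [hsum]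
  rw [lintegral_tsum fun k => (hGm k).aemeasurable]
  simp only [hGint]
  rw [← lintegral_iUnion hAm hAd, hAV]
  -- Critical points carry Jacobian zero, so enlarging the domain from the regular points to all of
  -- U does not change the integral.
  have hsplit := lintegral_inter_add_sdiff (μ := volume) (fun z =>
    ENNReal.ofReal (Complex.normSq (deriv g z)) * F z) U hVo.measurableSet
  have hUV : U ∩ V = V := inter_eq_right.2 fun z hz => hz.1
  have hzero : ∫⁻ z in U \ V, ENNReal.ofReal (Complex.normSq (deriv g z)) * F z = 0 := by
    rw [← lintegral_zero (μ := volume.restrict (U \ V))]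
    refine setLIntegral_congr_fun (hU.measurableSet.diff hVo.measurableSet) fun z hz => ?_
    have : deriv g z = 0 := by
      by_contra h; exact hz.2 ⟨hz.1, h⟩
    simp [this]
  rw [← hsplit, hUV, hzero, add_zero]

/-- Critical values are negligible. -/
lemma ae_regular (hU : IsOpen U) (hg : DifferentiableOn ℂ g U) :
    ∀ᵐ w : ℂ, ∀ z ∈ U, g z = w → deriv g z ≠ 0 := by
  have h := addHaar_image_eq_zero_of_det_fderivWithin_eq_zero (volume : Measure ℂ)
    (s := {z | z ∈ U ∧ deriv g z = 0}) (f := g)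
    (f' := fun z => (ContinuousLinearMap.toSpanSingleton ℂ (deriv g z)).restrictScalars ℝ)
    (fun z hz => (hasFDerivAt_real_of_differentiableOn hU hg hz.1).hasFDerivWithinAt)
    (fun z hz => by rw [det_toSpanSingleton_complex, hz.2, map_zero])
  refine (measure_eq_zero_iff_ae_notMem.1 h).mono fun w hw z hz hgz hd => ?_
  exact hw ⟨z, ⟨hz, hd⟩, hgz⟩

end AreaFormula

end RankOneGUE
end

/-! ### Continuity of linear eigenvalue statistics -/

noncomputable section
namespace RankOneGUE

lemma exists_charpoly_eq_prod {N : ℕ} (M : Matrix (Fin N) (Fin N) ℂ) :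
    ∃ r : Fin N → ℂ, M.charpoly.roots = Finset.univ.val.map r ∧
      ∀ t, (Matrix.scalar (Fin N) t - M).det = ∏ i, (t - r i) := by
  have hcard : M.charpoly.roots.card = N := by
    rw [IsAlgClosed.card_roots_eq_natDegree, Matrix.charpoly_natDegree_eq_dim, Fintype.card_fin]
  have hlen : M.charpoly.roots.toList.length = N := by rw [Multiset.length_toList, hcard]
  have hr : M.charpoly.roots =
      Finset.univ.val.map fun i : Fin N => M.charpoly.roots.toList.get (i.cast hlen.symm) := by
    rw [Fin.univ_val_map]
    conv_lhs => rw [← Multiset.coe_toList M.charpoly.roots]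
    congr 1
    refine List.ext_get (by simp [hlen]) fun i h1 h2 => ?_
    simp
  refine ⟨_, hr, fun t => ?_⟩
  rw [← Matrix.eval_charpoly]
  conv_lhs => rw [(IsAlgClosed.splits M.charpoly).eq_prod_roots_of_monic M.charpoly_monic, hr]
  rw [Multiset.map_map, Polynomial.eval_multiset_prod, Multiset.map_map]
  simp [Finset.prod]

/-- Apply M to an eigenvector and compare sup norms. This confines the eigenvalues of a convergent
sequence of matrices to a compact set. -/
lemma norm_le_of_det_eq_zero {N : ℕ} {M : Matrix (Fin N) (Fin N) ℂ} {C : ℝ}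
    (hM : ∀ i j, ‖M i j‖ ≤ C) {z : ℂ} (hz : (Matrix.scalar (Fin N) z - M).det = 0) :
    ‖z‖ ≤ N * C := by
  obtain ⟨v, hv, h⟩ := Matrix.exists_mulVec_eq_zero_iff.2 hz
  have h1 : ∀ i, z * v i = ∑ j, M i j * v j := by
    intro i
    rw [Matrix.sub_mulVec, sub_eq_zero] at h
    have := congrFun h i
    rw [Matrix.scalar_apply, Matrix.mulVec_diagonal] at this
    exact this
  have hv0 : 0 < ‖v‖ := norm_pos_iff.2 hv
  have h2 : ‖z • v‖ ≤ N * C * ‖v‖ := by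
    have hN : ∃ i : Fin N, True := by
      by_contra hne
      exact hv (funext fun i => absurd ⟨i, trivial⟩ hne)
    obtain ⟨i₀, -⟩ := hN
    have hC : 0 ≤ C := (norm_nonneg _).trans (hM i₀ i₀)
    refine (pi_norm_le_iff_of_nonneg (by positivity)).2 fun i => ?_
    rw [Pi.smul_apply, smul_eq_mul, h1]
    refine (norm_sum_le _ _).trans ?_
    calc ∑ j, ‖M i j * v j‖ ≤ ∑ _j : Fin N, C * ‖v‖ := by
          refine Finset.sum_le_sum fun j _ => ?_
          rw [norm_mul]
          exact mul_le_mul (hM i j) (norm_le_pi_norm v j) (norm_nonneg _) hC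
      _ = N * C * ‖v‖ := by simp [mul_assoc]
  rw [norm_smul] at h2
  exact le_of_mul_le_mul_right h2 hv0

/-- Linear statistics of the eigenvalues depend continuously on the matrix. -/
lemma continuous_sum_roots {N : ℕ} {f : ℂ → ℝ} (hf : Continuous f) :
    Continuous fun M : Matrix (Fin N) (Fin N) ℂ => (M.charpoly.roots.map f).sum := by
  have : FirstCountableTopology (Matrix (Fin N) (Fin N) ℂ) :=
    inferInstanceAs (FirstCountableTopology (Fin N → Fin N → ℂ))
  rw [continuous_iff_seqContinuous]
  intro M M₀ hM
  -- No continuous labelling of the roots is needed: along a subsequence arbitrarily ordered root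
  -- vectors converge, and the limit of the products ∏(t - rᵢ) identifies their limit as the roots
  -- of the limiting matrix.
  refine tendsto_of_subseq_tendsto fun ns hns => ?_
  have hM' : Tendsto (fun k => M (ns k)) atTop (𝓝 M₀) := hM.comp hns
  choose r hr hdet using fun k => exists_charpoly_eq_prod (M (ns k))
  obtain ⟨C, hC⟩ : ∃ C : ℝ, ∀ k i j, ‖M (ns k) i j‖ ≤ C := by
    have hb : ∀ i j, ∃ C : ℝ, ∀ k, ‖M (ns k) i j‖ ≤ C := fun i j => by
      have h1 : Tendsto (fun k => M (ns k) i j) atTop (𝓝 (M₀ i j)) :=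
        ((continuous_apply_apply i j).tendsto M₀).comp hM'
      obtain ⟨C, hC⟩ := (Metric.isBounded_range_of_tendsto _ h1).exists_norm_le
      exact ⟨C, fun k => hC _ (Set.mem_range_self k)⟩
    choose C hC using hb
    refine ⟨∑ i, ∑ j, |C i j|, fun k i j => (hC i j k).trans ((le_abs_self _).trans ?_)⟩
    calc |C i j| ≤ ∑ j, |C i j| :=
          Finset.single_le_sum (f := fun j => |C i j|) (fun _ _ => abs_nonneg _) (Finset.mem_univ j)
      _ ≤ _ := Finset.single_le_sum (f := fun i => ∑ j, |C i j|)
          (fun _ _ => Finset.sum_nonneg fun _ _ => abs_nonneg _) (Finset.mem_univ i)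
  have hbd : ∀ k, r k ∈ Metric.closedBall (0 : Fin N → ℂ) |N * C| := by
    intro k
    rw [mem_closedBall_zero_iff]
    refine (pi_norm_le_iff_of_nonneg (abs_nonneg _)).2 fun i => ?_
    refine (norm_le_of_det_eq_zero (hC k) ?_).trans (le_abs_self _)
    rw [hdet k]
    exact Finset.prod_eq_zero (Finset.mem_univ i) (sub_self _)
  obtain ⟨r₀, -, φ, hφ, hlim⟩ := (isCompact_closedBall (0 : Fin N → ℂ) |N * C|).tendsto_subseq hbd
  refine ⟨φ, ?_⟩
  have hlim' : ∀ i, Tendsto (fun k => r (φ k) i) atTop (𝓝 (r₀ i)) := fun i =>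
    ((continuous_apply i).tendsto r₀).comp hlim
  have hM₀ : M₀.charpoly = ∏ i, (Polynomial.X - Polynomial.C (r₀ i)) := by
    refine Polynomial.funext fun t => ?_
    rw [Matrix.eval_charpoly, Polynomial.eval_prod]
    simp only [Polynomial.eval_sub, Polynomial.eval_X, Polynomial.eval_C]
    have h1 : Tendsto (fun k => (Matrix.scalar (Fin N) t - M (ns (φ k))).det) atTop
        (𝓝 (Matrix.scalar (Fin N) t - M₀).det) := by
      have hc : Continuous fun M : Matrix (Fin N) (Fin N) ℂ => (Matrix.scalar (Fin N) t - M).det :=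
        (continuous_const.sub continuous_id).matrix_det
      exact (hc.tendsto M₀).comp (hM'.comp hφ.tendsto_atTop)
    simp only [hdet] at h1
    exact tendsto_nhds_unique h1 (tendsto_finsetProd _ fun i _ => tendsto_const_nhds.sub (hlim' i))
  have h0 : (M₀.charpoly.roots.map f).sum = ∑ i, f (r₀ i) := by
    rw [hM₀, Polynomial.roots_prod _ _ (Finset.prod_ne_zero_iff.2 fun i _ =>
      Polynomial.X_sub_C_ne_zero _)]
    simp [Finset.sum]
    rfl
  have hk : ∀ k, ((M (ns (φ k))).charpoly.roots.map f).sum = ∑ i, f (r (φ k) i) := fun k => by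
    rw [hr, Multiset.map_map]; rfl
  simp only [h0, Function.comp_apply, hk]
  exact tendsto_finsetSum _ fun i _ => (hf.tendsto _).comp (hlim' i)

lemma continuous_deformedMatrix {N : ℕ} :
    Continuous fun p : ℝ × HermitianCoords N => deformedMatrix p.1 p.2 := by
  unfold deformedMatrix
  refine (continuous_hermitianMatrix.comp continuous_snd).add ?_
  have h : Continuous fun (p : ℝ × HermitianCoords N) (i : Fin N) =>
      if (i : ℕ) = 0 then (p.1 : ℂ) else 0 := by
    refine continuous_pi fun i => ?_
    split_ifs
    · exact Complex.continuous_ofReal.comp continuous_fst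
    · exact continuous_const
  exact h.matrix_diagonal.const_smul Complex.I

lemma continuous_eigenvalueSum {N : ℕ} {f : ℝ × ℝ → ℝ} (hf : Continuous f) :
    Continuous fun p : ℝ × HermitianCoords N => eigenvalueSum p.1 f p.2 :=
  (continuous_sum_roots (f := fun z : ℂ => f (z.re, z.im))
    (hf.comp (Complex.continuous_re.prodMk Complex.continuous_im))).comp continuous_deformedMatrix

lemma abs_eigenvalueSum_le {N : ℕ} {f : ℝ × ℝ → ℝ} {C : ℝ} (hC : ∀ p, |f p| ≤ C) (γ : ℝ)
    (x : HermitianCoords N) : |eigenvalueSum γ f x| ≤ N * C := by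
  obtain ⟨r, hr, -⟩ := exists_charpoly_eq_prod (deformedMatrix γ x)
  rw [eigenvalueSum, hr, Multiset.map_map]
  refine (Finset.abs_sum_le_sum_abs _ _).trans ?_
  calc _ ≤ ∑ _i : Fin N, C := Finset.sum_le_sum fun i _ => hC _
    _ = N * C := by simp

end RankOneGUE
end

/-! ### The secular equation for the eigenvalues -/

noncomputable section
namespace RankOneGUE
variable {n : ℕ}

/-- The secular function `z - b (z - H)⁻¹ b*`. -/
def secular (b : Fin n → ℂ) (x : HermitianCoords n) (z : ℂ) : ℂ := z - rowForm (shifted x z)⁻¹ b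

/-- The derivative of the secular function. -/
def secularDeriv (b : Fin n → ℂ) (x : HermitianCoords n) (z : ℂ) : ℂ :=
  1 + rowForm ((shifted x z)⁻¹ * (shifted x z)⁻¹) b

lemma charDet_smul_inv (x : HermitianCoords n) {z : ℂ} (hz : z.im ≠ 0) :
    charDet x z • (shifted x z)⁻¹ = (shifted x z).adjugate := by
  rw [Matrix.inv_def, smul_smul, Ring.inverse_eq_inv', ← charDet,
    mul_inv_cancel₀ (charDet_ne_zero x hz), one_smul]

lemma isUnit_det_shifted (x : HermitianCoords n) {z : ℂ} (hz : z.im ≠ 0) :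
    IsUnit (shifted x z).det := isUnit_iff_ne_zero.2 (charDet_ne_zero x hz)

lemma rowForm_smul (c : ℂ) (M : Matrix (Fin n) (Fin n) ℂ) (b : Fin n → ℂ) :
    rowForm (c • M) b = c * rowForm M b := by
  rw [rowForm, Matrix.smul_mulVec, dotProduct_smul, smul_eq_mul, rowForm]

lemma rowForm_sub (M M' : Matrix (Fin n) (Fin n) ℂ) (b : Fin n → ℂ) :
    rowForm (M - M') b = rowForm M b - rowForm M' b := by
  rw [rowForm, Matrix.sub_mulVec, dotProduct_sub]; rfl

lemma rowForm_eq_sum (M : Matrix (Fin n) (Fin n) ℂ) (b : Fin n → ℂ) :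
    rowForm M b = ∑ i, ∑ j, b i * (M i j * star (b j)) := by
  simp only [rowForm, dotProduct, Matrix.mulVec, Finset.mul_sum]
  rfl

lemma measurable_rowForm {X : Type*} [MeasurableSpace X] {M : X → Matrix (Fin n) (Fin n) ℂ}
    {b : X → Fin n → ℂ} (hM : ∀ i j, Measurable fun t => M t i j) (hb : Measurable b) :
    Measurable fun t => rowForm (M t) (b t) := by
  simp only [rowForm_eq_sum]
  refine Finset.measurable_sum _ fun i _ => Finset.measurable_sum _ fun j _ => ?_
  have hbi : ∀ i, Measurable fun t => b t i := fun i => (measurable_pi_apply i).comp hb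
  exact (hbi i).mul ((hM i j).mul (continuous_star.measurable.comp (hbi j)))

lemma measurable_shifted_inv_apply (i j : Fin n) :
    Measurable fun p : HermitianCoords n × ℂ => (shifted p.1 p.2)⁻¹ i j := by
  simp only [Matrix.inv_def, Ring.inverse_eq_inv', Matrix.smul_apply, smul_eq_mul]
  refine (continuous_charDet.measurable.inv).mul ?_
  exact ((continuous_shifted.matrix_adjugate).matrix_elem i j).measurable

lemma measurable_secular : Measurable fun p : (Fin n → ℂ) × HermitianCoords n × ℂ =>
    secular p.1 p.2.1 p.2.2 := by
  unfold secular
  refine (measurable_snd.comp measurable_snd).sub (measurable_rowForm (fun i j => ?_)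
      measurable_fst)
  exact (measurable_shifted_inv_apply i j).comp measurable_snd

lemma measurable_secularDeriv : Measurable fun p : (Fin n → ℂ) × HermitianCoords n × ℂ =>
    secularDeriv p.1 p.2.1 p.2.2 := by
  unfold secularDeriv
  refine measurable_const.add (measurable_rowForm (fun i j => ?_) measurable_fst)
  simp only [Matrix.mul_apply]
  exact Finset.measurable_sum _ fun k _ =>
    ((measurable_shifted_inv_apply i k).comp measurable_snd).mul
      ((measurable_shifted_inv_apply k j).comp measurable_snd)

lemma continuousAt_shifted_inv (x : HermitianCoords n) {z : ℂ} (hz : z.im ≠ 0) :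
    ContinuousAt (fun w => (shifted x w)⁻¹) z := by
  have hc : Continuous fun w : ℂ => (x, w) := by fun_prop
  simp only [Matrix.inv_def, Ring.inverse_eq_inv']
  have h1 : ContinuousAt (fun w => (charDet x w)⁻¹) z :=
    (continuous_charDet.comp hc).continuousAt.inv₀ (charDet_ne_zero x hz)
  have h2 : ContinuousAt (fun w => (shifted x w).adjugate) z :=
    ((continuous_shifted.comp hc).matrix_adjugate).continuousAt
  exact h1.smul h2

/-- By the resolvent identity, the difference quotient of the resolvent at w and z is minus the
product of the two resolvents, which is continuous in w. -/
lemma hasDerivAt_secular (b : Fin n → ℂ) (x : HermitianCoords n) {z : ℂ} (hz : z.im ≠ 0) :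
    HasDerivAt (secular b x) (secularDeriv b x z) z := by
  have key : ∀ w : ℂ, w.im ≠ 0 → rowForm (shifted x w)⁻¹ b - rowForm (shifted x z)⁻¹ b =
      (w - z) * (-rowForm ((shifted x w)⁻¹ * (shifted x z)⁻¹) b) := by
    intro w hw
    have h1 : (shifted x w)⁻¹ - (shifted x z)⁻¹ = (z - w) • ((shifted x w)⁻¹ * (shifted x z)⁻¹)
        := by
      have h2 : shifted x z - shifted x w = (z - w) • (1 : Matrix (Fin n) (Fin n) ℂ) := by
        ext i j
        by_cases hij : i = j
        · subst hij; simp [shifted]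
        · simp [shifted, hij]
      calc (shifted x w)⁻¹ - (shifted x z)⁻¹
          = (shifted x w)⁻¹ * (shifted x z - shifted x w) * (shifted x z)⁻¹ := by
            rw [mul_sub, sub_mul, Matrix.nonsing_inv_mul _ (isUnit_det_shifted x hw), one_mul,
              Matrix.mul_nonsing_inv_cancel_right _ _ (isUnit_det_shifted x hz)]
        _ = _ := by rw [h2, mul_smul_comm, mul_one, smul_mul_assoc]
    rw [← rowForm_sub, h1, rowForm_smul]; ring
  have hR : HasDerivAt (fun w => rowForm (shifted x w)⁻¹ b)
      (-rowForm ((shifted x z)⁻¹ * (shifted x z)⁻¹) b) z := by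
    rw [hasDerivAt_iff_tendsto_slope]
    have hcont : ContinuousAt (fun w => -rowForm ((shifted x w)⁻¹ * (shifted x z)⁻¹) b) z := by
      have h0 : Continuous fun M : Matrix (Fin n) (Fin n) ℂ =>
          -rowForm (M * (shifted x z)⁻¹) b := by
        unfold rowForm
        exact (continuous_const.dotProduct
          ((continuous_id.matrix_mul continuous_const).matrix_mulVec continuous_const)).neg
      exact ContinuousAt.comp (g := fun M : Matrix (Fin n) (Fin n) ℂ =>
          -rowForm (M * (shifted x z)⁻¹) b) h0.continuousAt (continuousAt_shifted_inv x hz)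
    refine (hcont.tendsto.mono_left nhdsWithin_le_nhds).congr' ?_
    have hev : ∀ᶠ w in 𝓝 z, w.im ≠ 0 :=
      Complex.continuous_im.continuousAt.eventually_ne hz
    filter_upwards [hev.filter_mono nhdsWithin_le_nhds, self_mem_nhdsWithin] with w hw hne
    rw [slope_def_field, key w hw, mul_div_cancel_left₀]
    exact sub_ne_zero.2 hne
  have := (hasDerivAt_id z).sub hR
  rwa [sub_neg_eq_add] at this

/-- The open upper half-plane in `ℂ`. -/
def upperPlane : Set ℂ := {z | 0 < z.im}

lemma isOpen_upperPlane : IsOpen upperPlane := isOpen_lt continuous_const Complex.continuous_im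

lemma differentiableOn_secular (b : Fin n → ℂ) (x : HermitianCoords n) :
    DifferentiableOn ℂ (secular b x) upperPlane := fun _ hz =>
  (hasDerivAt_secular b x (ne_of_gt hz)).differentiableAt.differentiableWithinAt

lemma deriv_secular (b : Fin n → ℂ) (x : HermitianCoords n) {z : ℂ} (hz : z ∈ upperPlane) :
    deriv (secular b x) z = secularDeriv b x z :=
  (hasDerivAt_secular b x (ne_of_gt hz)).deriv

/-- The deformation only replaces the corner a by a + iγ in the Schur complement. Since the
determinant of the block does not vanish off the real axis, non-real eigenvalues are exactly the
solutions of the secular equation. -/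
lemma eval_charpoly_deformedMatrix (γ a : ℝ) (b : Fin n → ℂ) (x : HermitianCoords n) {z : ℂ}
    (hz : z.im ≠ 0) :
    (deformedMatrix γ (bordered n (a, b, x))).charpoly.eval z =
      charDet x z * (secular b x z - (a + γ * Complex.I)) := by
  rw [Matrix.eval_charpoly, det_eq_of_bordered (A := shifted x z) _ (fun i j => ?_)
    (charDet_ne_zero x hz)]
  · have e0 : ∀ j : Fin n, (Matrix.scalar (Fin (n + 1)) z -
        deformedMatrix γ (bordered n (a, b, x))) 0 j.succ = - b j := fun j => by
      have h := shifted_zero_succ a b x z j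
      simp only [shifted, Matrix.sub_apply] at h
      simp [deformedMatrix, ← h, Matrix.diagonal_apply_ne _ (Fin.succ_ne_zero j).symm]
    have e1 : ∀ j : Fin n, (Matrix.scalar (Fin (n + 1)) z -
        deformedMatrix γ (bordered n (a, b, x))) j.succ 0 = - star (b j) := fun j => by
      have h := shifted_succ_zero a b x z j
      simp only [shifted, Matrix.sub_apply] at h
      simp [deformedMatrix, hermitianMatrix_bordered_succ_zero]
    have e2 : (Matrix.scalar (Fin (n + 1)) z -
        deformedMatrix γ (bordered n (a, b, x))) 0 0 = z - (a + γ * Complex.I) := by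
      simp [deformedMatrix, hermitianMatrix_bordered_zero_zero, mul_comm]
    simp only [e0, e1, e2]
    change _ - (-b) ⬝ᵥ Matrix.mulVec _ (-star b) = _
    rw [Matrix.mulVec_neg, neg_dotProduct_neg, ← charDet_smul_inv x hz, Matrix.smul_mulVec,
      dotProduct_smul, smul_eq_mul, secular, rowForm, ← charDet]
    ring
  · have h := shifted_succ_succ a b x z i j
    simp only [shifted, Matrix.sub_apply] at h ⊢
    rw [← h]
    by_cases hij : i = j
    · subst hij; simp [deformedMatrix]
    · have : i.succ ≠ j.succ := fun hh => hij (Fin.succ_injective _ hh)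
      simp [deformedMatrix, Matrix.diagonal_apply_ne _ this]

/-- At a regular value the roots in the upper half-plane are simple, so counting with algebraic
multiplicity agrees with counting preimages. -/
lemma eigenvalueSum_eq_fiberSum {f : ℝ × ℝ → ℝ} (hf0 : ∀ p, 0 ≤ f p)
    (hf : ∀ p : ℝ × ℝ, p.2 ≤ 0 → f p = 0) (γ a : ℝ) (b : Fin n → ℂ) (x : HermitianCoords n)
    (hreg : ∀ z ∈ upperPlane, secular b x z = a + γ * Complex.I → deriv (secular b x) z ≠ 0) :
    ENNReal.ofReal (eigenvalueSum γ f (bordered n (a, b, x))) =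
      fiberSum upperPlane (secular b x) (fun z => ENNReal.ofReal (f (z.re, z.im)))
        (a + γ * Complex.I) := by
  classical
  set P := (deformedMatrix γ (bordered n (a, b, x))).charpoly with hP
  have hP0 : P ≠ 0 := (Matrix.charpoly_monic _).ne_zero
  have hroot : ∀ z ∈ upperPlane, P.IsRoot z ↔ secular b x z = a + γ * Complex.I := by
    intro z hz
    have hz' : z.im ≠ 0 := ne_of_gt hz
    rw [Polynomial.IsRoot.def, eval_charpoly_deformedMatrix γ a b x hz', mul_eq_zero, sub_eq_zero]
    simp [charDet_ne_zero x hz']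
  have hcount : ∀ z ∈ upperPlane, P.IsRoot z → P.roots.count z = 1 := by
    intro z hz hr
    rw [Polynomial.count_roots]
    have h1 : 0 < P.rootMultiplicity z := (Polynomial.rootMultiplicity_pos hP0).2 hr
    -- At a root, the derivative of the product formula is the block determinant times the
    -- derivative of the secular function, and both factors are nonzero.
    have h2 : ¬ 1 < P.rootMultiplicity z := by
      rw [Polynomial.one_lt_rootMultiplicity_iff_isRoot hP0]
      rintro ⟨-, hd⟩
      have hz' : z.im ≠ 0 := ne_of_gt hz
      have hg := (hasDerivAt_secular b x hz').sub_const (a + γ * Complex.I)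
      have hD : HasDerivAt (charDet x) ((hermitianMatrix x).charpoly.derivative.eval z) z := by
        have := (hermitianMatrix x).charpoly.hasDerivAt z
        simp only [Matrix.eval_charpoly] at this
        exact this
      have hprod := hD.mul hg
      have hev : (fun t => P.eval t) =ᶠ[𝓝 z]
          (charDet x * fun t => secular b x t - (a + γ * Complex.I)) := by
        filter_upwards [isOpen_upperPlane.mem_nhds hz] with t ht
        exact eval_charpoly_deformedMatrix γ a b x (ne_of_gt ht)
      have heq := (P.hasDerivAt z).unique (hprod.congr_of_eventuallyEq hev)
      rw [Polynomial.IsRoot.def] at hd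
      have hs := (hroot z hz).1 hr
      rw [hd, hs, sub_self, mul_zero, zero_add] at heq
      have := hreg z hz hs
      rw [deriv_secular b x hz] at this
      exact mul_ne_zero (charDet_ne_zero x hz') this heq.symm
    omega
  have hsum : eigenvalueSum γ f (bordered n (a, b, x)) =
      ∑ z ∈ P.roots.toFinset.filter (· ∈ upperPlane), f (z.re, z.im) := by
    rw [eigenvalueSum, ← hP, Finset.sum_multiset_map_count, Finset.sum_filter]
    refine Finset.sum_congr rfl fun z hz => ?_
    have hz : P.IsRoot z := (Polynomial.mem_roots hP0).1 (Multiset.mem_toFinset.1 hz)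
    split_ifs with hu
    · rw [hcount z hu hz, one_smul]
    · rw [hf (z.re, z.im) (show z.im ≤ 0 from not_lt.1 hu), smul_zero]
  rw [hsum, ENNReal.ofReal_sum_of_nonneg fun _ _ => hf0 _, fiberSum,
    tsum_eq_sum (s := P.roots.toFinset.filter (· ∈ upperPlane))]
  · refine Finset.sum_congr rfl fun z hz => ?_
    rw [Finset.mem_filter, Multiset.mem_toFinset, Polynomial.mem_roots hP0] at hz
    have hs := (hroot z hz.2).1 hz.1
    rw [Set.indicator_of_mem (by exact ⟨⟨hz.2, hreg z hz.2 hs⟩, hs⟩)]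
  · intro z hz
    refine Set.indicator_of_notMem ?_ _
    rintro ⟨⟨hu, -⟩, hs⟩
    apply hz
    rw [Finset.mem_filter, Multiset.mem_toFinset, Polynomial.mem_roots hP0]
    exact ⟨(hroot z hu).2 hs, hu⟩

end RankOneGUE
end

/-! ### The substitution b = u(z - H) and the reduction to a second moment -/

noncomputable section
namespace RankOneGUE
variable {n : ℕ} {κ : ℝ}

/-- A complex linear map has real Jacobian equal to the squared modulus of its complex determinant.
-/
lemma lintegral_vecMul (A : Matrix (Fin n) (Fin n) ℂ) (hA : A.det ≠ 0) {Φ : (Fin n → ℂ) → ENNReal}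
    (hΦ : Measurable Φ) :
    ∫⁻ b, Φ b = ENNReal.ofReal (Complex.normSq A.det) * ∫⁻ u, Φ (Matrix.vecMul u A) := by
  have hH : (volume : Measure (Fin n → ℂ)).IsAddHaarMeasure := Measure.pi.isAddHaarMeasure _
  set L : (Fin n → ℂ) →ₗ[ℝ] (Fin n → ℂ) := (Matrix.toLin' A.transpose).restrictScalars ℝ with hL
  have hLa : ∀ u, L u = Matrix.vecMul u A := fun u => by
    simp [hL, Matrix.toLin'_apply, Matrix.mulVec_transpose]
  have hdet : LinearMap.det L = Complex.normSq A.det := by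
    rw [hL, LinearMap.det_restrictScalars, LinearMap.det_toLin', Matrix.det_transpose,
      Algebra.norm_complex_apply]
  have hpos : 0 < Complex.normSq A.det := Complex.normSq_pos.2 hA
  have hc : Continuous L := LinearMap.continuous_of_finiteDimensional _
  have hmap := Measure.map_linearMap_addHaar_eq_smul_addHaar (volume : Measure (Fin n → ℂ))
    (f := L) (by rw [hdet]; exact hpos.ne')
  simp only [← hLa]
  rw [← lintegral_map hΦ hc.measurable, hmap, lintegral_smul_measure, hdet, smul_eq_mul,
    ← mul_assoc, ← ENNReal.ofReal_mul hpos.le, abs_of_pos (inv_pos.2 hpos),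
    mul_inv_cancel₀ hpos.ne', ENNReal.ofReal_one, one_mul]

lemma lintegral_affine (s t : ℝ) (hs : 0 < s) {Φ : ℝ → ENNReal} :
    ∫⁻ a, Φ a = ENNReal.ofReal s⁻¹ * ∫⁻ a, Φ ((a + t) / s) := by
  have h := lintegral_image_eq_lintegral_abs_deriv_mul (s := Set.univ)
    (f := fun a : ℝ => (a + t) / s) (f' := fun _ => s⁻¹) MeasurableSet.univ
    (fun a _ => by
      have h := ((hasDerivAt_id' a).add_const t).div_const s
      rw [one_div] at h
      exact h.hasDerivWithinAt)
    (fun a _ b _ hab => by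
      have hab : (a + t) / s = (b + t) / s := hab
      rw [div_left_inj' hs.ne'] at hab; linarith) Φ
  have him : (fun a : ℝ => (a + t) / s) '' Set.univ = Set.univ := by
    rw [Set.image_univ, Set.range_eq_univ]
    intro a
    exact ⟨a * s - t, by field_simp; ring⟩
  rw [him, setLIntegral_univ, setLIntegral_univ, abs_of_pos (inv_pos.2 hs)] at h
  rw [h, lintegral_const_mul' _ _ ENNReal.ofReal_ne_top]

lemma conjTranspose_shifted (x : HermitianCoords n) (z : ℂ) :
    star (shifted x z) = shifted x (star z) := by
  rw [shifted, star_sub, Matrix.star_eq_conjTranspose, Matrix.star_eq_conjTranspose,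
    (isHermitian_hermitianMatrix x).eq, shifted]
  congr 1
  ext i j
  by_cases hij : i = j
  · subst hij; simp
  · simp [Matrix.diagonal_apply_ne _ hij, Matrix.diagonal_apply_ne _ (Ne.symm hij)]

lemma rowForm_add (M M' : Matrix (Fin n) (Fin n) ℂ) (b : Fin n → ℂ) :
    rowForm (M + M') b = rowForm M b + rowForm M' b := by
  rw [rowForm, Matrix.add_mulVec, dotProduct_add]; rfl

lemma rowForm_one (b : Fin n → ℂ) : rowForm 1 b = sqNorm b := by
  rw [rowForm, Matrix.one_mulVec, dotProduct, sqNorm]; push_cast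
  exact Finset.sum_congr rfl fun i _ => Complex.mul_conj (b i)

lemma sqNorm_vecMul (A : Matrix (Fin n) (Fin n) ℂ) (u : Fin n → ℂ) :
    (sqNorm (Matrix.vecMul u A) : ℂ) = rowForm (A * star A) u := by
  have := rowForm_conj A 1 u
  rw [mul_one] at this
  rw [this, rowForm_one]

lemma rowForm_shifted (x : HermitianCoords n) (z : ℂ) (u : Fin n → ℂ) :
    rowForm (shifted x z) u = z * sqNorm u - rowForm (hermitianMatrix x) u := by
  rw [shifted, rowForm_sub, ← rowForm_one, ← rowForm_smul]
  congr 2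
  ext i j
  by_cases hij : i = j
  · subst hij; simp
  · simp [hij]

lemma rowForm_hermitianMatrix_im (x : HermitianCoords n) (u : Fin n → ℂ) :
    (rowForm (hermitianMatrix x) u).im = 0 := by
  have := (isHermitian_hermitianMatrix x).im_star_dotProduct_mulVec_self (star u)
  rw [star_star] at this
  exact this

/-- One factor z - H cancels the resolvent: b(z - H)⁻¹b* becomes u(z - H)*u* = z̄|u|² - uHu*, in
which no inverse is left. -/
lemma secular_vecMul (x : HermitianCoords n) {z : ℂ} (hz : z.im ≠ 0) (u : Fin n → ℂ) :
    secular (Matrix.vecMul u (shifted x z)) x z =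
      z - (star z * sqNorm u - rowForm (hermitianMatrix x) u) := by
  rw [secular, ← rowForm_conj, Matrix.mul_nonsing_inv _ (isUnit_det_shifted x hz), one_mul,
    conjTranspose_shifted, rowForm_shifted]

/-- Since uHu* is real, the coupling γ = Im g(z) depends on u only through |u|². This is what makes
the row integral radial. -/
lemma secular_vecMul_im (x : HermitianCoords n) {z : ℂ} (hz : z.im ≠ 0) (u : Fin n → ℂ) :
    (secular (Matrix.vecMul u (shifted x z)) x z).im = z.im * (1 + sqNorm u) := by
  rw [secular_vecMul x hz]
  simp [rowForm_hermitianMatrix_im]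
  ring

lemma secular_vecMul_re (x : HermitianCoords n) {z : ℂ} (hz : z.im ≠ 0) (u : Fin n → ℂ) :
    (secular (Matrix.vecMul u (shifted x z)) x z).re =
      z.re * (1 - sqNorm u) + (rowForm (hermitianMatrix x) u).re := by
  rw [secular_vecMul x hz]
  simp
  ring

/-- With A = z - H one has A(A⁻¹A⁻¹)A* = A⁻¹A* = 1 - 2i(Im z)A⁻¹. Multiplying by det A, which comes
from the Jacobian of the substitution, clears the remaining inverse. -/
lemma charDet_mul_secularDeriv (x : HermitianCoords n) {z : ℂ} (hz : z.im ≠ 0) (u : Fin n → ℂ) :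
    charDet x z * secularDeriv (Matrix.vecMul u (shifted x z)) x z =
      (1 + sqNorm u) * charDet x z -
        2 * z.im * Complex.I * rowForm (shifted x z).adjugate u := by
  have h1 : shifted x z * ((shifted x z)⁻¹ * (shifted x z)⁻¹) * star (shifted x z) =
      1 + (-(2 * z.im * Complex.I)) • (shifted x z)⁻¹ := by
    have h2 : star (shifted x z) = shifted x z + (-(2 * z.im * Complex.I)) • 1 := by
      rw [conjTranspose_shifted]
      have : (star z : ℂ) = z - 2 * z.im * Complex.I := by
        have := Complex.sub_conj z
        push_cast at this
        rw [← this]; simp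
      ext i j
      by_cases hij : i = j
      · subst hij; simp [shifted, this]; ring
      · simp [shifted, hij]
    rw [h2, ← mul_assoc, Matrix.mul_nonsing_inv _ (isUnit_det_shifted x hz), one_mul, mul_add,
      Matrix.nonsing_inv_mul _ (isUnit_det_shifted x hz), mul_smul_comm, mul_one]
  rw [secularDeriv, ← rowForm_conj, h1, rowForm_add, rowForm_one, rowForm_smul,
    ← charDet_smul_inv x hz, rowForm_smul]
  ring

/-- The integrand of the Kac–Rice formula after the substitution `b = u (z - H)`. -/
def kacRiceIntegrand (κ : ℝ) (z : ℂ) (u : Fin n → ℂ) (x : HermitianCoords n) : ℝ :=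
  Real.exp (-κ * sqNorm (Matrix.vecMul u (shifted x z))) *
    Real.exp (-(κ / 2) * (z.re * (1 - sqNorm u) + (rowForm (hermitianMatrix x) u).re) ^ 2) *
    Complex.normSq ((1 + sqNorm u) * charDet x z -
      2 * z.im * Complex.I * rowForm (shifted x z).adjugate u)

/-- The same integrand for `u = √s e₁`. -/
def radialIntegrand (κ : ℝ) (z : ℂ) (s : ℝ) (y : HermitianCoords (n + 1)) : ℝ :=
  Real.exp (-κ * (s * ∑ j, Complex.normSq (shifted y z 0 j))) *
    Real.exp (-(κ / 2) * (z.re * (1 - s) + s * y.1 0) ^ 2) *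
    Complex.normSq ((1 + s) * charDet y z - 2 * z.im * Complex.I * (s * charDet (minor y) z))

/-- Conjugating H by the unitary that sends u to |u|e₁ preserves the Gaussian measure and leaves
only the first row of z - H and the corner entry in the exponents. -/
lemma lintegral_kacRiceIntegrand (hκ : 0 < κ) (z : ℂ) (u : Fin (n + 1) → ℂ) :
    ∫⁻ x, ENNReal.ofReal (kacRiceIntegrand κ z u x) ∂(hermitianGaussian κ (n + 1)) =
      ∫⁻ y, ENNReal.ofReal (radialIntegrand κ z (sqNorm u) y) ∂(hermitianGaussian κ (n + 1)) := by
  obtain ⟨T, hT, hTe, U, hU, rfl, hu, h⟩ := exists_rotation hκ u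
  rw [← hT.lintegral_comp_emb hTe]
  refine lintegral_congr fun y => ?_
  congr 1
  have hs : (Complex.normSq ((√(sqNorm u) : ℝ) : ℂ) : ℂ) = (sqNorm u : ℝ) := by
    rw [Complex.normSq_ofReal, Real.mul_self_sqrt (sqNorm_nonneg u)]
  have hU' : U * star U = 1 := mul_eq_one_comm.1 hU
  have e1 : sqNorm (Matrix.vecMul u (shifted (conjCoords U y) z)) =
      sqNorm u * ∑ j, Complex.normSq (shifted y z 0 j) := by
    have : (sqNorm (Matrix.vecMul u (shifted (conjCoords U y) z)) : ℂ) =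
        ((sqNorm u * ∑ j, Complex.normSq (shifted y z 0 j) : ℝ) : ℂ) := by
      rw [sqNorm_vecMul, shifted_conjCoords hU, star_mul, star_mul, star_star,
        show U * shifted y z * star U * (U * (star (shifted y z) * star U)) =
          U * (shifted y z * (star U * U) * star (shifted y z)) * star U by noncomm_ring,
        hU, mul_one, rowForm_conj, hu, rowForm_single, hs, Complex.ofReal_mul]
      congr 1
      rw [Matrix.mul_apply]; push_cast
      exact Finset.sum_congr rfl fun j _ => Complex.mul_conj _
    exact_mod_cast this
  have e2 : (rowForm (hermitianMatrix (conjCoords U y)) u).re = sqNorm u * y.1 0 := by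
    rw [hermitianMatrix_conjCoords, rowForm_conj, hu, rowForm_single, hs,
      hermitianMatrix_apply_self]
    simp
  rw [kacRiceIntegrand, radialIntegrand, e1, e2, (h y z).1, (h y z).2]

lemma lintegral_bordered {F : HermitianCoords (n + 1) → ENNReal} (hF : Measurable F) :
    ∫⁻ y, F y ∂(hermitianGaussian κ (n + 1)) =
      ∫⁻ a, ENNReal.ofReal (Real.exp (-(κ / 2) * a ^ 2)) *
        ∫⁻ b : Fin n → ℂ, ENNReal.ofReal (Real.exp (-κ * sqNorm b)) *
          ∫⁻ x, F (bordered n (a, b, x)) ∂(hermitianGaussian κ n) := by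
  have hm : Measurable fun t : ℝ × (Fin n → ℂ) × HermitianCoords n => F (bordered n t) :=
    hF.comp (bordered n).measurable
  rw [(measurePreserving_bordered_gaussian κ n).lintegral_map_equiv,
      lintegral_prod _ hm.aemeasurable]
  have h1 : Measurable fun t : ℝ × (Fin n → ℂ) =>
      ∫⁻ x, F (bordered n (t.1, t.2, x)) ∂(hermitianGaussian κ n) :=
    Measurable.lintegral_prod_right' (f := fun p : (ℝ × (Fin n → ℂ)) × HermitianCoords n =>
      F (bordered n (p.1.1, p.1.2, p.2))) (hm.comp (by fun_prop))
  have h2 : Measurable fun a : ℝ => ∫⁻ b, ∫⁻ x, F (bordered n (a, b, x)) ∂(hermitianGaussian κ n)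
      ∂(rowGaussian κ n) := Measurable.lintegral_prod_right' h1
  have h3 : ∀ a : ℝ, ∫⁻ t, F (bordered n (a, t)) ∂((rowGaussian κ n).prod (hermitianGaussian κ n)) =
      ∫⁻ b, ∫⁻ x, F (bordered n (a, b, x)) ∂(hermitianGaussian κ n) ∂(rowGaussian κ n) := fun a =>
    lintegral_prod _ (hm.comp measurable_prodMk_left).aemeasurable
  simp only [h3]
  rw [lineGaussian, lintegral_withDensity_eq_lintegral_mul _ (by fun_prop) h2]
  refine lintegral_congr fun a => ?_
  have h4 : Measurable fun b : Fin n → ℂ => ∫⁻ x, F (bordered n (a, b, x))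
      ∂(hermitianGaussian κ n) :=
    h1.comp measurable_prodMk_left
  rw [Pi.mul_apply, rowGaussian, lintegral_withDensity_eq_lintegral_mul _ (by fun_prop) h4]
  rfl

/-- The mean of `|det (z - H - i c e₁e₁ᵀ)|²` as a Lebesgue integral. -/
def deformedLIntegral (κ : ℝ) (n : ℕ) (c : ℝ) (z : ℂ) : ENNReal :=
  ∫⁻ y, ENNReal.ofReal (Complex.normSq (charDet y z - Complex.I * c * charDet (minor y) z))
    ∂(hermitianGaussian κ (n + 1))

lemma continuous_charDet_left (z : ℂ) : Continuous fun y : HermitianCoords n => charDet y z :=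
  (polyGrowth_charDet z).1

lemma measurable_radialIntegrand_joint (z : ℂ) :
    Measurable fun p : ℝ × HermitianCoords (n + 1) => radialIntegrand κ z p.1 p.2 := by
  have h1 : Continuous fun p : ℝ × HermitianCoords (n + 1) => charDet p.2 z :=
    (continuous_charDet_left z).comp continuous_snd
  have h2 : Continuous fun p : ℝ × HermitianCoords (n + 1) => charDet (minor p.2) z :=
    (continuous_charDet_left z).comp (continuous_minor.comp continuous_snd)
  have h3 : ∀ j, Continuous fun p : ℝ × HermitianCoords (n + 1) => shifted p.2 z 0 j := fun j =>
    (continuous_shifted.comp (by fun_prop : Continuous fun p : ℝ × HermitianCoords (n + 1) =>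
      (p.2, z))).matrix_elem 0 j
  have h4 : Continuous fun p : ℝ × HermitianCoords (n + 1) =>
      ∑ j, Complex.normSq (shifted p.2 z 0 j) :=
    continuous_finsetSum _ fun j _ => Complex.continuous_normSq.comp (h3 j)
  have h5 : Continuous fun p : ℝ × HermitianCoords (n + 1) =>
      Complex.normSq ((1 + p.1) * charDet p.2 z -
        2 * z.im * Complex.I * (p.1 * charDet (minor p.2) z)) :=
    Complex.continuous_normSq.comp (by fun_prop)
  unfold radialIntegrand
  exact Continuous.measurable (by fun_prop)

lemma measurable_radialIntegrand (z : ℂ) (s : ℝ) :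
    Measurable (radialIntegrand κ z s : HermitianCoords (n + 1) → ℝ) :=
  (measurable_radialIntegrand_joint z).comp measurable_prodMk_left

lemma sqNorm_smul (c : ℂ) (b : Fin n → ℂ) : sqNorm (c • b) = Complex.normSq c * sqNorm b := by
  simp [sqNorm, Finset.mul_sum]

lemma rowForm_smul_right (M : Matrix (Fin n) (Fin n) ℂ) (c : ℂ) (b : Fin n → ℂ) :
    rowForm M (c • b) = Complex.normSq c * rowForm M b := by
  simp only [rowForm_eq_sum, Finset.mul_sum]
  refine Finset.sum_congr rfl fun i _ => Finset.sum_congr rfl fun j _ => ?_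
  rw [← Complex.mul_conj]
  simp
  ring

/-- Collecting quadratic terms, the corner a' occurs as κ(1+s)²a'²/2 and the row b' as κ(1+s)|b'|².
The substitutions (1+s)a' = a + s Re z and √(1+s) b' = b therefore restore the standard Gaussian
weights. In the determinant, (1+s)(z - a') - 2is Im z becomes z - a - is Im z, which is a rank-one
shift by c = s Im z. -/
lemma radialIntegrand_bordered (hz : (z : ℂ).im ≠ 0) {s : ℝ} (hs : 0 < 1 + s) (a : ℝ)
    (b : Fin n → ℂ) (x : HermitianCoords n) :
    Real.exp (-(κ / 2) * ((a + s * z.re) / (1 + s)) ^ 2) *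
      Real.exp (-κ * sqNorm ((((√(1 + s))⁻¹ : ℝ) : ℂ) • b)) *
      radialIntegrand κ z s
        (bordered n ((a + s * z.re) / (1 + s), (((√(1 + s))⁻¹ : ℝ) : ℂ) • b, x)) =
    Real.exp (-κ * (s * z.im ^ 2) - κ / 2 * z.re ^ 2) *
      (Real.exp (-(κ / 2) * a ^ 2) * Real.exp (-κ * sqNorm b) *
        Complex.normSq (charDet (bordered n (a, b, x)) z -
          Complex.I * ((z.im * s : ℝ) : ℂ) * charDet x z)) := by
  have hsc : (1 + (s : ℂ)) ≠ 0 := by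
    have : ((1 + s : ℝ) : ℂ) ≠ 0 := by exact_mod_cast hs.ne'
    simpa using this
  have hn : Complex.normSq ((((√(1 + s))⁻¹ : ℝ) : ℂ)) = (1 + s)⁻¹ := by
    rw [Complex.normSq_ofReal, ← mul_inv, Real.mul_self_sqrt hs.le]
  set b' := (((√(1 + s))⁻¹ : ℝ) : ℂ) • b with hb'
  set a' := (a + s * z.re) / (1 + s) with ha'
  have hq : sqNorm b' = (1 + s)⁻¹ * sqNorm b := by rw [hb', sqNorm_smul, hn]
  have hrow : ∑ j, Complex.normSq (shifted (bordered n (a', b', x)) z 0 j) =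
      (z.re - a') ^ 2 + z.im ^ 2 + sqNorm b' := by
    rw [Fin.sum_univ_succ, shifted_zero_zero]
    simp only [shifted_zero_succ, Complex.normSq_neg]
    rw [← sqNorm, Complex.normSq_apply]
    simp
    ring
  have hdet : (1 + (s : ℂ)) * charDet (bordered n (a', b', x)) z -
      2 * z.im * Complex.I * (s * charDet (minor (bordered n (a', b', x))) z) =
      charDet (bordered n (a, b, x)) z - Complex.I * ((z.im * s : ℝ) : ℂ) * charDet x z := by
    rw [minor_bordered, charDet_bordered _ _ _ hz, charDet_bordered _ _ _ hz, hb',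
      rowForm_smul_right, hn, ha']
    have hzz : z = z.re + z.im * Complex.I := (Complex.re_add_im z).symm
    push_cast
    generalize rowForm (shifted x z).adjugate b = R
    generalize charDet x z = D
    field_simp
    linear_combination (D * s) * hzz
  rw [radialIntegrand, hdet, hrow, bordered_fst_zero, hq]
  simp only [← mul_assoc]
  congr 1
  simp only [← Real.exp_add]
  congr 1
  rw [ha']
  field_simp
  ring

/-- The corner contributes the Jacobian (1+s)⁻¹ and the n complex row entries contribute (1+s)⁻ⁿ,
which gives the exponent n + 1. -/
lemma lintegral_radialIntegrand {z : ℂ} (hz : z.im ≠ 0) {s : ℝ} (hs : 0 ≤ s) :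
    ∫⁻ y, ENNReal.ofReal (radialIntegrand κ z s y) ∂(hermitianGaussian κ (n + 1)) =
      ENNReal.ofReal (Real.exp (-κ * (s * z.im ^ 2) - κ / 2 * z.re ^ 2) * ((1 + s)⁻¹) ^ (n + 1)) *
        deformedLIntegral κ n (z.im * s) z := by
  have hs1 : 0 < 1 + s := by linarith
  have hc1 := continuous_charDet_left (n := n + 1) z
  have hc2 : Continuous fun y : HermitianCoords (n + 1) => charDet (minor y) z :=
    (continuous_charDet_left z).comp continuous_minor
  have hmN : Measurable fun y : HermitianCoords (n + 1) => ENNReal.ofReal (Complex.normSq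
      (charDet y z - Complex.I * ((z.im * s : ℝ) : ℂ) * charDet (minor y) z)) :=
    ENNReal.measurable_ofReal.comp
      (Complex.continuous_normSq.comp (by fun_prop)).measurable
  have hmR := (measurable_radialIntegrand (κ := κ) (n := n) z s).ennreal_ofReal
  rw [deformedLIntegral, lintegral_bordered hmN, lintegral_bordered hmR,
    lintegral_affine (1 + s) (s * z.re) hs1]
  set K : ℝ := Real.exp (-κ * (s * z.im ^ 2) - κ / 2 * z.re ^ 2) with hK
  set A : Matrix (Fin n) (Fin n) ℂ := (((√(1 + s))⁻¹ : ℝ) : ℂ) • 1 with hA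
  have hAdet : Complex.normSq A.det = ((1 + s)⁻¹) ^ n := by
    rw [hA, Matrix.det_smul, Matrix.det_one, mul_one, Fintype.card_fin, map_pow,
      Complex.normSq_ofReal, ← mul_inv, Real.mul_self_sqrt hs1.le]
  have hAne : A.det ≠ 0 := by
    rw [← Complex.normSq_pos, hAdet]; positivity
  have hvec : ∀ u : Fin n → ℂ, Matrix.vecMul u A = (((√(1 + s))⁻¹ : ℝ) : ℂ) • u := fun u => by
    rw [hA, Matrix.vecMul_smul, Matrix.vecMul_one]
  have hin : ∀ a : ℝ, ENNReal.ofReal (Real.exp (-(κ / 2) * ((a + s * z.re) / (1 + s)) ^ 2)) *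
      ∫⁻ b : Fin n → ℂ, ENNReal.ofReal (Real.exp (-κ * sqNorm b)) *
        ∫⁻ x, ENNReal.ofReal (radialIntegrand κ z s
          (bordered n ((a + s * z.re) / (1 + s), b, x))) ∂(hermitianGaussian κ n) =
      ENNReal.ofReal (K * ((1 + s)⁻¹) ^ n) *
      (ENNReal.ofReal (Real.exp (-(κ / 2) * a ^ 2)) *
      ∫⁻ b : Fin n → ℂ, ENNReal.ofReal (Real.exp (-κ * sqNorm b)) *
        ∫⁻ x, ENNReal.ofReal (Complex.normSq (charDet (bordered n (a, b, x)) z -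
          Complex.I * ((z.im * s : ℝ) : ℂ) * charDet (minor (bordered n (a, b, x))) z))
          ∂(hermitianGaussian κ n)) := by
    intro a
    have hm1 : Measurable fun b : Fin n → ℂ => ∫⁻ x, ENNReal.ofReal (radialIntegrand κ z s
          (bordered n ((a + s * z.re) / (1 + s), b, x))) ∂(hermitianGaussian κ n) :=
      Measurable.lintegral_prod_right' (f := fun p : (Fin n → ℂ) × HermitianCoords n =>
        ENNReal.ofReal (radialIntegrand κ z s (bordered n ((a + s * z.re) / (1 + s), p.1, p.2))))
        (hmR.comp ((bordered n).measurable.comp (by fun_prop)))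
    have hm2 : Measurable fun b : Fin n → ℂ => ENNReal.ofReal (Real.exp (-κ * sqNorm b)) *
        ∫⁻ x, ENNReal.ofReal (radialIntegrand κ z s
          (bordered n ((a + s * z.re) / (1 + s), b, x))) ∂(hermitianGaussian κ n) :=
      Measurable.mul (by fun_prop) hm1
    rw [lintegral_vecMul A hAne hm2, hAdet,
      ← lintegral_const_mul' _ _ ENNReal.ofReal_ne_top,
      ← lintegral_const_mul' _ _ ENNReal.ofReal_ne_top,
      ← lintegral_const_mul' _ _ ENNReal.ofReal_ne_top,
      ← lintegral_const_mul' _ _ ENNReal.ofReal_ne_top]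
    refine lintegral_congr fun b => ?_
    simp only [← lintegral_const_mul' _ _ ENNReal.ofReal_ne_top]
    refine lintegral_congr fun x => ?_
    rw [hvec]
    simp only [← ENNReal.ofReal_mul (Real.exp_nonneg _),
      ← ENNReal.ofReal_mul (pow_nonneg (inv_nonneg.2 hs1.le) n)]
    rw [← ENNReal.ofReal_mul (by positivity)]
    congr 1
    have := radialIntegrand_bordered (κ := κ) hz hs1 a b x
    rw [minor_bordered]
    linear_combination ((1 + s)⁻¹) ^ n * this
  simp only [hin]
  rw [lintegral_const_mul' _ _ ENNReal.ofReal_ne_top, ← mul_assoc,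
    ← ENNReal.ofReal_mul (by positivity)]
  congr 2
  ring

end RankOneGUE
end

/-! ### The Kac–Rice formula integrated over the coupling -/

noncomputable section
namespace RankOneGUE
variable {n : ℕ} {κ : ℝ}

/-- The weight of `w = a + i γ` when `a` is Gaussian and `γ` is restricted to `S`. -/
def slabWeight (κ : ℝ) (S : Set ℝ) (w : ℂ) : ENNReal :=
  S.indicator 1 w.im * ENNReal.ofReal (Real.exp (-(κ / 2) * w.re ^ 2))

lemma measurable_slabWeight {S : Set ℝ} (hS : MeasurableSet S) : Measurable (slabWeight κ S) := by
  unfold slabWeight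
  refine Measurable.mul ?_ (by fun_prop)
  exact (measurable_one.indicator hS).comp Complex.measurable_im

lemma fiberSum_mul (U : Set ℂ) (g : ℂ → ℂ) (W F : ℂ → ENNReal) (w : ℂ) :
    fiberSum U g (fun z => W (g z) * F z) w = W w * fiberSum U g F w := by
  rw [fiberSum, fiberSum, ← ENNReal.tsum_mul_left]
  congr 1; ext z
  by_cases hz : z ∈ {z | (z ∈ U ∧ deriv g z ≠ 0) ∧ g z = w}
  · rw [Set.indicator_of_mem hz, Set.indicator_of_mem hz, hz.2]
  · rw [Set.indicator_of_notMem hz, Set.indicator_of_notMem hz, mul_zero]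

lemma measurable_eigenvalueSum {X : Type*} [MeasurableSpace X] {f : ℝ × ℝ → ℝ} (hf : Continuous f)
    {g : X → ℝ} {h : X → HermitianCoords n} (hg : Measurable g) (hh : Measurable h) :
    Measurable fun t => ENNReal.ofReal (eigenvalueSum (g t) f (h t)) := by
  have h1 : Measurable fun p : ℝ × HermitianCoords n => eigenvalueSum p.1 f p.2 :=
    (continuous_eigenvalueSum hf).measurable
  have h2 : Measurable fun t => (g t, h t) := hg.prodMk hh
  exact (h1.comp h2).ennreal_ofReal

/-- Integrating over γ as well as over the corner makes w = a + iγ range over a two-dimensional set,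
as the area formula requires. Since b and x are fixed, the secular function is one holomorphic map
throughout. -/
lemma lintegral_line_eigenvalueSum {f : ℝ × ℝ → ℝ} (hfc : Continuous f) (hf0 : ∀ p, 0 ≤ f p)
    (hf : ∀ p : ℝ × ℝ, p.2 ≤ 0 → f p = 0) {S : Set ℝ} (hS : MeasurableSet S)
    (b : Fin n → ℂ) (x : HermitianCoords n) :
    ∫⁻ γ in S, ∫⁻ a, ENNReal.ofReal (eigenvalueSum γ f (bordered n (a, b, x))) ∂(lineGaussian κ) =
      ∫⁻ z in upperPlane, ENNReal.ofReal (Complex.normSq (secularDeriv b x z)) *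
        (slabWeight κ S (secular b x z) * ENNReal.ofReal (f (z.re, z.im))) := by
  have hE : Measurable fun p : ℝ × ℝ =>
      ENNReal.ofReal (eigenvalueSum p.2 f (bordered n (p.1, b, x))) := by
    have h1 : Measurable fun p : ℝ × ℝ => (p.1, b, x) := by fun_prop
    exact measurable_eigenvalueSum hfc measurable_snd ((bordered n).measurable.comp h1)
  have hsec : Measurable fun z => secular b x z :=
    measurable_secular.comp (by fun_prop : Measurable fun z : ℂ => (b, x, z))
  have hF : Measurable fun z : ℂ => slabWeight κ S (secular b x z) *
      ENNReal.ofReal (f (z.re, z.im)) := by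
    refine ((measurable_slabWeight hS).comp hsec).mul (ENNReal.measurable_ofReal.comp ?_)
    exact hfc.measurable.comp (by fun_prop)
  have hU := isOpen_upperPlane
  have hd := differentiableOn_secular b x
  have e1 : ∫⁻ z in upperPlane, ENNReal.ofReal (Complex.normSq (secularDeriv b x z)) *
        (slabWeight κ S (secular b x z) * ENNReal.ofReal (f (z.re, z.im))) =
      ∫⁻ w, fiberSum upperPlane (secular b x) (fun z => slabWeight κ S (secular b x z) *
        ENNReal.ofReal (f (z.re, z.im))) w := by
    rw [lintegral_fiberSum hU hd hF]
    refine setLIntegral_congr_fun hU.measurableSet fun z hz => ?_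
    simp only [deriv_secular b x hz]
  have e2 : ∫⁻ w, fiberSum upperPlane (secular b x) (fun z => slabWeight κ S (secular b x z) *
        ENNReal.ofReal (f (z.re, z.im))) w = ∫⁻ w : ℂ, slabWeight κ S w *
          ENNReal.ofReal (eigenvalueSum w.im f (bordered n (w.re, b, x))) := by
    -- Values of w attained at a critical point, where eigenvalues may be multiple, form a null set.
    refine lintegral_congr_ae ((ae_regular hU hd).mono fun w hw => ?_)
    beta_reduce
    rw [fiberSum_mul, eigenvalueSum_eq_fiberSum hf0 hf w.im w.re b x
      (fun z hz h => hw z hz (by rw [h, Complex.re_add_im])), Complex.re_add_im]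
  have hprod : Measurable fun p : ℝ × ℝ => slabWeight κ S (Complex.mk p.1 p.2) *
      ENNReal.ofReal (eigenvalueSum p.2 f (bordered n (p.1, b, x))) := by
    refine ((measurable_slabWeight hS).comp ?_).mul hE
    exact Complex.measurableEquivRealProd.symm.measurable
  rw [e1, e2]
  have e3 := Complex.volume_preserving_equiv_real_prod.lintegral_comp_emb
    Complex.measurableEquivRealProd.measurableEmbedding (fun p : ℝ × ℝ =>
      slabWeight κ S (Complex.mk p.1 p.2) *
        ENNReal.ofReal (eigenvalueSum p.2 f (bordered n (p.1, b, x))))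
  simp only [Complex.measurableEquivRealProd_apply, Complex.eta] at e3
  rw [e3, Measure.volume_eq_prod, lintegral_prod_symm _ hprod.aemeasurable,
      ← lintegral_indicator hS]
  refine lintegral_congr fun γ => ?_
  by_cases hγ : γ ∈ S
  · have hEγ : Measurable fun a : ℝ =>
        ENNReal.ofReal (eigenvalueSum γ f (bordered n (a, b, x))) :=
      measurable_eigenvalueSum hfc measurable_const
        ((bordered n).measurable.comp (by fun_prop : Measurable fun a : ℝ => (a, b, x)))
    rw [Set.indicator_of_mem hγ, lineGaussian,
      lintegral_withDensity_eq_lintegral_mul _ (by fun_prop) hEγ]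
    refine lintegral_congr fun a => ?_
    simp [slabWeight, hγ]
  · rw [Set.indicator_of_notMem hγ]
    simp [slabWeight, hγ]

lemma measurable_rowForm_adjugate (z : ℂ) :
    Measurable fun p : (Fin n → ℂ) × HermitianCoords n => rowForm (shifted p.2 z).adjugate p.1 := by
  refine measurable_rowForm (fun i j => ?_) measurable_fst
  exact ((continuous_shifted.comp (by fun_prop : Continuous
    fun p : (Fin n → ℂ) × HermitianCoords n => (p.2,
        z))).matrix_adjugate.matrix_elem i j).measurable

lemma measurable_kacRiceIntegrand (z : ℂ) :
    Measurable fun p : (Fin n → ℂ) × HermitianCoords n => kacRiceIntegrand κ z p.1 p.2 := by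
  have h1 : Continuous fun p : (Fin n → ℂ) × HermitianCoords n =>
      Matrix.vecMul p.1 (shifted p.2 z) :=
    continuous_fst.matrix_vecMul (continuous_shifted.comp (by fun_prop : Continuous
    fun p : (Fin n → ℂ) × HermitianCoords n => (p.2, z)))
  have h2 : Measurable fun p : (Fin n → ℂ) × HermitianCoords n =>
      rowForm (hermitianMatrix p.2) p.1 :=
    measurable_rowForm (fun i j => ((continuous_hermitianMatrix.comp continuous_snd).matrix_elem
      i j).measurable) measurable_fst
  have h3 := measurable_rowForm_adjugate (n := n) z
  have h4 : Measurable fun p : (Fin n → ℂ) × HermitianCoords n => charDet p.2 z :=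
    ((continuous_charDet_left z).comp continuous_snd).measurable
  have h5 : Measurable fun p : (Fin n → ℂ) × HermitianCoords n => sqNorm p.1 :=
    measurable_sqNorm.comp measurable_fst
  have h6 : Measurable fun p : (Fin n → ℂ) × HermitianCoords n =>
      sqNorm (Matrix.vecMul p.1 (shifted p.2 z)) := measurable_sqNorm.comp h1.measurable
  have h7 : Measurable fun p : (Fin n → ℂ) × HermitianCoords n => Complex.normSq
      ((1 + sqNorm p.1) * charDet p.2 z -
        2 * z.im * Complex.I * rowForm (shifted p.2 z).adjugate p.1) :=
    Complex.continuous_normSq.measurable.comp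
      (((measurable_const.add (Complex.measurable_ofReal.comp h5)).mul h4).sub (h3.const_mul _))
  unfold kacRiceIntegrand
  have h8 : Measurable fun p : (Fin n → ℂ) × HermitianCoords n =>
      (rowForm (hermitianMatrix p.2) p.1).re := Complex.measurable_re.comp h2
  fun_prop

lemma measurable_ofReal_kacRiceIntegrand {X : Type*} [MeasurableSpace X] (z : ℂ)
    {u : X → Fin n → ℂ} {x : X → HermitianCoords n} (hu : Measurable u) (hx : Measurable x) :
    Measurable fun t => ENNReal.ofReal (kacRiceIntegrand κ z (u t) (x t)) := by
  have h : Measurable fun t => (u t, x t) := hu.prodMk hx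
  exact ((measurable_kacRiceIntegrand z).comp h).ennreal_ofReal

lemma measurable_secular_weight {X : Type*} [MeasurableSpace X] {S : Set ℝ} (hS : MeasurableSet S)
    {b : X → Fin n → ℂ} {x : X → HermitianCoords n} {z : X → ℂ} (hb : Measurable b)
    (hx : Measurable x) (hz : Measurable z) :
    Measurable fun t => ENNReal.ofReal (Complex.normSq (secularDeriv (b t) (x t) (z t))) *
      slabWeight κ S (secular (b t) (x t) (z t)) := by
  have h : Measurable fun t => (b t, x t, z t) := hb.prodMk (hx.prodMk hz)
  exact (ENNReal.measurable_ofReal.comp (Complex.continuous_normSq.measurable.comp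
      (measurable_secularDeriv.comp h))).mul
      ((measurable_slabWeight hS).comp (measurable_secular.comp h))

/-- Kac–Rice after the substitution `b = u (z - H)`, for fixed `z` and `H`. -/
lemma lintegral_row_secular {z : ℂ} (hz : z ∈ upperPlane) {S : Set ℝ} (hS : MeasurableSet S)
    (x : HermitianCoords n) :
    ∫⁻ b, ENNReal.ofReal (Complex.normSq (secularDeriv b x z)) * slabWeight κ S (secular b x z)
      ∂(rowGaussian κ n) =
    ∫⁻ u, S.indicator 1 (z.im * (1 + sqNorm u)) * ENNReal.ofReal (kacRiceIntegrand κ z u x) := by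
  have hz' : z.im ≠ 0 := ne_of_gt hz
  have hm : Measurable fun b : Fin n → ℂ => ENNReal.ofReal (Complex.normSq (secularDeriv b x z)) *
      slabWeight κ S (secular b x z) :=
    measurable_secular_weight hS measurable_id measurable_const measurable_const
  rw [rowGaussian, lintegral_withDensity_eq_lintegral_mul _ (by fun_prop) hm]
  have hm2 : Measurable ((fun b : Fin n → ℂ => ENNReal.ofReal (Real.exp (-κ * sqNorm b))) *
      fun b : Fin n → ℂ => ENNReal.ofReal (Complex.normSq (secularDeriv b x z)) *
      slabWeight κ S (secular b x z)) := Measurable.mul (by fun_prop) hm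
  rw [lintegral_vecMul (shifted x z) (charDet_ne_zero x hz') hm2,
    ← lintegral_const_mul' _ _ ENNReal.ofReal_ne_top]
  refine lintegral_congr fun u => ?_
  rw [Pi.mul_apply, slabWeight, secular_vecMul_im x hz', secular_vecMul_re x hz', kacRiceIntegrand,
    ← charDet_mul_secularDeriv x hz', ← charDet, map_mul,
    ENNReal.ofReal_mul (by positivity), ENNReal.ofReal_mul (by positivity),
    ENNReal.ofReal_mul (Complex.normSq_nonneg _)]
  ring

/-- The block is integrated before u, so that for each fixed u the rotation is available. The result
depends only on r = |u|² and reduces to a one-dimensional radial integral. -/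
lemma lintegral_gaussian_secular (hκ : 0 < κ) {z : ℂ} (hz : z ∈ upperPlane) {S : Set ℝ}
    (hS : MeasurableSet S) :
    ∫⁻ p, ENNReal.ofReal (Complex.normSq (secularDeriv p.1 p.2 z)) *
        slabWeight κ S (secular p.1 p.2 z)
      ∂((rowGaussian κ (n + 1)).prod (hermitianGaussian κ (n + 1))) =
    ∫⁻ r in Set.Ioi (0 : ℝ), ENNReal.ofReal (Real.pi ^ (n + 1) / n.factorial * r ^ n) *
      (S.indicator 1 (z.im * (1 + r)) *
        (ENNReal.ofReal (Real.exp (-κ * (r * z.im ^ 2) - κ / 2 * z.re ^ 2) *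
          ((1 + r)⁻¹) ^ (n + 1)) * deformedLIntegral κ n (z.im * r) z)) := by
  have hz' : z.im ≠ 0 := ne_of_gt hz
  have hm : Measurable fun p : (Fin (n + 1) → ℂ) × HermitianCoords (n + 1) =>
      ENNReal.ofReal (Complex.normSq (secularDeriv p.1 p.2 z)) *
      slabWeight κ S (secular p.1 p.2 z) :=
    measurable_secular_weight hS measurable_fst measurable_snd measurable_const
  have hind : Measurable fun r : ℝ => (S.indicator 1 (z.im * (1 + r)) : ENNReal) :=
    (measurable_one.indicator hS).comp (by fun_prop)
  rw [lintegral_prod_symm _ hm.aemeasurable]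
  simp only [lintegral_row_secular hz hS]
  have hind' : Measurable fun p : HermitianCoords (n + 1) × (Fin (n + 1) → ℂ) =>
      (S.indicator 1 (z.im * (1 + sqNorm p.2)) : ENNReal) :=
    hind.comp (measurable_sqNorm.comp measurable_snd)
  have hk' : Measurable fun p : HermitianCoords (n + 1) × (Fin (n + 1) → ℂ) =>
      ENNReal.ofReal (kacRiceIntegrand κ z p.2 p.1) :=
    measurable_ofReal_kacRiceIntegrand z measurable_snd measurable_fst
  rw [lintegral_lintegral_swap (hind'.mul hk').aemeasurable]
  have e1 : ∀ u : Fin (n + 1) → ℂ, ∫⁻ x, S.indicator 1 (z.im * (1 + sqNorm u)) *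
      ENNReal.ofReal (kacRiceIntegrand κ z u x) ∂(hermitianGaussian κ (n + 1)) =
      (fun r => S.indicator 1 (z.im * (1 + r)) * ∫⁻ y, ENNReal.ofReal (radialIntegrand κ z r y)
        ∂(hermitianGaussian κ (n + 1))) (sqNorm u) := by
    intro u
    have hk : Measurable fun x : HermitianCoords (n + 1) =>
        ENNReal.ofReal (kacRiceIntegrand κ z u x) :=
      measurable_ofReal_kacRiceIntegrand z measurable_const measurable_id
    rw [lintegral_const_mul _ hk, lintegral_kacRiceIntegrand hκ]
  simp only [e1]
  have hrad : Measurable fun r => ∫⁻ y, ENNReal.ofReal (radialIntegrand κ z r y)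
        ∂(hermitianGaussian κ (n + 1)) := by
    refine Measurable.lintegral_prod_right' (f := fun p : ℝ × HermitianCoords (n + 1) =>
      ENNReal.ofReal (radialIntegrand κ z p.1 p.2)) (ENNReal.measurable_ofReal.comp ?_)
    exact measurable_radialIntegrand_joint z
  refine (lintegral_sqNorm n _ (hind.mul hrad)).trans ?_
  refine setLIntegral_congr_fun measurableSet_Ioi fun r hr => ?_
  simp only [Pi.mul_apply, lintegral_radialIntegrand hz' (le_of_lt hr)]

/-- The Kac–Rice formula, integrated over the coupling. -/
lemma lintegral_eigenvalueSum (hκ : 0 < κ) {f : ℝ × ℝ → ℝ} (hfc : Continuous f)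
    (hf0 : ∀ p, 0 ≤ f p) (hf : ∀ p : ℝ × ℝ, p.2 ≤ 0 → f p = 0) {S : Set ℝ}
    (hS : MeasurableSet S) :
    ∫⁻ γ in S, ∫⁻ y, ENNReal.ofReal (eigenvalueSum γ f y) ∂(hermitianGaussian κ (n + 2)) =
      ∫⁻ z in upperPlane, ENNReal.ofReal (f (z.re, z.im)) *
        ∫⁻ r in Set.Ioi (0 : ℝ), ENNReal.ofReal (Real.pi ^ (n + 1) / n.factorial * r ^ n) *
      (S.indicator 1 (z.im * (1 + r)) *
        (ENNReal.ofReal (Real.exp (-κ * (r * z.im ^ 2) - κ / 2 * z.re ^ 2) *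
          ((1 + r)⁻¹) ^ (n + 1)) * deformedLIntegral κ n (z.im * r) z)) := by
  have hE : Measurable fun p : ℝ × ℝ × (Fin (n + 1) → ℂ) × HermitianCoords (n + 1) =>
      ENNReal.ofReal (eigenvalueSum p.1 f (bordered (n + 1) p.2)) :=
    measurable_eigenvalueSum hfc measurable_fst
      ((bordered (n + 1)).measurable.comp measurable_snd)
  have hf' : Measurable fun z : ℂ => ENNReal.ofReal (f (z.re, z.im)) :=
    ENNReal.measurable_ofReal.comp (hfc.measurable.comp (by fun_prop))
  have e1 : ∀ γ : ℝ, ∫⁻ y, ENNReal.ofReal (eigenvalueSum γ f y) ∂(hermitianGaussian κ (n + 2)) =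
      ∫⁻ p, ∫⁻ a, ENNReal.ofReal (eigenvalueSum γ f (bordered (n + 1) (a, p))) ∂(lineGaussian κ)
        ∂((rowGaussian κ (n + 1)).prod (hermitianGaussian κ (n + 1))) := fun γ => by
    have hEγ : Measurable fun t : ℝ × (Fin (n + 1) → ℂ) × HermitianCoords (n + 1) =>
        ENNReal.ofReal (eigenvalueSum γ f (bordered (n + 1) t)) :=
      measurable_eigenvalueSum hfc measurable_const (bordered (n + 1)).measurable
    rw [(measurePreserving_bordered_gaussian κ (n + 1)).lintegral_map_equiv,
      lintegral_prod_symm _ hEγ.aemeasurable]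
  simp only [e1]
  have hE1 : Measurable fun q : (ℝ × (Fin (n + 1) → ℂ) × HermitianCoords (n + 1)) × ℝ =>
      ENNReal.ofReal (eigenvalueSum q.1.1 f (bordered (n + 1) (q.2, q.1.2))) :=
    measurable_eigenvalueSum hfc (by fun_prop) ((bordered (n + 1)).measurable.comp
      (by fun_prop : Measurable fun q : (ℝ × (Fin (n + 1) → ℂ) × HermitianCoords (n + 1)) × ℝ =>
        (q.2, q.1.2)))
  have hE2 : Measurable fun q : ℝ × (Fin (n + 1) → ℂ) × HermitianCoords (n + 1) =>
      ∫⁻ a, ENNReal.ofReal (eigenvalueSum q.1 f (bordered (n + 1) (a, q.2))) ∂(lineGaussian κ) :=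
    Measurable.lintegral_prod_right' hE1
  rw [lintegral_lintegral_swap hE2.aemeasurable]
  have e2 : ∀ p : (Fin (n + 1) → ℂ) × HermitianCoords (n + 1), ∫⁻ γ in S, ∫⁻ a,
      ENNReal.ofReal (eigenvalueSum γ f (bordered (n + 1) (a, p))) ∂(lineGaussian κ) =
      ∫⁻ z in upperPlane, ENNReal.ofReal (Complex.normSq (secularDeriv p.1 p.2 z)) *
        (slabWeight κ S (secular p.1 p.2 z) * ENNReal.ofReal (f (z.re, z.im))) := fun p =>
    lintegral_line_eigenvalueSum hfc hf0 hf hS p.1 p.2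
  simp only [e2]
  have hm : Measurable fun p : ((Fin (n + 1) → ℂ) × HermitianCoords (n + 1)) × ℂ =>
      ENNReal.ofReal (Complex.normSq (secularDeriv p.1.1 p.1.2 p.2)) *
        slabWeight κ S (secular p.1.1 p.1.2 p.2) :=
    measurable_secular_weight hS (by fun_prop) (by fun_prop) (by fun_prop)
  simp only [← mul_assoc]
  rw [lintegral_lintegral_swap (hm.mul (hf'.comp measurable_snd)).aemeasurable]
  refine setLIntegral_congr_fun isOpen_upperPlane.measurableSet fun z hz => ?_
  have hmz : Measurable fun p : (Fin (n + 1) → ℂ) × HermitianCoords (n + 1) =>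
      ENNReal.ofReal (Complex.normSq (secularDeriv p.1 p.2 z)) *
        slabWeight κ S (secular p.1 p.2 z) :=
    measurable_secular_weight hS measurable_fst measurable_snd measurable_const
  rw [lintegral_mul_const _ hmz, lintegral_gaussian_secular hκ hz hS, mul_comm]
  simp only [mul_assoc]

end RankOneGUE
end

/-! ### The explicit spectral profile -/

noncomputable section
namespace RankOneGUE
variable {n : ℕ} {κ : ℝ}

lemma PolyGrowth.sub {E : Type*} [NormedAddCommGroup E] {f g : E → ℂ} (hf : PolyGrowth f)
    (hg : PolyGrowth g) : PolyGrowth fun x => f x - g x := by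
  obtain ⟨hf, C, k, hC, h⟩ := hf
  obtain ⟨hg, C', k', hC', h'⟩ := hg
  refine ⟨hf.sub hg, C + C', k + k', by positivity, fun x => ?_⟩
  have h1 : (1 : ℝ) ≤ 1 + ‖x‖ := by linarith [norm_nonneg x]
  calc ‖f x - g x‖ ≤ C * (1 + ‖x‖) ^ k + C' * (1 + ‖x‖) ^ k' :=
        (norm_sub_le _ _).trans (add_le_add (h x) (h' x))
    _ ≤ C * (1 + ‖x‖) ^ (k + k') + C' * (1 + ‖x‖) ^ (k + k') := by
        gcongr <;> first | exact h1 | omega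
    _ = _ := by ring

lemma polyGrowth_const {E : Type*} [NormedAddCommGroup E] (c : ℂ) :
    PolyGrowth fun _ : E => c :=
  ⟨continuous_const, ‖c‖, 0, norm_nonneg _, fun _ => by simp⟩

lemma integrable_normSq_deformed (hκ : 0 < κ) (c : ℝ) (z : ℂ) :
    Integrable (fun y : HermitianCoords (n + 1) =>
      Complex.normSq (charDet y z - Complex.I * c * charDet (minor y) z))
      (hermitianGaussian κ (n + 1)) := by
  have h : PolyGrowth fun y : HermitianCoords (n + 1) =>
      charDet y z - Complex.I * c * charDet (minor y) z :=
    (polyGrowth_charDet z).sub ((polyGrowth_const _).mul (polyGrowth_charDet_minor z))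
  refine ((h.mul h).integrable hκ).norm.congr (ae_of_all _ fun y => ?_)
  beta_reduce
  rw [norm_mul, Complex.norm_mul_self_eq_normSq]

lemma integral_normSq_deformed_eq (hκ : 0 < κ) {z : ℂ} (hz : z.im ≠ 0) (c : ℝ) :
    ∫ y, Complex.normSq (charDet y z - Complex.I * c * charDet (minor y) z)
      ∂(hermitianGaussian κ (n + 1)) =
      gaussianMass κ (n + 1) * (deformedMoment κ n c z).re := by
  have h := congrArg Complex.re (integral_normSq_deformed hκ hz n c)
  rwa [Complex.ofReal_re, Complex.re_ofReal_mul] at h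

lemma deformedLIntegral_eq (hκ : 0 < κ) {z : ℂ} (hz : z.im ≠ 0) (c : ℝ) :
    deformedLIntegral κ n c z =
      ENNReal.ofReal (gaussianMass κ (n + 1) * (deformedMoment κ n c z).re) := by
  rw [deformedLIntegral, ← integral_normSq_deformed_eq hκ hz,
    ofReal_integral_eq_lintegral_ofReal (integrable_normSq_deformed hκ c z)
      (ae_of_all _ fun _ => Complex.normSq_nonneg _)]

lemma gaussianMass_mul_deformedMoment_nonneg (hκ : 0 < κ) {z : ℂ} (hz : z.im ≠ 0) (c : ℝ) :
    0 ≤ gaussianMass κ (n + 1) * (deformedMoment κ n c z).re := by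
  rw [← integral_normSq_deformed_eq hκ hz]
  exact integral_nonneg fun _ => Complex.normSq_nonneg _

lemma continuous_monicHermite (κ : ℝ) : ∀ k, Continuous fun z => monicHermite κ z k
  | 0 => by simpa [monicHermite] using continuous_const
  | 1 => continuous_id
  | k + 2 => by
      have h1 := continuous_monicHermite κ (k + 1)
      have h0 := continuous_monicHermite κ k
      simp only [monicHermite_succ_succ]
      fun_prop

lemma continuous_hermiteKernel_star (κ : ℝ) (k : ℕ) :
    Continuous fun z : ℂ => hermiteKernel κ z (star z) k := by
  unfold hermiteKernel hermiteTerm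
  refine continuous_finsetSum _ fun j _ => continuous_const.mul ?_
  exact (continuous_monicHermite κ j).mul ((continuous_monicHermite κ j).comp continuous_star)

lemma continuous_deformedMoment (κ : ℝ) (n : ℕ) :
    Continuous fun p : ℝ × ℂ => deformedMoment κ n p.1 p.2 := by
  have h : ∀ k, Continuous fun p : ℝ × ℂ => hermiteKernel κ p.2 (star p.2) k := fun k =>
    (continuous_hermiteKernel_star κ k).comp continuous_snd
  have hs : Continuous fun p : ℝ × ℂ =>
      ∑ k ∈ Finset.range (n + 1), hermiteKernel κ p.2 (star p.2) k :=
    continuous_finsetSum _ fun k _ => h k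
  have h1 := h (n + 1)
  have h0 := h n
  unfold deformedMoment
  fun_prop

/-- The mean density of eigenvalues at `z` for the unnormalised Gaussian weight. -/
def spectralProfile (κ : ℝ) (n : ℕ) (γ : ℝ) (z : ℂ) : ℝ :=
  Real.pi ^ (n + 1) / n.factorial * ((max (γ - z.im) 0) ^ n / γ ^ (n + 1)) *
    Real.exp (-κ * (z.im * (γ - z.im)) - κ / 2 * z.re ^ 2) *
    (gaussianMass κ (n + 1) * (deformedMoment κ n (γ - z.im) z).re)

lemma continuous_deformedMoment_sub (κ : ℝ) (n : ℕ) :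
    Continuous fun p : ℝ × ℂ => (deformedMoment κ n (p.1 - p.2.im) p.2).re :=
  Complex.continuous_re.comp ((continuous_deformedMoment κ n).comp
    (by fun_prop : Continuous fun p : ℝ × ℂ => (p.1 - p.2.im, p.2)))

lemma measurable_spectralProfile (κ : ℝ) (n : ℕ) :
    Measurable fun p : ℝ × ℂ => spectralProfile κ n p.1 p.2 := by
  have h := (continuous_deformedMoment_sub κ n).measurable
  unfold spectralProfile
  fun_prop

lemma continuousOn_spectralProfile (κ : ℝ) (n : ℕ) :
    ContinuousOn (fun p : ℝ × ℂ => spectralProfile κ n p.1 p.2) (Set.Ioi 0 ×ˢ Set.univ) := by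
  have h := continuous_deformedMoment_sub κ n
  have h1 : ContinuousOn (fun p : ℝ × ℂ => (max (p.1 - p.2.im) 0) ^ n / p.1 ^ (n + 1))
      (Set.Ioi 0 ×ˢ Set.univ) :=
    ContinuousOn.div (by fun_prop) (by fun_prop) fun p hp => pow_ne_zero _ (ne_of_gt hp.1)
  unfold spectralProfile
  refine ContinuousOn.mul (ContinuousOn.mul (continuousOn_const.mul h1) ?_) ?_
  · fun_prop
  · exact (continuous_const.mul h).continuousOn

lemma spectralProfile_nonneg (hκ : 0 < κ) {γ : ℝ} (hγ : 0 < γ) {z : ℂ} (hz : z.im ≠ 0) :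
    0 ≤ spectralProfile κ n γ z :=
  mul_nonneg (by positivity) (gaussianMass_mul_deformedMoment_nonneg hκ hz _)

/-- The substitution is γ = y(1 + r) with y = Im z. The powers of y from dr, rⁿ and (1+r)⁻⁽ⁿ⁺¹⁾
cancel, and Im z · r becomes γ - y. The condition n ≠ 0 is what makes the truncated power max(γ - y,
0)ⁿ vanish for γ ≤ y. -/
lemma lintegral_radial_eq_profile (hκ : 0 < κ) (hn : n ≠ 0) {z : ℂ} (hz : z ∈ upperPlane)
    (S : Set ℝ) :
    ∫⁻ r in Set.Ioi (0 : ℝ), ENNReal.ofReal (Real.pi ^ (n + 1) / n.factorial * r ^ n) *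
      (S.indicator 1 (z.im * (1 + r)) *
        (ENNReal.ofReal (Real.exp (-κ * (r * z.im ^ 2) - κ / 2 * z.re ^ 2) *
          ((1 + r)⁻¹) ^ (n + 1)) * deformedLIntegral κ n (z.im * r) z)) =
      ∫⁻ γ, S.indicator 1 γ * ENNReal.ofReal (spectralProfile κ n γ z) := by
  have hy : 0 < z.im := hz
  rw [← lintegral_indicator measurableSet_Ioi, lintegral_affine z.im (-z.im) hy,
    ← lintegral_const_mul' _ _ ENNReal.ofReal_ne_top]
  refine lintegral_congr fun γ => ?_
  rcases lt_or_ge z.im γ with h | h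
  · have hr : 0 < (γ + -z.im) / z.im := div_pos (by linarith) hy
    have hγ : 0 < γ := hy.trans h
    have e1 : z.im * (1 + (γ + -z.im) / z.im) = γ := by field_simp; ring
    have e2 : z.im * ((γ + -z.im) / z.im) = γ - z.im := by field_simp; ring
    have e3 : 1 + (γ + -z.im) / z.im = γ / z.im := by field_simp; ring
    rw [Set.indicator_of_mem (by exact hr), e1, e2, e3, deformedLIntegral_eq hκ hy.ne',
      mul_left_comm (ENNReal.ofReal _) (S.indicator 1 γ), mul_left_comm (ENNReal.ofReal _)
        (S.indicator 1 γ)]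
    congr 1
    rw [← ENNReal.ofReal_mul (by positivity), ← ENNReal.ofReal_mul (by positivity),
      ← ENNReal.ofReal_mul (by positivity), spectralProfile, max_eq_left (by linarith)]
    congr 1
    rw [show -κ * ((γ + -z.im) / z.im * z.im ^ 2) = -κ * (z.im * (γ - z.im)) by field_simp; ring]
    generalize gaussianMass κ (n + 1) * (deformedMoment κ n (γ - z.im) z).re = G
    generalize Real.exp _ = E
    rw [show γ + -z.im = γ - z.im by ring, inv_div, div_pow, div_pow]
    field_simp
    ring
  · rw [Set.indicator_of_notMem (by
      rw [Set.mem_Ioi, not_lt]; exact div_nonpos_of_nonpos_of_nonneg (by linarith) hy.le),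
      spectralProfile, max_eq_right (by linarith), zero_pow hn]
    simp

lemma lintegral_eigenvalueSum_eq_profile (hκ : 0 < κ) (hn : n ≠ 0) {f : ℝ × ℝ → ℝ}
    (hfc : Continuous f) (hf0 : ∀ p, 0 ≤ f p) (hf : ∀ p : ℝ × ℝ, p.2 ≤ 0 → f p = 0) {S : Set ℝ}
    (hS : MeasurableSet S) :
    ∫⁻ γ in S, ∫⁻ y, ENNReal.ofReal (eigenvalueSum γ f y) ∂(hermitianGaussian κ (n + 2)) =
      ∫⁻ γ in S, ∫⁻ z in upperPlane,
        ENNReal.ofReal (f (z.re, z.im)) * ENNReal.ofReal (spectralProfile κ n γ z) := by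
  have hf' : Measurable fun z : ℂ => ENNReal.ofReal (f (z.re, z.im)) :=
    ENNReal.measurable_ofReal.comp (hfc.measurable.comp (by fun_prop))
  have hP := (measurable_spectralProfile κ n).ennreal_ofReal
  rw [lintegral_eigenvalueSum hκ hfc hf0 hf hS, lintegral_lintegral_swap
    ((hf'.comp measurable_snd).mul hP).aemeasurable]
  refine setLIntegral_congr_fun isOpen_upperPlane.measurableSet fun z hz => ?_
  rw [lintegral_radial_eq_profile hκ hn hz, lintegral_const_mul' _ _ ENNReal.ofReal_ne_top]
  congr 1
  rw [← lintegral_indicator hS]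
  refine lintegral_congr fun γ => ?_
  by_cases h : γ ∈ S <;> simp [h]

end RankOneGUE
end

/-! ### From almost every coupling to every coupling; the mean density -/

noncomputable section
namespace RankOneGUE
variable {n : ℕ} {κ : ℝ}

lemma isFiniteMeasure_hermitianGaussian (hκ : 0 < κ) (n : ℕ) :
    IsFiniteMeasure (hermitianGaussian κ n) :=
  ⟨by rw [hermitianGaussian_univ_eq hκ]; exact ENNReal.ofReal_lt_top⟩

lemma exists_abs_le_of_hasCompactSupport {f : ℝ × ℝ → ℝ} (hfc : Continuous f)
    (hfs : HasCompactSupport f) : ∃ C, ∀ p, |f p| ≤ C := by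
  obtain ⟨C, hC⟩ := hfs.exists_bound_of_continuous hfc
  exact ⟨C, fun p => hC p⟩

lemma eigenvalueSum_nonneg {f : ℝ × ℝ → ℝ} (hf0 : ∀ p, 0 ≤ f p) (γ : ℝ) (x : HermitianCoords n) :
    0 ≤ eigenvalueSum γ f x := by
  unfold eigenvalueSum
  refine Multiset.sum_nonneg fun t ht => ?_
  obtain ⟨z, -, rfl⟩ := Multiset.mem_map.1 ht
  exact hf0 _

lemma continuous_eigenvalueSum_comp {X : Type*} [TopologicalSpace X] {f : ℝ × ℝ → ℝ} (hf :
    Continuous f)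
    {g : X → ℝ} {h : X → HermitianCoords n} (hg : Continuous g) (hh : Continuous h) :
    Continuous fun t => eigenvalueSum (g t) f (h t) := by
  have h2 : Continuous fun t => (g t, h t) := hg.prodMk hh
  have h1 : Continuous fun p : ℝ × HermitianCoords n => eigenvalueSum p.1 f p.2 :=
    continuous_eigenvalueSum hf
  simpa only [Function.comp_def] using h1.comp h2

lemma continuous_spectralProfile_comp {X : Type*} [TopologicalSpace X] {γ : ℝ} (hγ : 0 < γ) {g :
    X → ℂ}
    (hg : Continuous g) : Continuous fun t => spectralProfile κ n γ (g t) := by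
  have h2 : Continuous fun t => (γ, g t) := continuous_const.prodMk hg
  exact (continuousOn_spectralProfile κ n).comp_continuous h2 fun t => ⟨hγ, trivial⟩

lemma integrable_eigenvalueSum (hκ : 0 < κ) {f : ℝ × ℝ → ℝ} (hfc : Continuous f)
    (hfs : HasCompactSupport f) (γ : ℝ) :
    Integrable (fun x => eigenvalueSum γ f x) (hermitianGaussian κ n) := by
  have := isFiniteMeasure_hermitianGaussian hκ n
  obtain ⟨C, hC⟩ := exists_abs_le_of_hasCompactSupport hfc hfs
  have h1 : Continuous fun x : HermitianCoords n => eigenvalueSum γ f x :=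
    continuous_eigenvalueSum_comp hfc continuous_const continuous_id
  exact Integrable.of_bound h1.measurable.aestronglyMeasurable (n * C)
    (ae_of_all _ fun x => abs_eigenvalueSum_le hC γ x)

lemma continuous_integral_eigenvalueSum (hκ : 0 < κ) {f : ℝ × ℝ → ℝ} (hfc : Continuous f)
    (hfs : HasCompactSupport f) :
    Continuous fun γ => ∫ x, eigenvalueSum γ f x ∂(hermitianGaussian κ n) := by
  have := isFiniteMeasure_hermitianGaussian hκ n
  obtain ⟨C, hC⟩ := exists_abs_le_of_hasCompactSupport hfc hfs
  refine continuous_of_dominated (bound := fun _ => n * C)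
    (fun γ => (integrable_eigenvalueSum hκ hfc hfs γ).aestronglyMeasurable)
    (fun γ => ae_of_all _ fun x => abs_eigenvalueSum_le hC γ x) (integrable_const _)
    (ae_of_all _ fun x => ?_)
  exact continuous_eigenvalueSum_comp hfc continuous_id continuous_const

/-- The pullback of a function of two real variables to the complex plane. -/
def onComplex (f : ℝ × ℝ → ℝ) (z : ℂ) : ℝ := f (z.re, z.im)

lemma continuous_onComplex {f : ℝ × ℝ → ℝ} (hfc : Continuous f) : Continuous (onComplex f) :=
  hfc.comp (by fun_prop)

lemma exists_isCompact_onComplex {f : ℝ × ℝ → ℝ} (hfs : HasCompactSupport f) :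
    ∃ k : Set ℂ, IsCompact k ∧ ∀ z ∉ k, onComplex f z = 0 := by
  refine ⟨Complex.equivRealProdCLM.toHomeomorph ⁻¹' tsupport f,
    Complex.equivRealProdCLM.toHomeomorph.isCompact_preimage.2 hfs, fun z hz => ?_⟩
  exact image_eq_zero_of_notMem_tsupport (f := f) hz

lemma continuousOn_onComplex_mul_profile {f : ℝ × ℝ → ℝ} (hfc : Continuous f) :
    ContinuousOn (Function.uncurry fun (γ : ℝ) (z : ℂ) => onComplex f z * spectralProfile κ n γ z)
      (Set.Ioi 0 ×ˢ Set.univ) :=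
  (((continuous_onComplex hfc).comp continuous_snd).continuousOn).mul
    (continuousOn_spectralProfile κ n)

lemma integrable_onComplex_mul_profile {f : ℝ × ℝ → ℝ} (hfc : Continuous f)
    (hfs : HasCompactSupport f) {γ : ℝ} (hγ : 0 < γ) :
    Integrable fun z : ℂ => onComplex f z * spectralProfile κ n γ z := by
  obtain ⟨k, hk, hk0⟩ := exists_isCompact_onComplex hfs
  have hc : Continuous fun z : ℂ => onComplex f z * spectralProfile κ n γ z :=
    (continuous_onComplex hfc).mul (continuous_spectralProfile_comp hγ continuous_id)
  refine hc.integrable_of_hasCompactSupport (HasCompactSupport.intro hk fun z hz => ?_)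
  rw [hk0 z hz, zero_mul]

/-- The integrated formula holds over every measurable set of couplings, so the two sides agree for
almost every γ. Both are continuous on γ > 0, so they agree everywhere there. -/
lemma integral_eigenvalueSum_of_nonneg (hκ : 0 < κ) (hn : n ≠ 0) {f : ℝ × ℝ → ℝ}
    (hfc : Continuous f) (hfs : HasCompactSupport f) (hf0 : ∀ p, 0 ≤ f p)
    (hf : ∀ p : ℝ × ℝ, p.2 ≤ 0 → f p = 0) {γ : ℝ} (hγ : 0 < γ) :
    ∫ x, eigenvalueSum γ f x ∂(hermitianGaussian κ (n + 2)) =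
      ∫ z, onComplex f z * spectralProfile κ n γ z := by
  obtain ⟨k, hk, hk0⟩ := exists_isCompact_onComplex hfs
  have hA := (continuous_integral_eigenvalueSum (n := n + 2) hκ hfc hfs).continuousOn
    (s := Set.Ioi (0 : ℝ))
  have hB : ContinuousOn (fun γ => ∫ z, onComplex f z * spectralProfile κ n γ z) (Set.Ioi 0) :=
    continuousOn_integral_of_compact_support hk (continuousOn_onComplex_mul_profile hfc)
      fun γ z _ hz => by rw [hk0 z hz, zero_mul]
  refine Measure.eqOn_open_of_ae_eq (μ := volume) ?_ isOpen_Ioi hA hB hγ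
  have hm1 : Measurable fun γ : ℝ =>
      ∫⁻ y, ENNReal.ofReal (eigenvalueSum γ f y) ∂(hermitianGaussian κ (n + 2)) :=
    Measurable.lintegral_prod_right' (f := fun p : ℝ × HermitianCoords (n + 2) =>
      ENNReal.ofReal (eigenvalueSum p.1 f p.2))
      (measurable_eigenvalueSum hfc measurable_fst measurable_snd)
  have hm2 : Measurable fun γ : ℝ => ∫⁻ z in upperPlane,
        ENNReal.ofReal (f (z.re, z.im)) * ENNReal.ofReal (spectralProfile κ n γ z) := by
    refine Measurable.lintegral_prod_right' (f := fun p : ℝ × ℂ =>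
      ENNReal.ofReal (f (p.2.re, p.2.im)) * ENNReal.ofReal (spectralProfile κ n p.1 p.2)) ?_
    exact (ENNReal.measurable_ofReal.comp (hfc.measurable.comp (by fun_prop))).mul
      (measurable_spectralProfile κ n).ennreal_ofReal
  have hae := ae_eq_of_forall_setLIntegral_eq_of_sigmaFinite (μ := volume) hm1 hm2
    fun S hS _ => lintegral_eigenvalueSum_eq_profile hκ hn hfc hf0 hf hS
  refine (ae_restrict_iff' measurableSet_Ioi).2 (hae.mono fun t ht ht0 => ?_)
  have ht0 : 0 < t := ht0
  beta_reduce at ht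
  have hnn : ∀ z : ℂ, 0 ≤ onComplex f z * spectralProfile κ n t z := by
    intro z
    by_cases hz : z.im = 0
    · have : onComplex f z = 0 := hf _ hz.le
      rw [this, zero_mul]
    · exact mul_nonneg (hf0 _) (spectralProfile_nonneg hκ ht0 hz)
  rw [← ENNReal.ofReal_eq_ofReal_iff (integral_nonneg fun x => eigenvalueSum_nonneg hf0 t x)
    (integral_nonneg hnn), ofReal_integral_eq_lintegral_ofReal
      (integrable_eigenvalueSum hκ hfc hfs t) (ae_of_all _ fun x => eigenvalueSum_nonneg hf0 t x),
    ofReal_integral_eq_lintegral_ofReal (integrable_onComplex_mul_profile hfc hfs ht0)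
      (ae_of_all _ hnn), ht, ← lintegral_indicator isOpen_upperPlane.measurableSet]
  refine lintegral_congr fun z => ?_
  by_cases hz : z ∈ upperPlane
  · rw [Set.indicator_of_mem hz, ← ENNReal.ofReal_mul (hf0 _)]; rfl
  · have : onComplex f z = 0 := hf _ (not_lt.1 hz)
    rw [Set.indicator_of_notMem hz, this, zero_mul, ENNReal.ofReal_zero]

lemma eigenvalueSum_sub (f g : ℝ × ℝ → ℝ) (γ : ℝ) (x : HermitianCoords n) :
    eigenvalueSum γ (fun p => f p - g p) x = eigenvalueSum γ f x - eigenvalueSum γ g x := by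
  simp [eigenvalueSum]

/-- Split the test function into positive and negative parts; both remain continuous, compactly
supported, and zero on the closed lower half-plane. -/
lemma integral_eigenvalueSum (hκ : 0 < κ) (hn : n ≠ 0) {f : ℝ × ℝ → ℝ} (hfc : Continuous f)
    (hfs : HasCompactSupport f) (hf : ∀ p : ℝ × ℝ, p.2 ≤ 0 → f p = 0) {γ : ℝ} (hγ : 0 < γ) :
    ∫ x, eigenvalueSum γ f x ∂(hermitianGaussian κ (n + 2)) =
      ∫ z, onComplex f z * spectralProfile κ n γ z := by
  set f₁ : ℝ × ℝ → ℝ := fun p => max (f p) 0 with hf₁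
  set f₂ : ℝ × ℝ → ℝ := fun p => max (-f p) 0 with hf₂
  have hs₁ : HasCompactSupport f₁ := hfs.comp_left (g := fun t => max t 0) (by simp)
  have hs₂ : HasCompactSupport f₂ := hfs.comp_left (g := fun t => max (-t) 0) (by simp)
  have hc₁ : Continuous f₁ := by fun_prop
  have hc₂ : Continuous f₂ := by fun_prop
  have hsub : f = fun p => f₁ p - f₂ p := by
    ext p
    simp only [hf₁, hf₂]
    rcases le_total 0 (f p) with h | h
    · rw [max_eq_left h, max_eq_right (by linarith)]; ring
    · rw [max_eq_right h, max_eq_left (by linarith)]; ring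
  have i₁ := integral_eigenvalueSum_of_nonneg hκ hn hc₁ hs₁ (fun p => le_max_right _ _)
    (fun p hp => by simp [hf₁, hf p hp]) hγ
  have i₂ := integral_eigenvalueSum_of_nonneg hκ hn hc₂ hs₂ (fun p => le_max_right _ _)
    (fun p hp => by simp [hf₂, hf p hp]) hγ
  have e : ∀ z, onComplex f z * spectralProfile κ n γ z =
      onComplex f₁ z * spectralProfile κ n γ z - onComplex f₂ z * spectralProfile κ n γ z := by
    intro z
    rw [← sub_mul]
    congr 1
    exact congrFun hsub _
  simp only [e]
  rw [integral_sub (integrable_onComplex_mul_profile hc₁ hs₁ hγ)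
    (integrable_onComplex_mul_profile hc₂ hs₂ hγ), ← i₁, ← i₂,
    ← integral_sub (integrable_eigenvalueSum hκ hc₁ hs₁ γ) (integrable_eigenvalueSum hκ hc₂ hs₂ γ)]
  refine integral_congr_ae (ae_of_all _ fun x => ?_)
  beta_reduce
  rw [← eigenvalueSum_sub, ← hsub]

lemma gueWeight_eq (N : ℕ) (x : HermitianCoords N) :
    gueWeight N x = Real.exp (-((N : ℝ) / 2) * traceSq x) := by
  rw [gueWeight, trace_hermitianMatrix_sq, Complex.ofReal_re]

lemma gue_eq {N : ℕ} (hN : 0 < N) :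
    gue N = (ENNReal.ofReal (gaussianMass N N))⁻¹ • hermitianGaussian N N := by
  have hN' : (0 : ℝ) < N := by exact_mod_cast hN
  rw [gue, hermitianGaussian, ← hermitianGaussian_univ_eq hN', hermitianGaussian,
    withDensity_apply _ MeasurableSet.univ, Measure.restrict_univ]
  simp only [gueWeight_eq]

/-- The mean eigenvalue density of the deformed `(n + 2) × (n + 2)` GUE matrix. -/
def meanDensity (n : ℕ) (γ : ℝ) (p : ℝ × ℝ) : ℝ :=
  1 / ((n + 2 : ℕ) : ℝ) * ((gaussianMass (n + 2 : ℕ) (n + 2))⁻¹ *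
    spectralProfile (n + 2 : ℕ) n γ (Complex.mk p.1 p.2))

lemma continuous_meanDensity {γ : ℝ} (hγ : 0 < γ) : Continuous (meanDensity n γ) := by
  have h : Continuous fun p : ℝ × ℝ => Complex.mk p.1 p.2 :=
    Complex.equivRealProdCLM.symm.continuous
  exact continuous_const.mul (continuous_const.mul (continuous_spectralProfile_comp hγ h))

lemma isMeanEigenvalueDensity_meanDensity (hn : n ≠ 0) {γ : ℝ} (hγ : 0 < γ) :
    IsMeanEigenvalueDensity (n + 2) γ (meanDensity n γ) := by
  refine ⟨(continuous_meanDensity hγ).continuousOn, fun f hfc hfs hft => ?_⟩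
  have hκ : (0 : ℝ) < ((n + 2 : ℕ) : ℝ) := by positivity
  have hf : ∀ p : ℝ × ℝ, p.2 ≤ 0 → f p = 0 := fun p hp =>
    image_eq_zero_of_notMem_tsupport fun h => not_lt.2 hp (hft h)
  have hZ := gaussianMass_pos hκ (n + 2)
  rw [gue_eq (by omega), integral_smul_measure, integral_const_mul,
    integral_eigenvalueSum hκ hn hfc hfs hf hγ, ENNReal.toReal_inv, ENNReal.toReal_ofReal hZ.le]
  have e := Complex.volume_preserving_equiv_real_prod.integral_comp
    Complex.measurableEquivRealProd.measurableEmbedding (fun p : ℝ × ℝ =>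
      f p * spectralProfile (n + 2 : ℕ) n γ (Complex.mk p.1 p.2))
  simp only [Complex.measurableEquivRealProd_apply, Complex.eta] at e
  unfold onComplex
  rw [e, smul_eq_mul, ← integral_const_mul, ← integral_const_mul]
  refine integral_congr_ae (ae_of_all _ fun p => ?_)
  simp only [meanDensity]
  ring

end RankOneGUE
end

/-! ### A recursion for the terms of Mehler's series -/

noncomputable section
namespace RankOneGUE

/-- The fourth order recursion satisfied by the terms of Mehler's series. -/
def MehlerRecursion (A B : ℂ) (a : ℕ → ℂ) : Prop :=
  a 1 = A * a 0 ∧ 2 * a 2 = a 0 + A * a 1 - B * a 0 ∧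
    3 * a 3 = 3 * a 1 + A * (a 2 + a 0) - B * a 1 ∧
    ∀ k : ℕ, (k + 4) * a (k + 4) = 2 * (k + 2) * a (k + 2) - k * a k + a (k + 2) - a k
      + A * (a (k + 3) + a (k + 1)) - B * a (k + 2)

lemma MehlerRecursion.unique {A B : ℂ} {a b : ℕ → ℂ} (ha : MehlerRecursion A B a)
    (hb : MehlerRecursion A B b) (h0 : a 0 = b 0) (k : ℕ) : a k = b k := by
  have h1 : a 1 = b 1 := by rw [ha.1, hb.1, h0]
  have h2 : a 2 = b 2 := by
    have h := ha.2.1; rw [h0, h1, ← hb.2.1] at h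
    exact mul_left_cancel₀ two_ne_zero h
  have h3 : a 3 = b 3 := by
    have h := ha.2.2.1; rw [h0, h1, h2, ← hb.2.2.1] at h
    exact mul_left_cancel₀ three_ne_zero h
  induction k using Nat.strong_induction_on with
  | _ k ih =>
    match k, ih with
    | 0, _ => exact h0
    | 1, _ => exact h1
    | 2, _ => exact h2
    | 3, _ => exact h3
    | k + 4, ih =>
      have h := ha.2.2.2 k
      rw [ih k (by omega), ih (k + 1) (by omega), ih (k + 2) (by omega), ih (k + 3) (by omega),
        ← hb.2.2.2 k] at h
      refine mul_left_cancel₀ ?_ h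
      exact_mod_cast (by omega : k + 4 ≠ 0)

/-- Both polynomial sequences obey three-term recurrences, so the terms of index k to k + 4 reduce
to bilinear expressions in the polynomials of index k and k + 1. The recursion is a linear relation
among these expressions. -/
lemma mehlerRecursion_hermiteTerm {κ : ℝ} (hκ : κ ≠ 0) (z w : ℂ) :
    MehlerRecursion (κ * (z * w)) (κ * (z ^ 2 + w ^ 2)) (hermiteTerm κ z w) := by
  have hk : (κ : ℂ) ≠ 0 := by exact_mod_cast hκ
  refine ⟨?_, ?_, ?_, fun k => ?_⟩
  · simp [hermiteTerm, monicHermite]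
  · simp [hermiteTerm, monicHermite]
    field_simp
    ring
  · simp [hermiteTerm, monicHermite, Nat.factorial]
    field_simp
    ring
  · have hf : (k.factorial : ℂ) ≠ 0 := by exact_mod_cast k.factorial_ne_zero
    have f1 : ((k : ℂ) + 1) ≠ 0 := by exact_mod_cast k.succ_ne_zero
    have f2 : ((k : ℂ) + 2) ≠ 0 := by exact_mod_cast (by omega : k + 2 ≠ 0)
    have f3 : ((k : ℂ) + 3) ≠ 0 := by exact_mod_cast (by omega : k + 3 ≠ 0)
    have f4 : ((k : ℂ) + 4) ≠ 0 := by exact_mod_cast (by omega : k + 4 ≠ 0)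
    have e1 : ((k + 1).factorial : ℂ) = (k + 1) * k.factorial := by
      rw [Nat.factorial_succ]; push_cast; ring
    have e2 : ((k + 2).factorial : ℂ) = (k + 2) * ((k + 1) * k.factorial) := by
      rw [Nat.factorial_succ, Nat.cast_mul, e1]; push_cast; ring
    have e3 : ((k + 3).factorial : ℂ) = (k + 3) * ((k + 2) * ((k + 1) * k.factorial)) := by
      rw [Nat.factorial_succ, Nat.cast_mul, e2]; push_cast; ring
    have e4 : ((k + 4).factorial : ℂ) = (k + 4) * ((k + 3) * ((k + 2) * ((k + 1) * k.factorial)))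
        := by
      rw [Nat.factorial_succ, Nat.cast_mul, e3]; push_cast; ring
    have g2 : ∀ u, monicHermite κ u (k + 2) =
      u * monicHermite κ u (k + 1) - (k + 1) / κ * monicHermite κ u k := fun u => rfl
    have g3 : ∀ u, monicHermite κ u (k + 3) =
      u * monicHermite κ u (k + 2) - (k + 2) / κ * monicHermite κ u (k + 1) := fun u => by
        rw [monicHermite_succ_succ]; push_cast; ring
    have g4 : ∀ u, monicHermite κ u (k + 4) =
      u * monicHermite κ u (k + 3) - (k + 3) / κ * monicHermite κ u (k + 2) := fun u => by
        rw [monicHermite_succ_succ]; push_cast; ring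
    simp only [hermiteTerm, e1, e2, e3, e4, g4, g3, g2]
    generalize monicHermite κ z k = a
    generalize monicHermite κ w k = b
    generalize monicHermite κ z (k + 1) = c
    generalize monicHermite κ w (k + 1) = d
    field_simp
    ring

end RankOneGUE
end

/-! ### Taylor coefficients and Mehler's formula -/

noncomputable section
namespace RankOneGUE

section TaylorCoeff
open Metric

variable {r : ℝ} {F G : ℂ → ℂ}

/-- The `n`-th Taylor coefficient at `0` as a contour integral over `|z| = r`. -/
def taylorCoeff (r : ℝ) (n : ℕ) (F : ℂ → ℂ) : ℂ :=
  (2 * Real.pi * Complex.I)⁻¹ * ∮ z in C(0, r), F z / z ^ (n + 1)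

lemma ne_zero_of_mem_sphere (hr : 0 < r) {z : ℂ} (hz : z ∈ sphere (0 : ℂ) r) : z ≠ 0 := by
  rintro rfl
  simp at hz
  exact hr.ne hz

lemma circleIntegrable_taylorCoeff (hr : 0 < r) (hr1 : r < 1) (hF : DifferentiableOn ℂ F (ball 0 1))
    (n : ℕ) : CircleIntegrable (fun z => F z / z ^ (n + 1)) 0 r := by
  refine ContinuousOn.circleIntegrable hr.le (ContinuousOn.div ?_ (by fun_prop) fun z hz =>
    pow_ne_zero _ (ne_zero_of_mem_sphere hr hz))
  exact hF.continuousOn.mono (sphere_subset_closedBall.trans (closedBall_subset_ball hr1))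

lemma taylorCoeff_add (hr : 0 < r) (hr1 : r < 1) (hF : DifferentiableOn ℂ F (ball 0 1))
    (hG : DifferentiableOn ℂ G (ball 0 1)) (n : ℕ) :
    taylorCoeff r n (fun z => F z + G z) = taylorCoeff r n F + taylorCoeff r n G := by
  rw [taylorCoeff, taylorCoeff, taylorCoeff, ← mul_add, ← circleIntegral.integral_add
    (circleIntegrable_taylorCoeff hr hr1 hF n) (circleIntegrable_taylorCoeff hr hr1 hG n)]
  simp only [add_div]

lemma taylorCoeff_const_mul (a : ℂ) (F : ℂ → ℂ) (n : ℕ) :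
    taylorCoeff r n (fun z => a * F z) = a * taylorCoeff r n F := by
  simp only [taylorCoeff, mul_div_assoc, circleIntegral.integral_const_mul]
  ring

lemma taylorCoeff_congr (hr : 0 < r) (hr1 : r < 1) (h : Set.EqOn F G (ball 0 1)) (n : ℕ) :
    taylorCoeff r n F = taylorCoeff r n G := by
  rw [taylorCoeff, taylorCoeff]
  congr 1
  refine circleIntegral.integral_congr hr.le fun z hz => ?_
  rw [h (closedBall_subset_ball hr1 (sphere_subset_closedBall hz))]

lemma taylorCoeff_succ_mul (hr : 0 < r) (F : ℂ → ℂ) (n : ℕ) :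
    taylorCoeff r (n + 1) (fun z => z * F z) = taylorCoeff r n F := by
  rw [taylorCoeff, taylorCoeff]
  congr 1
  refine circleIntegral.integral_congr hr.le fun z hz => ?_
  have := ne_zero_of_mem_sphere hr hz
  rw [pow_succ z (n + 1)]
  field_simp

lemma taylorCoeff_zero_mul (hr : 0 < r) (hr1 : r < 1) (hF : DifferentiableOn ℂ F (ball 0 1)) :
    taylorCoeff r 0 (fun z => z * F z) = 0 := by
  have h : ∮ z in C(0, r), z * F z / z ^ (0 + 1) = ∮ z in C(0, r), F z := by
    refine circleIntegral.integral_congr hr.le fun z hz => ?_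
    have := ne_zero_of_mem_sphere hr hz
    rw [zero_add, pow_one, mul_div_cancel_left₀ _ this]
  rw [taylorCoeff, h, Complex.circleIntegral_eq_zero_of_differentiable_on_off_countable hr.le
    Set.countable_empty (hF.continuousOn.mono (closedBall_subset_ball hr1))
    (fun z hz => hF.differentiableAt (isOpen_ball.mem_nhds (ball_subset_ball hr1.le hz.1))),
    mul_zero]

lemma taylorCoeff_zero (hr : 0 < r) (hr1 : r < 1) (hF : DifferentiableOn ℂ F (ball 0 1)) :
    taylorCoeff r 0 F = F 0 := by
  have h := (hF.mono (closedBall_subset_ball hr1)).circleIntegral_sub_inv_smul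
    (w := 0) (mem_ball_self hr)
  have h' : ∮ z in C(0, r), F z / z ^ (0 + 1) = ∮ z in C(0, r), (z - 0)⁻¹ • F z := by
    refine circleIntegral.integral_congr hr.le fun z hz => ?_
    simp [div_eq_inv_mul]
  rw [taylorCoeff, h', h, smul_eq_mul, ← mul_assoc, inv_mul_cancel₀, one_mul]
  simp [Real.pi_ne_zero]

/-- The derivative of F/zⁿ⁺¹ is single-valued with a primitive on the circle, so its contour
integral vanishes. -/
lemma taylorCoeff_deriv (hr : 0 < r) (hr1 : r < 1) (hF : DifferentiableOn ℂ F (ball 0 1)) (n : ℕ) :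
    taylorCoeff r n (deriv F) = (n + 1) * taylorCoeff r (n + 1) F := by
  have h1 : ∮ z in C(0, r), (deriv F z / z ^ (n + 1) - (n + 1) * (F z / z ^ (n + 1 + 1))) = 0 := by
    refine circleIntegral.integral_eq_zero_of_hasDerivWithinAt
      (f := fun z => F z / z ^ (n + 1)) hr.le fun z hz => ?_
    have hz0 := ne_zero_of_mem_sphere hr hz
    have hd : HasDerivAt F (deriv F z) z := (hF.differentiableAt (isOpen_ball.mem_nhds
      (closedBall_subset_ball hr1 (sphere_subset_closedBall hz)))).hasDerivAt
    have := (hd.div (hasDerivAt_pow (n + 1) z) (pow_ne_zero _ hz0)).hasDerivWithinAt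
      (s := sphere (0 : ℂ) r)
    refine this.congr_deriv ?_
    rw [Nat.add_sub_cancel]
    push_cast
    field_simp
    ring
  have h2 : CircleIntegrable (fun z => ((n : ℂ) + 1) * (F z / z ^ (n + 1 + 1))) 0 r :=
    (circleIntegrable_taylorCoeff hr hr1 hF (n + 1)).const_smul (a := (n + 1 : ℂ))
  rw [circleIntegral.integral_sub (circleIntegrable_taylorCoeff hr hr1 (hF.deriv isOpen_ball) n) h2,
    circleIntegral.integral_const_mul, sub_eq_zero] at h1
  rw [taylorCoeff, taylorCoeff, h1]
  ring

lemma one_sub_ne_zero_of_mem_ball {t : ℂ} (ht : t ∈ ball (0 : ℂ) 1) : 1 - t ≠ 0 := by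
  intro h
  have : t = 1 := by linear_combination -h
  simp [this] at ht

lemma one_add_ne_zero_of_mem_ball {t : ℂ} (ht : t ∈ ball (0 : ℂ) 1) : 1 + t ≠ 0 := by
  intro h
  have : t = -1 := by linear_combination h
  simp [this] at ht

lemma differentiableOn_div_one_sub (hF : DifferentiableOn ℂ F (ball 0 1)) :
    DifferentiableOn ℂ (fun t => F t / (1 - t)) (ball 0 1) :=
  hF.div (by fun_prop) fun _ ht => one_sub_ne_zero_of_mem_ball ht

/-- Dividing by 1 - t is multiplication by the geometric series, so coefficients become partial
sums; the induction uses G = F + tG. -/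
lemma taylorCoeff_div_one_sub (hr : 0 < r) (hr1 : r < 1) (hF : DifferentiableOn ℂ F (ball 0 1))
    (n : ℕ) :
    taylorCoeff r n (fun t => F t / (1 - t)) = ∑ k ∈ Finset.range (n + 1), taylorCoeff r k F := by
  have hG := differentiableOn_div_one_sub hF
  have hG' : DifferentiableOn ℂ (fun t => t * (F t / (1 - t))) (ball 0 1) :=
    differentiableOn_id.mul hG
  have key : ∀ k, taylorCoeff r k (fun t => F t / (1 - t)) =
      taylorCoeff r k F + taylorCoeff r k (fun t => t * (F t / (1 - t))) := fun k => by
    rw [← taylorCoeff_add hr hr1 hF hG']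
    refine taylorCoeff_congr hr hr1 (fun t ht => ?_) k
    have := one_sub_ne_zero_of_mem_ball ht
    field_simp
    ring
  induction n with
  | zero => rw [key, taylorCoeff_zero_mul hr hr1 hG]; simp
  | succ n ih => rw [key, taylorCoeff_succ_mul hr, ih, Finset.sum_range_succ _ (n + 1)]; ring

end TaylorCoeff

section Mehler
open Metric

variable {κ x y r : ℝ}

/-- The generating function of Mehler's formula at `z = x + i y`, `w = x - i y`. -/
def mehler (κ x y : ℝ) (t : ℂ) : ℂ :=
  Complex.exp (-(1 / 2) * Complex.log (1 - t ^ 2) + κ * (t * x ^ 2 / (1 + t)) +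
    κ * (t * y ^ 2 / (1 - t)))

lemma one_sub_sq_mem_slitPlane {t : ℂ} (ht : t ∈ ball (0 : ℂ) 1)
    : 1 - t ^ 2 ∈ Complex.slitPlane := by
  refine Complex.mem_slitPlane_of_norm_lt_one (z := -t ^ 2) ?_ |> fun h => by
    simpa [sub_eq_add_neg] using h
  rw [norm_neg, norm_pow]
  have : ‖t‖ < 1 := by simpa using ht
  exact pow_lt_one₀ (norm_nonneg t) this two_ne_zero

/-- The logarithmic derivative of Mehler's generating function. -/
def mehlerLogDeriv (κ x y : ℝ) (t : ℂ) : ℂ :=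
  t / (1 - t ^ 2) + κ * (x ^ 2 / (1 + t) ^ 2 + y ^ 2 / (1 - t) ^ 2)

lemma hasDerivAt_mehler {t : ℂ} (ht : t ∈ ball (0 : ℂ) 1) :
    HasDerivAt (mehler κ x y) (mehler κ x y t * mehlerLogDeriv κ x y t) t := by
  have h1 := one_sub_ne_zero_of_mem_ball ht
  have h2 := one_add_ne_zero_of_mem_ball ht
  have h3 : (1 - t ^ 2) ≠ 0 := by
    rw [show 1 - t ^ 2 = (1 - t) * (1 + t) by ring]; exact mul_ne_zero h1 h2
  have d1 : HasDerivAt (fun t : ℂ => -(1 / 2) * Complex.log (1 - t ^ 2)) (t / (1 - t ^ 2)) t := by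
    have := (((hasDerivAt_pow 2 t).const_sub 1).clog (one_sub_sq_mem_slitPlane ht)).const_mul
      (-(1 / 2) : ℂ)
    refine this.congr_deriv ?_
    field_simp
    simp
  have d2 : HasDerivAt (fun t : ℂ => (κ : ℂ) * (t * x ^ 2 / (1 + t))) (κ * (x ^ 2 / (1 + t) ^ 2))
      t := by
    have := ((((hasDerivAt_id t).mul_const ((x : ℂ) ^ 2)).div ((hasDerivAt_id t).const_add 1)
      h2)).const_mul (κ : ℂ)
    refine this.congr_deriv ?_
    simp only [id]
    field_simp
    ring
  have d3 : HasDerivAt (fun t : ℂ => (κ : ℂ) * (t * y ^ 2 / (1 - t))) (κ * (y ^ 2 / (1 - t) ^ 2))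
      t := by
    have := ((((hasDerivAt_id t).mul_const ((y : ℂ) ^ 2)).div ((hasDerivAt_id t).const_sub 1)
      h1)).const_mul (κ : ℂ)
    refine this.congr_deriv ?_
    simp only [id]
    field_simp
    ring
  have := ((d1.add d2).add d3).cexp
  refine this.congr_deriv ?_
  rw [mehlerLogDeriv, mehler]
  simp only [Pi.add_apply]
  ring

lemma differentiableOn_mehler : DifferentiableOn ℂ (mehler κ x y) (ball 0 1) := fun _ ht =>
  (hasDerivAt_mehler ht).differentiableAt.differentiableWithinAt

/-- Clearing denominators in the logarithmic derivative gives (1 - t²)²M' = (t(1 - t²) + A(1 + t²) -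
Bt)M. The recursion is this equation read coefficient by coefficient. -/
lemma mehlerRecursion_taylorCoeff (hr : 0 < r) (hr1 : r < 1) :
    MehlerRecursion (κ * (x ^ 2 + y ^ 2)) (κ * (2 * (x ^ 2 - y ^ 2)))
      (fun k => taylorCoeff r k (mehler κ x y)) := by
  set M := mehler κ x y with hM
  have hMd : DifferentiableOn ℂ M (ball 0 1) := differentiableOn_mehler
  have hDd : DifferentiableOn ℂ (deriv M) (ball 0 1) := hMd.deriv isOpen_ball
  have hmul : ∀ {F : ℂ → ℂ}, DifferentiableOn ℂ F (ball 0 1) →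
      DifferentiableOn ℂ (fun t => t * F t) (ball 0 1) := fun hF => differentiableOn_id.mul hF
  set A : ℂ := κ * (x ^ 2 + y ^ 2) with hA
  set B : ℂ := κ * (2 * (x ^ 2 - y ^ 2)) with hB
  have hN1 := hmul hMd
  have hN2 := hmul hN1
  have hN3 := hmul hN2
  have hD1 := hmul hDd
  have hD2 := hmul hD1
  have hD3 := hmul hD2
  have hD4 := hmul hD3
  have ode : ∀ k, taylorCoeff r k (deriv M) =
      2 * taylorCoeff r k (fun t => t * (t * deriv M t)) +
      (-1) * taylorCoeff r k (fun t => t * (t * (t * (t * deriv M t)))) +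
      (1 - B) * taylorCoeff r k (fun t => t * M t) +
      (-1) * taylorCoeff r k (fun t => t * (t * (t * M t))) +
      A * taylorCoeff r k M + A * taylorCoeff r k (fun t => t * (t * M t)) := by
    intro k
    simp only [← taylorCoeff_const_mul]
    rw [← taylorCoeff_add hr hr1 (hD2.const_mul 2) (hD4.const_mul (-1)),
      ← taylorCoeff_add hr hr1 _ (hN1.const_mul (1 - B)),
      ← taylorCoeff_add hr hr1 _ (hN3.const_mul (-1)),
      ← taylorCoeff_add hr hr1 _ (hMd.const_mul A),
      ← taylorCoeff_add hr hr1 _ (hN2.const_mul A)]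
    · refine taylorCoeff_congr hr hr1 (fun t ht => ?_) k
      have h1 := one_sub_ne_zero_of_mem_ball ht
      have h2 := one_add_ne_zero_of_mem_ball ht
      have h3 : (1 - t ^ 2) = (1 - t) * (1 + t) := by ring
      rw [(hasDerivAt_mehler ht).deriv, ← hM, mehlerLogDeriv, h3, hA, hB]
      field_simp
      ring
    · exact ((((hD2.const_mul 2).add (hD4.const_mul (-1))).add (hN1.const_mul _)).add
        (hN3.const_mul _)).add (hMd.const_mul _)
    · exact (((hD2.const_mul 2).add (hD4.const_mul (-1))).add (hN1.const_mul _)).add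
        (hN3.const_mul _)
    · exact ((hD2.const_mul 2).add (hD4.const_mul (-1))).add (hN1.const_mul _)
    · exact (hD2.const_mul 2).add (hD4.const_mul (-1))
  have hdc : ∀ k, taylorCoeff r k (deriv M) = (k + 1) * taylorCoeff r (k + 1) M :=
    taylorCoeff_deriv hr hr1 hMd
  refine ⟨?_, ?_, ?_, fun k => ?_⟩
  · have h := ode 0
    rw [hdc, taylorCoeff_zero_mul hr hr1 hD1, taylorCoeff_zero_mul hr hr1 hD3,
      taylorCoeff_zero_mul hr hr1 hMd, taylorCoeff_zero_mul hr hr1 hN2,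
      taylorCoeff_zero_mul hr hr1 hN1] at h
    push_cast at h
    linear_combination h
  · have h := ode 1
    simp only [hdc, taylorCoeff_succ_mul hr, taylorCoeff_zero_mul hr hr1 hDd,
      taylorCoeff_zero_mul hr hr1 hD2, taylorCoeff_zero_mul hr hr1 hN1,
      taylorCoeff_zero_mul hr hr1 hMd] at h
    push_cast at h
    linear_combination h
  · have h := ode 2
    simp only [hdc, taylorCoeff_succ_mul hr, taylorCoeff_zero_mul hr hr1 hD1,
      taylorCoeff_zero_mul hr hr1 hMd] at h
    push_cast at h
    linear_combination h
  · have h := ode (k + 3)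
    simp only [taylorCoeff_succ_mul hr] at h
    rw [hdc, hdc] at h
    -- The term t⁴M' contributes the coefficient of M' of index k - 1, which is absent when k = 0.
    cases k with
    | zero =>
      rw [taylorCoeff_zero_mul hr hr1 hDd] at h
      push_cast at h ⊢
      linear_combination h
    | succ k =>
      rw [taylorCoeff_succ_mul hr, hdc] at h
      push_cast at h ⊢
      linear_combination h

/-- Mehler's formula for the coefficients. -/
lemma hermiteTerm_eq_taylorCoeff (hκ : κ ≠ 0) (hr : 0 < r) (hr1 : r < 1) (k : ℕ) :
    hermiteTerm κ (Complex.mk x y) (star (Complex.mk x y)) k = taylorCoeff r k (mehler κ x y) := by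
  have hz : (Complex.mk x y) = x + y * Complex.I := (Complex.re_add_im (Complex.mk x y)).symm
  have hw : star (Complex.mk x y) = x - y * Complex.I := by
    rw [hz]; simp [sub_eq_add_neg]
  have h := mehlerRecursion_hermiteTerm hκ (Complex.mk x y) (star (Complex.mk x y))
  rw [show (κ : ℂ) * (Complex.mk x y * star (Complex.mk x y)) = κ * (x ^ 2 + y ^ 2) by
      rw [hw, hz]; linear_combination (-κ * y ^ 2 : ℂ) * Complex.I_sq,
    show (κ : ℂ) * (Complex.mk x y ^ 2 + star (Complex.mk x y) ^ 2) = κ * (2 * (x ^ 2 - y ^ 2)) by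
      rw [hw, hz]; linear_combination (2 * κ * y ^ 2 : ℂ) * Complex.I_sq] at h
  refine h.unique (mehlerRecursion_taylorCoeff hr hr1) ?_ k
  rw [taylorCoeff_zero hr hr1 differentiableOn_mehler]
  simp [hermiteTerm, monicHermite, mehler]

/-- The amplitude in the contour integral for the deformed moment. -/
def contourAmplitude (κ c x y : ℝ) (t : ℂ) : ℂ :=
  1 / κ * (1 / (1 - t) + t / (1 - t ^ 2)) + x ^ 2 / (1 + t) ^ 2 + (y / (1 - t) - c) ^ 2

lemma hermiteKernel_eq_taylorCoeff (hκ : κ ≠ 0) (hr : 0 < r) (hr1 : r < 1) (n : ℕ) :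
    hermiteKernel κ (Complex.mk x y) (star (Complex.mk x y)) n =
      taylorCoeff r n (fun t => mehler κ x y t / (1 - t)) := by
  rw [taylorCoeff_div_one_sub hr hr1 differentiableOn_mehler, hermiteKernel]
  exact Finset.sum_congr rfl fun k _ => hermiteTerm_eq_taylorCoeff hκ hr hr1 k

/-- With Φ = M/(1 - t), the factor n + 1 is a derivative of Φ and the sum of kernels is a further
division by 1 - t. The term y²/(1-t)² from the logarithmic derivative combines with c² and
-2cy/(1-t) into the square in `contourAmplitude`. -/
lemma deformedMoment_eq_taylorCoeff (hκ : κ ≠ 0) (hr : 0 < r) (hr1 : r < 1) (n : ℕ) (c : ℝ) :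
    deformedMoment κ n c (Complex.mk x y) = n.factorial / (κ : ℂ) ^ n *
      taylorCoeff r n (fun t => mehler κ x y t / (1 - t) * contourAmplitude κ c x y t) := by
  have hk : (κ : ℂ) ≠ 0 := by exact_mod_cast hκ
  set Φ : ℂ → ℂ := fun t => mehler κ x y t / (1 - t) with hΦ
  have hΦd : DifferentiableOn ℂ Φ (ball 0 1) := differentiableOn_div_one_sub differentiableOn_mehler
  rw [deformedMoment]
  congr 1
  have h1 : ((n : ℂ) + 1) / κ * hermiteKernel κ (Complex.mk x y) (star (Complex.mk x y)) (n + 1) =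
      taylorCoeff r n (fun t => 1 / κ * deriv Φ t) := by
    rw [taylorCoeff_const_mul, taylorCoeff_deriv hr hr1 hΦd, hermiteKernel_eq_taylorCoeff hκ hr hr1]
    ring
  have h2 : (c : ℂ) ^ 2 * hermiteKernel κ (Complex.mk x y) (star (Complex.mk x y)) n =
      taylorCoeff r n (fun t => c ^ 2 * Φ t) := by
    rw [taylorCoeff_const_mul, hermiteKernel_eq_taylorCoeff hκ hr hr1]
  have h3 : -(2 * (c : ℂ) * y) *
      ∑ k ∈ Finset.range (n + 1), hermiteKernel κ (Complex.mk x y) (star (Complex.mk x y)) k =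
      taylorCoeff r n (fun t => -(2 * c * y) * (Φ t / (1 - t))) := by
    rw [taylorCoeff_const_mul, taylorCoeff_div_one_sub hr hr1 hΦd]
    congr 1
    exact Finset.sum_congr rfl fun k _ => hermiteKernel_eq_taylorCoeff hκ hr hr1 k
  have h4 : DifferentiableOn ℂ (fun t => 1 / κ * deriv Φ t + c ^ 2 * Φ t) (ball 0 1) :=
    ((hΦd.deriv isOpen_ball).const_mul _).add (hΦd.const_mul _)
  rw [h1, h2, sub_eq_add_neg, ← neg_mul, h3,
    ← taylorCoeff_add hr hr1 ((hΦd.deriv isOpen_ball).const_mul _) (hΦd.const_mul _),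
    ← taylorCoeff_add hr hr1 h4 ((differentiableOn_div_one_sub hΦd).const_mul _)]
  refine taylorCoeff_congr hr hr1 (fun t ht => ?_) n
  have e1 := one_sub_ne_zero_of_mem_ball ht
  have e2 := one_add_ne_zero_of_mem_ball ht
  have e3 : (1 - t ^ 2) = (1 - t) * (1 + t) := by ring
  have hd := (hasDerivAt_mehler (κ := κ) (x := x) (y := y) ht).div
    ((hasDerivAt_id t).const_sub 1) e1
  have hd' : deriv Φ t = _ := hd.deriv
  rw [hd', hΦ, contourAmplitude, mehlerLogDeriv, e3]
  simp only [id]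
  generalize mehler κ x y t = M
  field_simp
  ring

end Mehler

end RankOneGUE
end

/-! ### The mean density as a contour integral -/

noncomputable section
namespace RankOneGUE

/-- The radius exp(-y) puts the circle through ζ = y, where t = exp(-ζ); this is the leading-order
saddle of N(y²/ζ + ζ). Periodicity centres the angle so that the saddle sits at φ = 0. -/
lemma taylorCoeff_eq_integral (y : ℝ) (n : ℕ) (F : ℂ → ℂ) :
    taylorCoeff (Real.exp (-y)) n F = (2 * Real.pi : ℂ)⁻¹ * ∫ φ in (-Real.pi)..Real.pi,
      F (Complex.exp (-(y - φ * Complex.I))) * Complex.exp (n * (y - φ * Complex.I)) := by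
  have hw : ∀ φ : ℝ, circleMap 0 (Real.exp (-y)) φ = Complex.exp (-(y - φ * Complex.I)) := by
    intro φ
    rw [circleMap, zero_add, Complex.ofReal_exp, ← Complex.exp_add]
    congr 1
    push_cast
    ring
  have hintegral : ∀ φ : ℝ, deriv (circleMap 0 (Real.exp (-y))) φ •
      (F (circleMap 0 (Real.exp (-y)) φ) / circleMap 0 (Real.exp (-y)) φ ^ (n + 1)) =
      Complex.I * (F (Complex.exp (-(y - φ * Complex.I))) *
        Complex.exp (n * (y - φ * Complex.I))) := by
    intro φ
    rw [deriv_circleMap, hw, smul_eq_mul,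
      show Complex.exp (n * (y - φ * Complex.I)) =
        (Complex.exp (-(y - φ * Complex.I)) ^ n)⁻¹ by
        rw [← Complex.exp_nat_mul, ← Complex.exp_neg]; congr 1; ring]
    have := Complex.exp_ne_zero (-(y - φ * Complex.I))
    rw [pow_succ]
    field_simp
  have hper : Function.Periodic (fun φ : ℝ => F (Complex.exp (-(y - φ * Complex.I))) *
      Complex.exp (n * (y - φ * Complex.I))) (2 * Real.pi) := by
    intro φ
    have e1 : Complex.exp (-(y - ((φ + 2 * Real.pi : ℝ) : ℂ) * Complex.I)) =
        Complex.exp (-(y - φ * Complex.I)) := by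
      rw [show -((y : ℂ) - ((φ + 2 * Real.pi : ℝ) : ℂ) * Complex.I) =
        -(y - φ * Complex.I) + 2 * Real.pi * Complex.I by push_cast; ring, Complex.exp_add,
        Complex.exp_two_pi_mul_I, mul_one]
    have e2 : Complex.exp (n * (y - ((φ + 2 * Real.pi : ℝ) : ℂ) * Complex.I)) =
        Complex.exp (n * (y - φ * Complex.I)) := by
      rw [show (n : ℂ) * (y - ((φ + 2 * Real.pi : ℝ) : ℂ) * Complex.I) =
        n * (y - φ * Complex.I) - n * (2 * Real.pi * Complex.I) by push_cast; ring,
        Complex.exp_sub, Complex.exp_nat_mul_two_pi_mul_I, div_one]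
    beta_reduce
    rw [e1, e2]
  have hsh := hper.intervalIntegral_add_eq 0 (-Real.pi)
  rw [zero_add, show -Real.pi + 2 * Real.pi = Real.pi by ring] at hsh
  rw [taylorCoeff, circleIntegral]
  simp only [hintegral]
  rw [intervalIntegral.integral_const_mul, hsh]
  have : (Real.pi : ℂ) ≠ 0 := by exact_mod_cast Real.pi_ne_zero
  have := Complex.I_ne_zero
  generalize ∫ φ in (-Real.pi)..Real.pi, F (Complex.exp (-(y - φ * Complex.I))) *
    Complex.exp (n * (y - φ * Complex.I)) = J
  field_simp

/-- The mean density above the real axis as a contour integral. -/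
lemma meanDensity_eq (n : ℕ) {γ x y : ℝ} (hy : 0 < y) (hγ : y < γ) :
    meanDensity n γ (x, y) = √(((n + 2 : ℕ) : ℝ) / (2 * Real.pi)) * ((γ - y) ^ n / γ ^ (n + 1)) *
      Real.exp (-((n + 2 : ℕ) : ℝ) * (y * (γ - y)) - ((n + 2 : ℕ) : ℝ) / 2 * x ^ 2) *
      (taylorCoeff (Real.exp (-y)) n (fun t => mehler ((n + 2 : ℕ) : ℝ) x y t / (1 - t) *
        contourAmplitude ((n + 2 : ℕ) : ℝ) (γ - y) x y t)).re := by
  set κ : ℝ := ((n + 2 : ℕ) : ℝ) with hκdef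
  have hκ : 0 < κ := by rw [hκdef]; positivity
  have hfac : ((n.factorial : ℂ) / (κ : ℂ) ^ n) = ((n.factorial / κ ^ n : ℝ) : ℂ)
      := by push_cast; rfl
  rw [meanDensity, spectralProfile]
  dsimp only
  rw [← hκdef, deformedMoment_eq_taylorCoeff (r := Real.exp (-y)) hκ.ne' (Real.exp_pos _)
    (by rw [Real.exp_lt_one_iff]; linarith), hfac, Complex.re_ofReal_mul]
  rw [max_eq_left (by linarith), gaussianMass_succ hκ (n + 1)]
  generalize (taylorCoeff _ _ _).re = T
  have hs : √(κ / (2 * Real.pi)) = (√(2 * Real.pi / κ))⁻¹ := by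
    rw [← Real.sqrt_inv, inv_div]
  have hs0 : √(2 * Real.pi / κ) ≠ 0 := by positivity
  have hm := gaussianMass_pos hκ (n + 1)
  have hf : (n.factorial : ℝ) ≠ 0 := by exact_mod_cast n.factorial_ne_zero
  have hγ0 : γ ≠ 0 := by linarith
  rw [hs, div_pow]
  generalize Real.exp _ = E
  generalize √(2 * Real.pi / κ) = R at *
  field_simp
  ring

end RankOneGUE
end

/-! ### Rescaling around the saddle point -/

noncomputable section
namespace RankOneGUE

/-- The logarithm of the inverse of the point `exp (-ζ)` of the contour. -/
def contourLog (m δ s : ℝ) : ℂ := δ * (m - δ * s * Complex.I)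

/-- The point of the contour. -/
def contourPoint (m δ s : ℝ) : ℂ := Complex.exp (-contourLog m δ s)

/-- The exponent of the rescaled contour integral, with `N = δ⁻³`. -/
def saddleExponent (α q m δ s : ℝ) : ℂ :=
  (((δ ^ 3)⁻¹ - 2) * Real.log (1 - m * δ / (1 + α * δ)) -
      (δ ^ 3)⁻¹ * (m * δ * (1 + α * δ - m * δ)) - (δ ^ 3)⁻¹ / 2 * (q * δ) ^ 2 : ℝ) +
    (((δ ^ 3)⁻¹ : ℝ) * (contourPoint m δ s * (q * δ : ℝ) ^ 2 / (1 + contourPoint m δ s)) +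
     ((δ ^ 3)⁻¹ : ℝ) * (contourPoint m δ s * (m * δ : ℝ) ^ 2 / (1 - contourPoint m δ s))) +
    (((δ ^ 3)⁻¹ : ℝ) - 2) * contourLog m δ s

/-- The amplitude of the rescaled contour integral. -/
def saddleAmplitude (α q m δ s : ℝ) : ℂ :=
  δ / (1 - contourPoint m δ s) *
    (√δ * Complex.exp (-(1 / 2) * Complex.log (1 - contourPoint m δ s ^ 2))) *
    (contourAmplitude (δ ^ 3)⁻¹ (1 + α * δ - m * δ) (q * δ) (m * δ) (contourPoint m δ s) / δ ^ 2)

/-- The angle is φ = δ²s because the second derivative of N(y²/ζ + ζ) at y = mδ is of order δ⁻⁴. The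
prefactors N^(1/3), √N and dφ give δ^(-1/2) in total, distributed in `saddleAmplitude` as δ, √δ and
δ⁻² so that each factor has its own limit. -/
lemma rescaledDensity_meanDensity_eq (α q : ℝ) {m : ℝ} (hm : 0 < m) (n : ℕ) {δ : ℝ}
    (hδ : δ = (((n + 2 : ℕ) : ℝ) ^ (1 / 3 : ℝ))⁻¹) (hγ : m * δ < 1 + α * δ) :
    rescaledDensity (n + 2) (meanDensity n (criticalGamma α (n + 2))) q m =
      (√(2 * Real.pi) * (2 * Real.pi) * (1 + α * δ))⁻¹ *
        (∫ s in (-(Real.pi / δ ^ 2))..(Real.pi / δ ^ 2),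
          saddleAmplitude α q m δ s * Complex.exp (saddleExponent α q m δ s)).re := by
  have hN : (0 : ℝ) < ((n + 2 : ℕ) : ℝ) := by positivity
  have hδ0 : 0 < δ := by rw [hδ]; positivity
  have hκ : ((n + 2 : ℕ) : ℝ) = (δ ^ 3)⁻¹ := by
    rw [hδ, inv_pow, inv_inv, ← Real.rpow_natCast, ← Real.rpow_mul hN.le]; norm_num
  have h23 : ((n + 2 : ℕ) : ℝ) ^ (2 / 3 : ℝ) = (δ ^ 2)⁻¹ := by
    rw [hδ, inv_pow, inv_inv, ← Real.rpow_natCast, ← Real.rpow_mul hN.le]; norm_num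
  have h13 : ((n + 2 : ℕ) : ℝ) ^ (1 / 3 : ℝ) = δ⁻¹ := by rw [hδ, inv_inv]
  have hnκ : (n : ℝ) = (δ ^ 3)⁻¹ - 2 := by rw [← hκ]; push_cast; ring
  have hnκc : (n : ℂ) = ((δ ^ 3)⁻¹ : ℝ) - 2 := by
    have := congrArg (fun t : ℝ => (t : ℂ)) hnκ
    simpa using this
  rw [rescaledDensity, criticalGamma, h13, h23]
  simp only [div_inv_eq_mul]
  rw [meanDensity_eq n (by positivity) hγ, taylorCoeff_eq_integral, hκ]
  set κ := (δ ^ 3)⁻¹ with hκd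
  have hκ0 : 0 < κ := by positivity
  set γ := 1 + α * δ with hγd
  have hγ0 : 0 < γ := lt_trans (by positivity) hγ
  have hsub := intervalIntegral.smul_integral_comp_mul_left (a := -(Real.pi / δ ^ 2))
    (b := Real.pi / δ ^ 2) (fun φ : ℝ =>
      (fun t => mehler κ (q * δ) (m * δ) t / (1 - t) *
        contourAmplitude κ (γ - m * δ) (q * δ) (m * δ) t)
        (Complex.exp (-((m * δ : ℝ) - φ * Complex.I))) *
        Complex.exp (n * ((m * δ : ℝ) - φ * Complex.I))) (δ ^ 2)
  rw [mul_neg, mul_div_cancel₀ _ (by positivity : δ ^ 2 ≠ 0)] at hsub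
  rw [← hsub]
  have hpt : ∀ s : ℝ, ((κ * δ ^ 2 * (√(κ / (2 * Real.pi)) *
      ((γ - m * δ) ^ n / γ ^ (n + 1)) * Real.exp (-κ * (m * δ * (γ - m * δ)) - κ / 2 * (q * δ)
          ^ 2) *
      ((2 * Real.pi)⁻¹ * δ ^ 2)) : ℝ) : ℂ) *
      ((fun t => mehler κ (q * δ) (m * δ) t / (1 - t) *
        contourAmplitude κ (γ - m * δ) (q * δ) (m * δ) t)
        (Complex.exp (-((m * δ : ℝ) - (δ ^ 2 * s : ℝ) * Complex.I))) *
        Complex.exp (n * ((m * δ : ℝ) - (δ ^ 2 * s : ℝ) * Complex.I))) =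
      (((√(2 * Real.pi) * (2 * Real.pi) * γ)⁻¹ : ℝ) : ℂ) *
        (saddleAmplitude α q m δ s * Complex.exp (saddleExponent α q m δ s)) := by
    intro s
    have hζ : ((m * δ : ℝ) : ℂ) - (δ ^ 2 * s : ℝ) * Complex.I = contourLog m δ s := by
      rw [contourLog]; push_cast; ring
    have hlog : (γ - m * δ) ^ n / γ ^ (n + 1) =
        γ⁻¹ * Real.exp ((κ - 2) * Real.log (1 - m * δ / γ)) := by
      have h1 : 1 - m * δ / γ = (γ - m * δ) / γ := by field_simp
      rw [← hnκ, h1, ← Real.log_pow, Real.exp_log (by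
        have : 0 < γ - m * δ := by linarith
        positivity), div_pow, pow_succ]
      field_simp
    have hsq : √(κ / (2 * Real.pi)) = (√(2 * Real.pi))⁻¹ * (δ * √δ)⁻¹ := by
      rw [Real.sqrt_div hκ0.le, hκd, Real.sqrt_inv, pow_succ, Real.sqrt_mul (by positivity),
        Real.sqrt_sq hδ0.le]
      ring
    have hsqδ : (√δ : ℂ) * √δ = δ := by exact_mod_cast Real.mul_self_sqrt hδ0.le
    have hexp : Complex.exp (saddleExponent α q m δ s) =
        (Real.exp ((κ - 2) * Real.log (1 - m * δ / γ)) : ℝ) *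
        (Real.exp (-κ * (m * δ * (γ - m * δ)) - κ / 2 * (q * δ) ^ 2) : ℝ) *
        Complex.exp (κ * (contourPoint m δ s * (q * δ : ℝ) ^ 2 / (1 + contourPoint m δ s)) +
          κ * (contourPoint m δ s * (m * δ : ℝ) ^ 2 / (1 - contourPoint m δ s))) *
        Complex.exp (n * contourLog m δ s) := by
      rw [saddleExponent, Complex.exp_add, Complex.exp_add, ← Complex.ofReal_mul, ← Real.exp_add,
        Complex.ofReal_exp, hnκc, ← hγd, ← hκd]
      congr 3
      push_cast
      ring
    beta_reduce
    rw [hζ, hlog, hsq, hexp, saddleAmplitude, ← contourPoint, mehler, add_assoc, Complex.exp_add,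
      ← hκd, ← hγd]
    generalize contourAmplitude κ (γ - m * δ) (q * δ) (m * δ) (contourPoint m δ s) = CA
    generalize Complex.exp (n * contourLog m δ s) = E1
    generalize Complex.exp (κ * (contourPoint m δ s * (q * δ : ℝ) ^ 2 / (1 + contourPoint m δ s)) +
          κ * (contourPoint m δ s * (m * δ : ℝ) ^ 2 / (1 - contourPoint m δ s))) = E2
    generalize Complex.exp (-(1 / 2) * Complex.log (1 - contourPoint m δ s ^ 2)) = E3
    generalize Real.exp _ = R1
    generalize Real.exp _ = R2
    have hs0 : (√δ : ℂ) ≠ 0 := by exact_mod_cast (Real.sqrt_pos.2 hδ0).ne'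
    have hd0 : (δ : ℂ) ≠ 0 := by exact_mod_cast hδ0.ne'
    have hg0 : (γ : ℂ) ≠ 0 := by exact_mod_cast hγ0.ne'
    have hp0 : (Real.pi : ℂ) ≠ 0 := by exact_mod_cast Real.pi_ne_zero
    have hsp0 : (√(2 * Real.pi) : ℂ) ≠ 0 := by
      exact_mod_cast (Real.sqrt_pos.2 Real.two_pi_pos).ne'
    rw [hκd, div_eq_mul_inv _ (1 - contourPoint m δ s), div_eq_mul_inv _ (1 - contourPoint m δ s)]
    generalize (1 - contourPoint m δ s)⁻¹ = P
    clear_value γ κ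
    push_cast
    generalize (√(2 * Real.pi) : ℂ) = Q at *
    generalize (√δ : ℂ) = W at *
    rw [← hsqδ] at hd0 ⊢
    have hW : W ≠ 0 := hs0
    field_simp
  have hmulre : ∀ (a : ℝ) (w : ℂ), a * w.re = ((a : ℂ) * w).re := fun a w =>
    (Complex.re_ofReal_mul a w).symm
  rw [hmulre, hmulre, hmulre, ← intervalIntegral.integral_const_mul, ← mul_assoc]
  have hre : ∀ a b : ℂ, a = b → a.re = b.re := fun a b h => by rw [h]
  refine hre _ _ ?_
  simp only [← hpt]
  rw [intervalIntegral.integral_const_mul, Complex.real_smul]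
  push_cast
  ring

end RankOneGUE
end

/-! ### Pointwise limit of the amplitude -/

noncomputable section
namespace RankOneGUE

lemma tendsto_exp_sub_quadratic :
    Tendsto (fun ζ : ℂ => (Complex.exp ζ - 1 - ζ - ζ ^ 2 / 2) / ζ ^ 3) (𝓝[≠] 0) (𝓝 (1 / 6)) := by
  rw [tendsto_iff_norm_sub_tendsto_zero]
  have hlim : Tendsto (fun ζ : ℂ => ‖ζ‖) (𝓝[≠] 0) (𝓝 0) := by
    have : Tendsto (fun ζ : ℂ => ‖ζ‖) (𝓝 0) (𝓝 ‖(0 : ℂ)‖) := continuous_norm.tendsto 0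
    rw [norm_zero] at this
    exact this.mono_left nhdsWithin_le_nhds
  refine squeeze_zero' (Eventually.of_forall fun _ => norm_nonneg _) ?_ hlim
  have hball : ∀ᶠ ζ : ℂ in 𝓝[≠] 0, ‖ζ‖ < 1 := hlim.eventually_lt_const one_pos
  filter_upwards [hball, self_mem_nhdsWithin] with ζ h1 h0
  have h0 : ζ ≠ 0 := h0
  have hb := Complex.exp_bound h1.le (n := 4) (by norm_num)
  have e : (Complex.exp ζ - 1 - ζ - ζ ^ 2 / 2) / ζ ^ 3 - 1 / 6 =
      (Complex.exp ζ - ∑ k ∈ Finset.range 4, ζ ^ k / k.factorial) / ζ ^ 3 := by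
    simp [Finset.sum_range_succ, Nat.factorial]
    field_simp
    ring
  rw [e, norm_div, norm_pow, div_le_iff₀ (by positivity)]
  refine hb.trans ?_
  have : ‖ζ‖ * ‖ζ‖ ^ 3 = ‖ζ‖ ^ 4 * 1 := by ring
  rw [this]
  gcongr
  norm_num [Nat.factorial]

/-- The remainder `h` in `1 / (1 - e^{-ζ}) = 1 / ζ + 1 / 2 + ζ h(ζ)`. -/
def bernoulliRemainder (ζ : ℂ) : ℂ := (1 / (1 - Complex.exp (-ζ)) - 1 / ζ - 1 / 2) / ζ

lemma inv_one_sub_exp_neg {ζ : ℂ} (hζ : ζ ≠ 0) :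
    1 / (1 - Complex.exp (-ζ)) = 1 / ζ + 1 / 2 + ζ * bernoulliRemainder ζ := by
  rw [bernoulliRemainder, mul_div_cancel₀ _ hζ]
  ring

/-- The limit is the Bernoulli coefficient B₂/2! = 1/12. Writing exp ζ = 1 + ζu gives 1/(1 -
exp(-ζ)) = 1 + 1/(ζu), and u is known to second order. -/
lemma tendsto_bernoulliRemainder :
    Tendsto bernoulliRemainder (𝓝[≠] 0) (𝓝 (1 / 12)) := by
  set r : ℂ → ℂ := fun ζ => (Complex.exp ζ - 1 - ζ - ζ ^ 2 / 2) / ζ ^ 3 with hr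
  have hrl : Tendsto r (𝓝[≠] 0) (𝓝 (1 / 6)) := tendsto_exp_sub_quadratic
  have hid : Tendsto (fun ζ : ℂ => ζ) (𝓝[≠] 0) (𝓝 0) := tendsto_id.mono_left nhdsWithin_le_nhds
  have hu : Tendsto (fun ζ => 1 + ζ / 2 + r ζ * ζ ^ 2) (𝓝[≠] 0) (𝓝 1) := by
    have := (tendsto_const_nhds (x := (1 : ℂ))).add (hid.div_const 2) |>.add (hrl.mul (hid.pow 2))
    simpa using this
  have hq : Tendsto (fun ζ => (1 / 4 - r ζ + r ζ * ζ / 2) / (1 + ζ / 2 + r ζ * ζ ^ 2)) (𝓝[≠] 0)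
      (𝓝 (1 / 12)) := by
    have := ((tendsto_const_nhds (x := (1 / 4 : ℂ))).sub hrl |>.add
      ((hrl.mul hid).div_const 2)).div hu one_ne_zero
    rwa [show ((1 / 4 - 1 / 6 + 1 / 6 * 0 / 2) / 1 : ℂ) = 1 / 12 by norm_num] at this
  refine hq.congr' ?_
  filter_upwards [hu.eventually_ne one_ne_zero, self_mem_nhdsWithin] with ζ hu0 h0
  have h0 : ζ ≠ 0 := h0
  have he : Complex.exp ζ = 1 + ζ * (1 + ζ / 2 + r ζ * ζ ^ 2) := by
    simp only [hr]; field_simp; ring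
  have he0 := Complex.exp_ne_zero ζ
  set u := 1 + ζ / 2 + r ζ * ζ ^ 2 with hud
  have hinv : 1 / (1 - Complex.exp (-ζ)) = 1 + 1 / (ζ * u) := by
    rw [Complex.exp_neg]
    have h1 : Complex.exp ζ - 1 = ζ * u := by rw [he]; ring
    have h2 : 1 - (Complex.exp ζ)⁻¹ = (ζ * u) / Complex.exp ζ := by rw [← h1]; field_simp
    rw [h2, one_div_div, ← h1]
    have h3 : Complex.exp ζ - 1 ≠ 0 := by rw [h1]; exact mul_ne_zero h0 hu0
    field_simp
    ring
  rw [bernoulliRemainder, hinv]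
  have hnum : 1 / 4 - r ζ + r ζ * ζ / 2 = (1 - u + ζ * u / 2) / ζ ^ 2 := by
    rw [hud]; field_simp; ring
  rw [hnum]
  field_simp
  ring

variable {m : ℝ}

lemma tendsto_ofReal_nhdsGT : Tendsto (fun δ : ℝ => (δ : ℂ)) (𝓝[>] 0) (𝓝 0) := by
  have : Tendsto (fun δ : ℝ => (δ : ℂ)) (𝓝 0) (𝓝 ((0 : ℝ) : ℂ)) :=
      Complex.continuous_ofReal.tendsto 0
  simpa using this.mono_left nhdsWithin_le_nhds

lemma contourDirection_ne_zero (hm : 0 < m) (δ s : ℝ) : ((m : ℂ) - δ * s * Complex.I) ≠ 0 := by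
  intro h
  have := congrArg Complex.re h
  simp at this
  exact hm.ne' this

lemma tendsto_contourDirection (m s : ℝ) :
    Tendsto (fun δ : ℝ => (m : ℂ) - δ * s * Complex.I) (𝓝[>] 0) (𝓝 m) := by
  have := (tendsto_const_nhds (x := (m : ℂ))).sub
    ((tendsto_ofReal_nhdsGT.mul_const (s : ℂ)).mul_const Complex.I)
  simpa using this

lemma tendsto_contourLog (hm : 0 < m) (s : ℝ) :
    Tendsto (fun δ : ℝ => contourLog m δ s) (𝓝[>] 0) (𝓝[≠] 0) := by
  refine tendsto_nhdsWithin_iff.2 ⟨?_, ?_⟩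
  · have := tendsto_ofReal_nhdsGT.mul (tendsto_contourDirection m s)
    simpa [contourLog] using this
  · filter_upwards [self_mem_nhdsWithin] with δ hδ
    have hδ : 0 < δ := hδ
    exact mul_ne_zero (by exact_mod_cast hδ.ne') (contourDirection_ne_zero hm δ s)

lemma tendsto_contourPoint (hm : 0 < m) (s : ℝ) :
    Tendsto (fun δ : ℝ => contourPoint m δ s) (𝓝[>] 0) (𝓝 1) := by
  have h := ((tendsto_contourLog hm s).mono_right nhdsWithin_le_nhds).neg.cexp
  simpa [contourPoint] using h

lemma tendsto_remainder_contourLog (hm : 0 < m) (s : ℝ) :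
    Tendsto (fun δ : ℝ => bernoulliRemainder (contourLog m δ s)) (𝓝[>] 0) (𝓝 (1 / 12)) :=
  tendsto_bernoulliRemainder.comp (tendsto_contourLog hm s)

lemma one_div_one_sub_contourPoint (hm : 0 < m) {δ : ℝ} (hδ : 0 < δ) (s : ℝ) :
    1 / (1 - contourPoint m δ s) = 1 / contourLog m δ s + 1 / 2 +
      contourLog m δ s * bernoulliRemainder (contourLog m δ s) :=
  inv_one_sub_exp_neg (mul_ne_zero (by exact_mod_cast hδ.ne') (contourDirection_ne_zero hm δ s))

lemma norm_contourPoint (m δ s : ℝ) : ‖contourPoint m δ s‖ = Real.exp (-(m * δ)) := by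
  rw [contourPoint, Complex.norm_exp, contourLog]
  congr 1
  simp
  ring

lemma contourPoint_mem_ball (hm : 0 < m) {δ : ℝ} (hδ : 0 < δ) (s : ℝ) :
    contourPoint m δ s ∈ Metric.ball (0 : ℂ) 1 := by
  rw [mem_ball_zero_iff, norm_contourPoint, Real.exp_lt_one_iff]
  have := mul_pos hm hδ
  linarith

lemma tendsto_div_one_sub_contourPoint (hm : 0 < m) (s : ℝ) :
    Tendsto (fun δ : ℝ => δ / (1 - contourPoint m δ s)) (𝓝[>] 0) (𝓝 (1 / m : ℂ)) := by
  have hmc : (m : ℂ) ≠ 0 := by exact_mod_cast hm.ne'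
  have hz := (tendsto_contourLog hm s).mono_right nhdsWithin_le_nhds
  have h := ((tendsto_const_nhds (x := (1 : ℂ))).div (tendsto_contourDirection m s) hmc).add
    (tendsto_ofReal_nhdsGT.div_const 2) |>.add
    (tendsto_ofReal_nhdsGT.mul (hz.mul (tendsto_remainder_contourLog hm s)))
  simp only [zero_div, zero_mul, add_zero, Pi.div_apply] at h
  refine h.congr' ?_
  filter_upwards [self_mem_nhdsWithin] with δ hδ
  have hδ : 0 < δ := hδ
  have hd : (δ : ℂ) ≠ 0 := by exact_mod_cast hδ.ne'
  have hu := contourDirection_ne_zero hm δ s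
  rw [div_eq_mul_one_div (δ : ℂ) (1 - contourPoint m δ s), one_div_one_sub_contourPoint hm hδ]
  generalize bernoulliRemainder (contourLog m δ s) = h
  rw [contourLog]
  generalize (m : ℂ) - δ * s * Complex.I = D at *
  field_simp

lemma tendsto_one_sub_contourPoint_div (hm : 0 < m) (s : ℝ) :
    Tendsto (fun δ : ℝ => (1 - contourPoint m δ s) / δ) (𝓝[>] 0) (𝓝 (m : ℂ)) := by
  have hmc : (m : ℂ) ≠ 0 := by exact_mod_cast hm.ne'
  have h := (tendsto_div_one_sub_contourPoint hm s).inv₀ (one_div_ne_zero hmc)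
  simpa using h

/-- Since δ is positive, √δ can be moved inside the principal logarithm. The rescaled argument (1 -
t²)/δ tends to 2m, away from the branch cut. -/
lemma tendsto_sqrt_mul_exp_log (hm : 0 < m) (s : ℝ) :
    Tendsto (fun δ : ℝ => (√δ : ℂ) * Complex.exp (-(1 / 2)
        * Complex.log (1 - contourPoint m δ s ^ 2)))
      (𝓝[>] 0) (𝓝 ((√(2 * m))⁻¹ : ℝ)) := by
  have h1 : Tendsto (fun δ : ℝ => (1 - contourPoint m δ s) / δ * (1 + contourPoint m δ s)) (𝓝[>] 0)
      (𝓝 ((2 * m : ℝ) : ℂ)) := by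
    have := (tendsto_one_sub_contourPoint_div hm s).mul
      ((tendsto_const_nhds (x := (1 : ℂ))).add (tendsto_contourPoint hm s))
    convert this using 2
    push_cast; ring
  have hsl : ((2 * m : ℝ) : ℂ) ∈ Complex.slitPlane := Complex.ofReal_mem_slitPlane.2 (by positivity)
  have h2 := (((h1.clog hsl).const_mul (-(1 / 2) : ℂ)).cexp)
  have hsq : ∀ t : ℝ, 0 < t → ((√t : ℝ) : ℂ) = Complex.exp (1 / 2 * Complex.log t) := by
    intro t ht
    rw [Real.sqrt_eq_rpow, Complex.ofReal_cpow ht.le, Complex.cpow_def_of_ne_zero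
      (by exact_mod_cast ht.ne'), mul_comm]
    push_cast; rfl
  have hv : Complex.exp (-(1 / 2) * Complex.log ((2 * m : ℝ) : ℂ)) = ((√(2 * m))⁻¹ : ℝ) := by
    rw [Complex.ofReal_inv, hsq _ (by positivity), ← Complex.exp_neg, neg_mul]
  rw [hv] at h2
  refine h2.congr' ?_
  filter_upwards [self_mem_nhdsWithin] with δ hδ
  have hδ : 0 < δ := hδ
  have hd : (δ : ℂ) ≠ 0 := by exact_mod_cast hδ.ne'
  have hb := contourPoint_mem_ball hm hδ s
  have hne : (1 - contourPoint m δ s) / δ * (1 + contourPoint m δ s) ≠ 0 :=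
    mul_ne_zero (div_ne_zero (one_sub_ne_zero_of_mem_ball hb) hd) (one_add_ne_zero_of_mem_ball hb)
  have hfac : 1 - contourPoint m δ s ^ 2 =
      δ * ((1 - contourPoint m δ s) / δ * (1 + contourPoint m δ s)) := by field_simp; ring
  rw [hfac, Complex.log_ofReal_mul hδ hne, hsq δ hδ, ← Complex.exp_add, Complex.ofReal_log hδ.le]
  congr 1
  ring

/-- The first summand gives (1/m)(1 + 1/2) and the second q²/4. In the third, y/(1 - t) - γ + y is
itself of order δ: with D = m - iδs one has (m/D - 1)/δ = is/D, and the constant 1/2 in the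
expansion of 1/(1 - t) adds m/2. -/
lemma tendsto_contourAmplitude (α q : ℝ) (hm : 0 < m) (s : ℝ) :
    Tendsto (fun δ : ℝ => contourAmplitude (δ ^ 3)⁻¹ (1 + α * δ - m * δ) (q * δ) (m * δ)
      (contourPoint m δ s) / δ ^ 2) (𝓝[>] 0)
      (𝓝 (3 / (2 * m) + q ^ 2 / 4 + (3 * m / 2 - α + s * Complex.I / m) ^ 2 : ℂ)) := by
  have hmc : (m : ℂ) ≠ 0 := by exact_mod_cast hm.ne'
  have hz := (tendsto_contourLog hm s).mono_right nhdsWithin_le_nhds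
  have ht := tendsto_contourPoint hm s
  have hadd : Tendsto (fun δ : ℝ => 1 + contourPoint m δ s) (𝓝[>] 0) (𝓝 2) := by
    have := (tendsto_const_nhds (x := (1 : ℂ))).add ht
    convert this using 2; norm_num
  have a1 := (tendsto_div_one_sub_contourPoint hm s).mul
    ((tendsto_const_nhds (x := (1 : ℂ))).add (ht.div hadd two_ne_zero))
  have a2 := (tendsto_const_nhds (x := (q : ℂ) ^ 2)).div (hadd.pow 2) (by norm_num)
  have a3 := ((((tendsto_const_nhds (x := (s * Complex.I : ℂ))).div (tendsto_contourDirection m s)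
    hmc).add (tendsto_const_nhds (x := (m / 2 : ℂ)))).add
    ((tendsto_const_nhds (x := (m : ℂ))).mul (hz.mul (tendsto_remainder_contourLog hm s)))).add
    (tendsto_const_nhds (x := (m - α : ℂ)))
  have h := (a1.add a2).add (a3.pow 2)
  have hlim : (1 / m * (1 + 1 / 2) + q ^ 2 / 2 ^ 2 +
      (s * Complex.I / m + m / 2 + m * (0 * (1 / 12)) + (m - α)) ^ 2 : ℂ) =
      3 / (2 * m) + q ^ 2 / 4 + (3 * m / 2 - α + s * Complex.I / m) ^ 2 := by
    field_simp
    ring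
  rw [hlim] at h
  simp only [Pi.div_apply] at h
  refine h.congr' ?_
  filter_upwards [self_mem_nhdsWithin] with δ hδ
  have hδ : 0 < δ := hδ
  have hd : (δ : ℂ) ≠ 0 := by exact_mod_cast hδ.ne'
  have hb := contourPoint_mem_ball hm hδ s
  have hu := contourDirection_ne_zero hm δ s
  have e1 := one_sub_ne_zero_of_mem_ball hb
  have e2 := one_add_ne_zero_of_mem_ball hb
  have hP := one_div_one_sub_contourPoint hm hδ s
  have hsI : s * Complex.I = (m - (m - δ * s * Complex.I)) / δ := by field_simp; ring
  have hX : s * Complex.I / (m - δ * s * Complex.I) + m / 2 +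
      m * (contourLog m δ s * bernoulliRemainder (contourLog m δ s)) + (m - α) =
      ((m * δ : ℝ) / (1 - contourPoint m δ s) - (1 + α * δ - m * δ : ℝ)) / δ := by
    rw [div_eq_mul_one_div ((m * δ : ℝ) : ℂ) (1 - contourPoint m δ s), hP]
    generalize bernoulliRemainder (contourLog m δ s) = h
    rw [contourLog, hsI]
    generalize (m : ℂ) - δ * s * Complex.I = D at *
    push_cast
    field_simp
    ring
  rw [hX, contourAmplitude, show 1 - contourPoint m δ s ^ 2 =
    (1 - contourPoint m δ s) * (1 + contourPoint m δ s) by ring]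
  push_cast
  field_simp

lemma tendsto_saddleAmplitude (α q : ℝ) (hm : 0 < m) (s : ℝ) :
    Tendsto (fun δ : ℝ => saddleAmplitude α q m δ s) (𝓝[>] 0)
      (𝓝 (1 / m * ((√(2 * m))⁻¹ : ℝ) *
        (3 / (2 * m) + q ^ 2 / 4 + (3 * m / 2 - α + s * Complex.I / m) ^ 2) : ℂ)) :=
  ((tendsto_div_one_sub_contourPoint hm s).mul (tendsto_sqrt_mul_exp_log hm s)).mul
    (tendsto_contourAmplitude α q hm s)

end RankOneGUE
end

/-! ### Pointwise limit of the exponent -/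

noncomputable section
namespace RankOneGUE
variable {m : ℝ}

lemma tendsto_id_nhdsGT : Tendsto (fun δ : ℝ => δ) (𝓝[>] 0) (𝓝 0) :=
  tendsto_id.mono_left nhdsWithin_le_nhds

/-- The real part of the exponent that does not depend on the position on the contour. -/
def realExponent (α m δ : ℝ) : ℝ :=
  ((δ ^ 3)⁻¹ - 2) * Real.log (1 - m * δ / (1 + α * δ)) -
    (δ ^ 3)⁻¹ * (m * δ * (1 + α * δ - m * δ)) - m ^ 2 / (2 * δ) + 2 * m / δ ^ 2

/-- The logarithm, multiplied by δ⁻³, must be expanded to third order. The terms of order δ⁻² and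
δ⁻¹ then cancel against the explicit ones, and only a constant survives. -/
lemma tendsto_realExponent (α : ℝ) (hm : 0 < m) :
    Tendsto (realExponent α m) (𝓝[>] 0) (𝓝 (-m * α ^ 2 + m ^ 2 * α - m ^ 3 / 3)) := by
  have hid := tendsto_id_nhdsGT
  have hγ : Tendsto (fun δ : ℝ => 1 + α * δ) (𝓝[>] 0) (𝓝 1) := by
    simpa using (tendsto_const_nhds (x := (1 : ℝ))).add (hid.const_mul α)
  have hμ : Tendsto (fun δ : ℝ => m / (1 + α * δ)) (𝓝[>] 0) (𝓝 m) := by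
    simpa [Pi.div_def] using (tendsto_const_nhds (x := m)).div hγ one_ne_zero
  have hv : Tendsto (fun δ : ℝ => m * δ / (1 + α * δ)) (𝓝[>] 0) (𝓝 0) := by
    simpa [Pi.div_def] using (hid.const_mul m).div hγ one_ne_zero
  have hlog : Tendsto (fun δ : ℝ => Real.log (1 - m * δ / (1 + α * δ))) (𝓝[>] 0) (𝓝 0) := by
    have h1 : Tendsto (fun δ : ℝ => 1 - m * δ / (1 + α * δ)) (𝓝[>] 0) (𝓝 1) := by
      simpa using (tendsto_const_nhds (x := (1 : ℝ))).sub hv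
    simpa using h1.log one_ne_zero
  -- The fourth-order logarithm remainder divided by δ³ is still of order δ.
  have hrem : Tendsto (fun δ : ℝ => (δ ^ 3)⁻¹ * ((m * δ / (1 + α * δ)) + (m * δ / (1 + α * δ))
      ^ 2 / 2 +
      (m * δ / (1 + α * δ)) ^ 3 / 3 + Real.log (1 - m * δ / (1 + α * δ)))) (𝓝[>] 0) (𝓝 0) := by
    have hb : Tendsto (fun δ : ℝ => δ * (m / (1 + α * δ)) ^ 4 / (1 - m * δ / (1 + α * δ))) (𝓝[>] 0)
        (𝓝 0) := by
      have := (hid.mul (hμ.pow 4)).div ((tendsto_const_nhds (x := (1 : ℝ))).sub hv) (by norm_num)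
      simpa [Pi.div_def] using this
    refine squeeze_zero_norm' ?_ hb
    filter_upwards [self_mem_nhdsWithin, hγ.eventually_const_lt zero_lt_one,
      hv.eventually_lt_const one_pos] with δ hδ hg hv1
    have hδ : 0 < δ := hδ
    have hv0 : 0 < m * δ / (1 + α * δ) := by positivity
    have h := Real.abs_log_sub_add_sum_range_le (x := m * δ / (1 + α * δ))
      (by rwa [abs_of_pos hv0]) 3
    rw [abs_of_pos hv0] at h
    have hs : ∑ i ∈ Finset.range 3, (m * δ / (1 + α * δ)) ^ (i + 1) / ((i : ℝ) + 1) =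
        (m * δ / (1 + α * δ)) + (m * δ / (1 + α * δ)) ^ 2 / 2 + (m * δ / (1 + α * δ)) ^ 3 / 3 := by
      simp [Finset.sum_range_succ]
      norm_num
    rw [hs] at h
    rw [Real.norm_eq_abs, abs_mul, abs_of_pos (by positivity : (0 : ℝ) < (δ ^ 3)⁻¹)]
    refine (mul_le_mul_of_nonneg_left h (by positivity)).trans (le_of_eq ?_)
    have h1 : 1 - m * δ / (1 + α * δ) ≠ 0 := by linarith
    generalize 1 - m * δ / (1 + α * δ) = R at *
    generalize 1 + α * δ = g at *
    rw [show 3 + 1 = 4 from rfl]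
    field_simp
  -- What the exact algebra leaves after the third-order Taylor polynomial of the logarithm is
  -- removed; no negative powers of δ remain.
  have hmain : Tendsto (fun δ : ℝ => -m * α ^ 2 / (1 + α * δ) +
      1 / 2 * (m * α / (1 + α * δ)) * (m + m / (1 + α * δ)) - (m / (1 + α * δ)) ^ 3 / 3) (𝓝[>] 0)
      (𝓝 (-m * α ^ 2 + m ^ 2 * α - m ^ 3 / 3)) := by
    have h := (((tendsto_const_nhds (x := -m * α ^ 2)).div hγ one_ne_zero).add
      ((((tendsto_const_nhds (x := m * α)).div hγ one_ne_zero).const_mul (1 / 2)).mul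
        ((tendsto_const_nhds (x := m)).add hμ))).sub ((hμ.pow 3).div_const 3)
    rw [show -m * α ^ 2 / 1 + 1 / 2 * (m * α / 1) * (m + m) - m ^ 3 / 3 =
      -m * α ^ 2 + m ^ 2 * α - m ^ 3 / 3 by ring] at h
    exact h
  have h := (hrem.sub (hlog.const_mul 2)).add hmain
  rw [mul_zero, sub_zero, zero_add] at h
  refine h.congr' ?_
  filter_upwards [self_mem_nhdsWithin, hγ.eventually_const_lt zero_lt_one] with δ hδ hg
  have hδ : 0 < δ := hδ
  rw [realExponent]
  generalize Real.log (1 - m * δ / (1 + α * δ)) = L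
  obtain ⟨g, hgd⟩ : ∃ g, 1 + α * δ = g := ⟨_, rfl⟩
  have hα : α = (g - 1) / δ := by rw [← hgd]; field_simp; ring
  rw [hgd] at hg ⊢
  rw [hα]
  field_simp
  ring

/-- Put D = m - iδs, so that ζ = δD. The singular part of t/(1 - t) combines with the linear term as
(m²/D + D)/δ² = 2m/δ² - s²/D; the constant -1/2 gives -m²/(2δ). These s-independent terms are
collected in `realExponent`, and everything else converges termwise. -/
lemma saddleExponent_eq (α q : ℝ) (hm : 0 < m) {δ : ℝ} (hδ : 0 < δ) (s : ℝ) :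
    saddleExponent α q m δ s = (realExponent α m δ : ℂ) -
      q ^ 2 / 2 * ((1 - contourPoint m δ s) / δ / (1 + contourPoint m δ s)) +
      m ^ 2 * (m - δ * s * Complex.I) * bernoulliRemainder (contourLog m δ s) -
      s ^ 2 / (m - δ * s * Complex.I) - 2 * (δ * (m - δ * s * Complex.I)) := by
  have hd : (δ : ℂ) ≠ 0 := by exact_mod_cast hδ.ne'
  have hb := contourPoint_mem_ball hm hδ s
  have hu := contourDirection_ne_zero hm δ s
  have e1 := one_sub_ne_zero_of_mem_ball hb
  have e2 := one_add_ne_zero_of_mem_ball hb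
  have hP := one_div_one_sub_contourPoint hm hδ s
  have hts : contourPoint m δ s / (1 - contourPoint m δ s) = 1 / contourLog m δ s - 1 / 2 +
      contourLog m δ s * bernoulliRemainder (contourLog m δ s) := by
    have : contourPoint m δ s / (1 - contourPoint m δ s) = 1 / (1 - contourPoint m δ s) - 1 := by
      field_simp; ring
    rw [this, hP]; ring
  have hsI : (s : ℂ) ^ 2 = -((m - (m - δ * s * Complex.I)) / δ) ^ 2 := by
    have : (m - ((m : ℂ) - δ * s * Complex.I)) / δ = s * Complex.I := by field_simp; ring
    rw [this, mul_pow, Complex.I_sq]; ring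
  rw [saddleExponent, mul_div_right_comm _ _ (1 - contourPoint m δ s), hts, realExponent, hsI]
  generalize bernoulliRemainder (contourLog m δ s) = h
  generalize contourPoint m δ s = t at *
  rw [contourLog]
  clear hP hts hsI
  generalize (m : ℂ) - δ * s * Complex.I = D at *
  push_cast
  generalize (Real.log (1 - m * δ / (1 + α * δ)) : ℂ) = L
  field_simp
  ring

/-- The Bernoulli remainder contributes m³/12, which turns -m³/3 into -m³/4 and completes the square
-m(α - m/2)². -/
lemma tendsto_saddleExponent (α q : ℝ) (hm : 0 < m) (s : ℝ) :
    Tendsto (fun δ : ℝ => saddleExponent α q m δ s) (𝓝[>] 0)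
      (𝓝 ((-m * (q ^ 2 / 4 + (α - m / 2) ^ 2) - s ^ 2 / m : ℝ) : ℂ)) := by
  have hmc : (m : ℂ) ≠ 0 := by exact_mod_cast hm.ne'
  have hD := tendsto_contourDirection m s
  have h1 : Tendsto (fun δ => (realExponent α m δ : ℂ)) (𝓝[>] 0)
      (𝓝 ((-m * α ^ 2 + m ^ 2 * α - m ^ 3 / 3 : ℝ) : ℂ)) :=
    (Complex.continuous_ofReal.tendsto _).comp (tendsto_realExponent α hm)
  have h2 : Tendsto (fun δ : ℝ => (q : ℂ) ^ 2 / 2 *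
      ((1 - contourPoint m δ s) / δ / (1 + contourPoint m δ s))) (𝓝[>] 0)
      (𝓝 ((q : ℂ) ^ 2 / 2 * (m / (1 + 1)))) :=
    ((tendsto_one_sub_contourPoint_div hm s).div ((tendsto_const_nhds (x := (1 : ℂ))).add
      (tendsto_contourPoint hm s)) (by norm_num)).const_mul _
  have h3 := (hD.const_mul ((m : ℂ) ^ 2)).mul (tendsto_remainder_contourLog hm s)
  have h4 := (tendsto_const_nhds (x := (s : ℂ) ^ 2)).div hD hmc
  have h5 := (tendsto_ofReal_nhdsGT.mul hD).const_mul (2 : ℂ)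
  have h := (((h1.sub h2).add h3).sub h4).sub h5
  have hlim : ((-m * α ^ 2 + m ^ 2 * α - m ^ 3 / 3 : ℝ) : ℂ) - q ^ 2 / 2 * (m / (1 + 1)) +
      m ^ 2 * m * (1 / 12) - s ^ 2 / m - 2 * (0 * m) =
      ((-m * (q ^ 2 / 4 + (α - m / 2) ^ 2) - s ^ 2 / m : ℝ) : ℂ) := by
    push_cast; ring
  rw [hlim] at h
  refine h.congr' ?_
  filter_upwards [self_mem_nhdsWithin] with δ hδ
  rw [saddleExponent_eq α q hm hδ s]
  rfl

end RankOneGUE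
end

/-! ### Decay of the exponent along the whole contour -/

noncomputable section
namespace RankOneGUE
variable {m : ℝ}

lemma contourPoint_eq (m δ s : ℝ) : contourPoint m δ s =
    (Real.exp (-(m * δ)) : ℂ) * Complex.exp ((δ ^ 2 * s : ℝ) * Complex.I) := by
  rw [contourPoint, contourLog, Complex.ofReal_exp, ← Complex.exp_add]
  congr 1
  push_cast
  ring

lemma contourPoint_re (m δ s : ℝ) :
    (contourPoint m δ s).re = Real.exp (-(m * δ)) * Real.cos (δ ^ 2 * s) := by
  rw [contourPoint_eq, Complex.re_ofReal_mul, Complex.exp_ofReal_mul_I_re]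

/-- The Möbius map t/(1 + t) sends the unit disc into the half-plane of real part less than 1/2. -/
lemma re_div_one_add_le {t : ℂ} (ht : ‖t‖ < 1) : (t / (1 + t)).re ≤ 1 / 2 := by
  have h1 : 1 + t ≠ 0 := one_add_ne_zero_of_mem_ball (mem_ball_zero_iff.2 ht)
  have hn : 0 < Complex.normSq (1 + t) := Complex.normSq_pos.2 h1
  rw [Complex.div_re, ← add_div, div_le_iff₀ hn]
  have h2 : t.re * t.re + t.im * t.im ≤ 1 := by
    have := Complex.normSq_eq_norm_sq t
    rw [Complex.normSq_apply] at this
    rw [this]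
    exact pow_le_one₀ (norm_nonneg t) ht.le
  rw [Complex.normSq_apply]
  simp only [Complex.add_re, Complex.one_re, Complex.add_im, Complex.one_im, zero_add]
  nlinarith

/-- Decay of the Poisson kernel along a circle. -/
lemma re_div_one_sub_le {r φ y : ℝ} (hr : Real.exp (-y) = r) (hy : 0 < y) (hy1 : y ≤ 1)
    (hφ : |φ| ≤ Real.pi) :
    ((r * Complex.exp (φ * Complex.I)) / (1 - r * Complex.exp (φ * Complex.I))).re ≤
      r / (1 - r) - 1 / 15 * (φ ^ 2 / (y * (y ^ 2 + φ ^ 2))) := by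
  have hr0 : 1 / 3 ≤ r := by
    have h1 : Real.exp (-1) ≤ Real.exp (-y) := Real.exp_le_exp.2 (by linarith)
    have h2 : (1 / 3 : ℝ) ≤ Real.exp (-1) := by
      rw [Real.exp_neg, one_div]
      exact inv_anti₀ (Real.exp_pos 1) Real.exp_one_lt_three.le
    linarith
  have hr1 : r < 1 := by rw [← hr, Real.exp_lt_one_iff]; linarith
  have hry : 1 - r ≤ y := by
    have := Real.add_one_le_exp (-y)
    linarith
  set c := Real.cos φ with hc
  have hw : 2 / Real.pi ^ 2 * φ ^ 2 ≤ 1 - c := by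
    have := Real.cos_le_one_sub_mul_cos_sq hφ
    linarith
  -- This is π² < 10. The final constant 1/15 is this 1/5 times the lower bound 1/3 for r.
  have hpi : 1 / 5 ≤ 2 / Real.pi ^ 2 := by
    rw [div_le_div_iff₀ (by norm_num) (by positivity)]
    nlinarith [Real.pi_lt_d2, Real.pi_gt_three]
  have hw5 : φ ^ 2 / 5 ≤ 1 - c := by nlinarith [sq_nonneg φ]
  have hcs : c ^ 2 + Real.sin φ ^ 2 = 1 := Real.cos_sq_add_sin_sq φ
  have hQ : 0 < (1 - r) ^ 2 + 2 * r * (1 - c) := by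
    have : 0 < 1 - r := by linarith
    have : 0 ≤ 1 - c := le_trans (by positivity) hw5
    positivity
  have hre : ((r * Complex.exp (φ * Complex.I)) / (1 - r * Complex.exp (φ * Complex.I))).re =
      r / (1 - r) - r * (1 + r) * (1 - c) / ((1 - r) * ((1 - r) ^ 2 + 2 * r * (1 - c))) := by
    have hn : Complex.normSq (1 - r * Complex.exp (φ * Complex.I)) =
        (1 - r) ^ 2 + 2 * r * (1 - c) := by
      rw [Complex.normSq_apply]
      simp only [Complex.sub_re, Complex.one_re, Complex.re_ofReal_mul, Complex.exp_ofReal_mul_I_re,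
        Complex.sub_im, Complex.one_im, Complex.im_ofReal_mul, Complex.exp_ofReal_mul_I_im, ← hc]
      linear_combination r ^ 2 * hcs
    rw [Complex.div_re, ← add_div, hn]
    simp only [Complex.sub_re, Complex.one_re, Complex.re_ofReal_mul, Complex.exp_ofReal_mul_I_re,
        Complex.sub_im, Complex.one_im, Complex.im_ofReal_mul, Complex.exp_ofReal_mul_I_im, ← hc]
    have hsub : 1 - r ≠ 0 := by linarith
    have hQ' := hQ.ne'
    rw [div_sub_div _ _ hsub (mul_ne_zero hsub hQ'), div_eq_div_iff hQ' (by positivity)]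
    linear_combination (-r ^ 2 * (1 - r) * ((1 - r) * ((1 - r) ^ 2 + 2 * r * (1 - c)))) * hcs
  rw [hre]
  have key : 1 / 15 * (φ ^ 2 / (y * (y ^ 2 + φ ^ 2))) ≤
      r * (1 + r) * (1 - c) / ((1 - r) * ((1 - r) ^ 2 + 2 * r * (1 - c))) := by
    rcases eq_or_ne φ 0 with h0 | h0
    · have : 0 ≤ 1 - c := le_trans (by positivity) hw5
      have : 0 < 1 - r := by linarith
      rw [h0]
      simp only [ne_eq, OfNat.ofNat_ne_zero, not_false_eq_true, zero_pow, zero_div, mul_zero]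
      positivity
    have hφ2 : 0 < φ ^ 2 := by positivity
    have hsub : 0 < 1 - r := by linarith
    have hw0 : 0 < φ ^ 2 / 5 := by positivity
    have hwp : 0 < 1 - c := lt_of_lt_of_le hw0 hw5
    -- The function w/((1-r)² + 2rw) increases in w, so 1 - cos φ may be replaced by its lower
    -- bound.
    have s1 : (φ ^ 2 / 5) / ((1 - r) ^ 2 + 2 * r * (φ ^ 2 / 5)) ≤
        (1 - c) / ((1 - r) ^ 2 + 2 * r * (1 - c)) := by
      rw [div_le_div_iff₀ (by positivity) hQ]
      nlinarith [mul_le_mul_of_nonneg_right hw5 (sq_nonneg (1 - r))]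
    have s2 : (φ ^ 2 / 5) / (y ^ 2 + φ ^ 2) ≤ (φ ^ 2 / 5) / ((1 - r) ^ 2 + 2 * r * (φ ^ 2 / 5))
        := by
      refine div_le_div_of_nonneg_left hw0.le (by positivity) ?_
      have : (1 - r) ^ 2 ≤ y ^ 2 := pow_le_pow_left₀ hsub.le hry 2
      nlinarith
    have s3 : (1 / 3) / y ≤ r * (1 + r) / (1 - r) := by
      refine div_le_div₀ (by positivity) ?_ hsub hry
      nlinarith
    calc 1 / 15 * (φ ^ 2 / (y * (y ^ 2 + φ ^ 2))) =
        ((1 / 3) / y) * ((φ ^ 2 / 5) / (y ^ 2 + φ ^ 2)) := by field_simp; norm_num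
      _ ≤ (r * (1 + r) / (1 - r)) * ((1 - c) / ((1 - r) ^ 2 + 2 * r * (1 - c))) :=
        mul_le_mul s3 (s2.trans s1) (by positivity) (by positivity)
      _ = _ := by rw [div_mul_div_comm]
  linarith

/-- The q-dependent contour term is at most half its coefficient and cancels the Gaussian prefactor
in q; the other contour term decays by the Poisson kernel estimate. On the integration range δ²s² ≤
π|s|, which makes the bound independent of δ, with quadratic decay near the saddle and linear decay
in the tails. -/
lemma re_saddleExponent_le (α q : ℝ) (hm : 0 < m) {δ s : ℝ} (hδ : 0 < δ) (hmδ : m * δ ≤ 1)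
    (hs : |s| ≤ Real.pi / δ ^ 2) :
    (saddleExponent α q m δ s).re ≤ (saddleExponent α 0 m δ 0).re -
      m / 15 * (s ^ 2 / (m ^ 2 + Real.pi * |s|)) := by
  have hy : 0 < m * δ := by positivity
  set r := Real.exp (-(m * δ)) with hr
  have hφ : |δ ^ 2 * s| ≤ Real.pi := by
    rw [abs_mul, abs_of_pos (by positivity : 0 < δ ^ 2)]
    rwa [le_div_iff₀ (by positivity), mul_comm] at hs
  have hA := re_div_one_sub_le hr.symm hy hmδ hφ
  rw [hr, ← contourPoint_eq] at hA
  have hB := re_div_one_add_le (t := contourPoint m δ s)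
    (mem_ball_zero_iff.1 (contourPoint_mem_ball hm hδ s))
  have h0 : contourPoint m δ 0 = (r : ℂ) := by rw [contourPoint_eq]; simp [hr]
  have e1 : (saddleExponent α q m δ s).re =
      ((δ ^ 3)⁻¹ - 2) * Real.log (1 - m * δ / (1 + α * δ)) -
      (δ ^ 3)⁻¹ * (m * δ * (1 + α * δ - m * δ)) - (δ ^ 3)⁻¹ / 2 * (q * δ) ^ 2 +
      ((δ ^ 3)⁻¹ * (q * δ) ^ 2 * (contourPoint m δ s / (1 + contourPoint m δ s)).re +
      (δ ^ 3)⁻¹ * (m * δ) ^ 2 * (contourPoint m δ s / (1 - contourPoint m δ s)).re) +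
      ((δ ^ 3)⁻¹ - 2) * (m * δ) := by
    have h1 : ∀ (a b : ℝ) (t w : ℂ), (a : ℂ) * (t * (b : ℂ) ^ 2 / w) =
        ((a * b ^ 2 : ℝ) : ℂ) * (t / w) := fun a b t w => by push_cast; ring
    have h2 : (((δ ^ 3)⁻¹ : ℝ) - 2 : ℂ) = (((δ ^ 3)⁻¹ - 2 : ℝ) : ℂ) := by push_cast; rfl
    rw [saddleExponent, h1, h1, h2]
    simp only [Complex.add_re, Complex.re_ofReal_mul, Complex.ofReal_re]
    have h3 : ((m : ℂ) - δ * s * Complex.I).re = m := by simp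
    rw [contourLog, Complex.re_ofReal_mul, h3]
    ring
  have e2 : (saddleExponent α 0 m δ 0).re =
      ((δ ^ 3)⁻¹ - 2) * Real.log (1 - m * δ / (1 + α * δ)) -
      (δ ^ 3)⁻¹ * (m * δ * (1 + α * δ - m * δ)) +
      (δ ^ 3)⁻¹ * (m * δ) ^ 2 * (r / (1 - r)) + ((δ ^ 3)⁻¹ - 2) * (m * δ) := by
    have h2 : (((δ ^ 3)⁻¹ : ℝ) - 2 : ℂ) = (((δ ^ 3)⁻¹ - 2 : ℝ) : ℂ) := by push_cast; rfl
    have h3 : (saddleExponent α 0 m δ 0) = ((((δ ^ 3)⁻¹ - 2) * Real.log (1 - m * δ / (1 + α * δ)) -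
      (δ ^ 3)⁻¹ * (m * δ * (1 + α * δ - m * δ)) +
      (δ ^ 3)⁻¹ * (m * δ) ^ 2 * (r / (1 - r)) + ((δ ^ 3)⁻¹ - 2) * (m * δ) : ℝ) : ℂ) := by
      rw [saddleExponent, h0, contourLog]
      push_cast
      ring
    rw [h3, Complex.ofReal_re]
  have hκ : 0 < (δ ^ 3)⁻¹ := by positivity
  have t1 : (δ ^ 3)⁻¹ * (q * δ) ^ 2 * (contourPoint m δ s / (1 + contourPoint m δ s)).re ≤
      (δ ^ 3)⁻¹ / 2 * (q * δ) ^ 2 := by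
    have := mul_le_mul_of_nonneg_left hB (by positivity : 0 ≤ (δ ^ 3)⁻¹ * (q * δ) ^ 2)
    linarith
  have t2 := mul_le_mul_of_nonneg_left hA (by positivity : 0 ≤ (δ ^ 3)⁻¹ * (m * δ) ^ 2)
  have t3 : m / 15 * (s ^ 2 / (m ^ 2 + Real.pi * |s|)) ≤ (δ ^ 3)⁻¹ * (m * δ) ^ 2 *
      (1 / 15 * ((δ ^ 2 * s) ^ 2 / (m * δ * ((m * δ) ^ 2 + (δ ^ 2 * s) ^ 2)))) := by
    have e : (δ ^ 3)⁻¹ * (m * δ) ^ 2 *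
      (1 / 15 * ((δ ^ 2 * s) ^ 2 / (m * δ * ((m * δ) ^ 2 + (δ ^ 2 * s) ^ 2)))) =
      m / 15 * (s ^ 2 / (m ^ 2 + δ ^ 2 * s ^ 2)) := by
      have : (m * δ) ^ 2 + (δ ^ 2 * s) ^ 2 = δ ^ 2 * (m ^ 2 + δ ^ 2 * s ^ 2) := by ring
      have : m ^ 2 + δ ^ 2 * s ^ 2 ≠ 0 := by positivity
      rw [‹(m * δ) ^ 2 + _ = _›]
      field_simp
    rw [e]
    refine mul_le_mul_of_nonneg_left (div_le_div_of_nonneg_left (by positivity) (by positivity) ?_)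
      (by positivity)
    have : δ ^ 2 * s ^ 2 ≤ Real.pi * |s| := by
      rw [← sq_abs s, pow_two |s|, ← mul_assoc]
      refine mul_le_mul_of_nonneg_right ?_ (abs_nonneg s)
      rwa [abs_mul, abs_of_pos (by positivity : 0 < δ ^ 2)] at hφ
    linarith
  rw [e1, e2]
  rw [← hr] at t2
  linarith

end RankOneGUE
end

/-! ### A bound for the amplitude uniform in δ -/

noncomputable section
namespace RankOneGUE
variable {m : ℝ}

lemma one_sub_exp_neg_ge {y : ℝ} (hy : 0 < y) : y / (1 + y) ≤ 1 - Real.exp (-y) := by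
  have h := Real.add_one_le_exp y
  have h2 : Real.exp (-y) ≤ (1 + y)⁻¹ := by
    rw [Real.exp_neg]
    exact inv_anti₀ (by linarith) (by linarith)
  have h3 : y / (1 + y) = 1 - (1 + y)⁻¹ := by field_simp; ring
  linarith

lemma half_le_one_sub_exp_neg {y : ℝ} (hy : 0 < y) (hy1 : y ≤ 1) : y / 2 ≤ 1 - Real.exp (-y) :=
  (div_le_div_of_nonneg_left hy.le (by linarith) (by linarith)).trans (one_sub_exp_neg_ge hy)

/-- A bound for the amplitude, uniform in `δ`. -/
def amplitudeBound (α q m s : ℝ) : ℝ :=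
  2 / m * √(2 / m) *
    (4 / m + q ^ 2 * (1 + 4 / m ^ 2 * |s|) + (4 / m * |s| + (2 * m + |α|)) ^ 2)

/-- Where cos φ ≥ 0 the modulus of 1 + t is at least 1. Elsewhere only mδ/2 is available, but then
δ²|s| ≥ 1, so the loss δ⁻² is paid for by |s|. -/
lemma norm_one_add_contourPoint_sq_inv_le (hm : 0 < m) {δ s : ℝ} (hδ : 0 < δ) (hmδ : m * δ ≤ 1) :
    (‖1 + contourPoint m δ s‖ ^ 2)⁻¹ ≤ 1 + 4 / m ^ 2 * |s| := by
  have hy : 0 < m * δ := by positivity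
  have hr := half_le_one_sub_exp_neg hy hmδ
  have hn := norm_contourPoint m δ s
  rcases le_or_gt |δ ^ 2 * s| (Real.pi / 2) with h | h
  · have hc : 0 ≤ Real.cos (δ ^ 2 * s) := by
      rw [abs_le] at h
      exact Real.cos_nonneg_of_neg_pi_div_two_le_of_le h.1 h.2
    have h1 : 1 ≤ ‖1 + contourPoint m δ s‖ := by
      refine le_trans ?_ (Complex.re_le_norm _)
      rw [Complex.add_re, Complex.one_re, contourPoint_re]
      have := mul_nonneg (Real.exp_pos (-(m * δ))).le hc
      linarith
    have h2 : (‖1 + contourPoint m δ s‖ ^ 2)⁻¹ ≤ 1 := inv_le_one_of_one_le₀ (one_le_pow₀ h1)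
    have : 0 ≤ 4 / m ^ 2 * |s| := by positivity
    linarith
  · have h1 : m * δ / 2 ≤ ‖1 + contourPoint m δ s‖ := by
      have := norm_sub_norm_le (1 : ℂ) (-contourPoint m δ s)
      rw [norm_neg, sub_neg_eq_add, norm_one, hn] at this
      linarith
    have h2 : (‖1 + contourPoint m δ s‖ ^ 2)⁻¹ ≤ ((m * δ / 2) ^ 2)⁻¹ :=
      inv_anti₀ (by positivity) (pow_le_pow_left₀ (by positivity) h1 2)
    have h3 : 1 ≤ δ ^ 2 * |s| := by
      rw [abs_mul, abs_of_pos (by positivity : 0 < δ ^ 2)] at h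
      linarith [Real.pi_gt_three]
    have h4 : ((m * δ / 2) ^ 2)⁻¹ ≤ 4 / m ^ 2 * |s| := by
      rw [inv_le_iff_one_le_mul₀ (by positivity)]
      calc (1 : ℝ) ≤ δ ^ 2 * |s| := h3
        _ = _ := by field_simp; norm_num
    linarith

/-- Compare t with the real point r = exp(-y) of the contour: |t - r| ≤ δ²|s| and both denominators
are at least y/2. At r itself, 1 ≤ y/(1 - r) ≤ 1 + y. -/
lemma norm_div_one_sub_sub_le (α : ℝ) (hm : 0 < m) {δ s : ℝ} (hδ : 0 < δ) (hmδ : m * δ ≤ 1) :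
    ‖((m * δ : ℝ) : ℂ) / (1 - contourPoint m δ s) - ((1 + α * δ - m * δ : ℝ) : ℂ)‖ ≤
      δ * (4 / m * |s| + (2 * m + |α|)) := by
  have hy : 0 < m * δ := by positivity
  set y := m * δ with hyd
  set r := Real.exp (-y) with hrd
  have hr := half_le_one_sub_exp_neg hy hmδ
  have hr2 := one_sub_exp_neg_ge hy
  rw [← hrd] at hr hr2
  have hry : 1 - r ≤ y := by
    have := Real.add_one_le_exp (-y)
    linarith
  have hr0 : 0 < 1 - r := by linarith
  have hn := norm_contourPoint m δ s
  rw [← hyd, ← hrd] at hn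
  have hrle : r ≤ 1 := by linarith
  have h1 : y / 2 ≤ ‖1 - contourPoint m δ s‖ := by
    have := norm_sub_norm_le (1 : ℂ) (contourPoint m δ s)
    rw [norm_one, hn] at this
    linarith
  have hne : 1 - contourPoint m δ s ≠ 0 := norm_pos_iff.1 (by linarith)
  have hdist : ‖contourPoint m δ s - r‖ ≤ δ ^ 2 * |s| := by
    rw [contourPoint_eq, ← hyd, ← hrd, ← mul_sub_one, norm_mul, Complex.norm_real,
      Real.norm_of_nonneg (Real.exp_pos _).le, mul_comm ((δ ^ 2 * s : ℝ) : ℂ) Complex.I]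
    have := Real.norm_exp_I_mul_ofReal_sub_one_le (x := δ ^ 2 * s)
    rw [Real.norm_eq_abs, abs_mul, abs_of_pos (by positivity : 0 < δ ^ 2)] at this
    calc r * ‖Complex.exp (Complex.I * ((δ ^ 2 * s : ℝ) : ℂ)) - 1‖ ≤ 1 * (δ ^ 2 * |s|) :=
          mul_le_mul hrle this (norm_nonneg _) zero_le_one
      _ = _ := one_mul _
  have hrc : (1 - (r : ℂ)) ≠ 0 := by exact_mod_cast hr0.ne'
  have hsplit : (y : ℂ) / (1 - contourPoint m δ s) - ((1 + α * δ - y : ℝ) : ℂ) =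
      y * (contourPoint m δ s - r) / ((1 - contourPoint m δ s) * (1 - r)) +
      ((y / (1 - r) - (1 + α * δ - y) : ℝ) : ℂ) := by
    push_cast
    field_simp
    ring
  rw [hsplit]
  refine (norm_add_le _ _).trans ?_
  have hA : ‖(y : ℂ) * (contourPoint m δ s - r) / ((1 - contourPoint m δ s) * (1 - r))‖ ≤
      δ * (4 / m * |s|) := by
    rw [norm_div, norm_mul, norm_mul, Complex.norm_real, Real.norm_of_nonneg hy.le,
      show (1 - (r : ℂ)) = ((1 - r : ℝ) : ℂ) by push_cast; rfl, Complex.norm_real,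
      Real.norm_of_nonneg hr0.le]
    calc y * ‖contourPoint m δ s - r‖ / (‖1 - contourPoint m δ s‖ * (1 - r)) ≤
        y * (δ ^ 2 * |s|) / (y / 2 * (y / 2)) := by gcongr
      _ = δ * (4 / m * |s|) := by rw [hyd]; field_simp; norm_num
  have hB : ‖((y / (1 - r) - (1 + α * δ - y) : ℝ) : ℂ)‖ ≤ δ * (2 * m + |α|) := by
    rw [Complex.norm_real, Real.norm_eq_abs]
    have b1 : 1 ≤ y / (1 - r) := (one_le_div hr0).2 hry
    have b2 : y / (1 - r) ≤ 1 + y := by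
      rw [div_le_iff₀ hr0]
      rw [div_le_iff₀ (by linarith)] at hr2
      linarith
    have b3 := neg_abs_le (α * δ)
    have b4 := le_abs_self (α * δ)
    rw [abs_mul, abs_of_pos hδ] at b3 b4
    rw [abs_le]
    constructor <;> nlinarith
  linarith

lemma norm_saddleAmplitude_le (α q : ℝ) (hm : 0 < m) {δ : ℝ} (hδ : 0 < δ) (hmδ : m * δ ≤ 1)
    (s : ℝ) : ‖saddleAmplitude α q m δ s‖ ≤ amplitudeBound α q m s := by
  have hy : 0 < m * δ := by positivity
  have hr := half_le_one_sub_exp_neg hy hmδ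
  have hn := norm_contourPoint m δ s
  have hb := contourPoint_mem_ball hm hδ s
  have hn1 : ‖contourPoint m δ s‖ ≤ 1 := (mem_ball_zero_iff.1 hb).le
  have h1 : m * δ / 2 ≤ ‖1 - contourPoint m δ s‖ := by
    have := norm_sub_norm_le (1 : ℂ) (contourPoint m δ s)
    rw [norm_one, hn] at this
    linarith
  have h2 : m * δ / 2 ≤ ‖1 - contourPoint m δ s ^ 2‖ := by
    have := norm_sub_norm_le (1 : ℂ) (contourPoint m δ s ^ 2)
    rw [norm_one, norm_pow] at this
    have h3 : ‖contourPoint m δ s‖ ^ 2 ≤ ‖contourPoint m δ s‖ := by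
      rw [pow_two]; exact mul_le_of_le_one_left (norm_nonneg _) hn1
    rw [hn] at h3 this
    linarith
  have b1 : ‖(δ : ℂ) / (1 - contourPoint m δ s)‖ ≤ 2 / m := by
    rw [norm_div, Complex.norm_real, Real.norm_of_nonneg hδ.le]
    calc δ / ‖1 - contourPoint m δ s‖ ≤ δ / (m * δ / 2) := by gcongr
      _ = 2 / m := by field_simp
  have b2 : ‖(√δ : ℂ) * Complex.exp (-(1 / 2) * Complex.log (1 - contourPoint m δ s ^ 2))‖ ≤
      √(2 / m) := by
    have hpos : 0 < ‖1 - contourPoint m δ s ^ 2‖ := lt_of_lt_of_le (by positivity) h2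
    have e : ‖Complex.exp (-(1 / 2) * Complex.log (1 - contourPoint m δ s ^ 2))‖ =
        (√‖1 - contourPoint m δ s ^ 2‖)⁻¹ := by
      rw [Complex.norm_exp, show (-(1 / 2) : ℂ) = ((-(1 / 2) : ℝ) : ℂ) by push_cast; rfl,
        Complex.re_ofReal_mul, Complex.log_re, Real.sqrt_eq_rpow, ← Real.rpow_neg hpos.le,
        Real.rpow_def_of_pos hpos, mul_comm]
    rw [norm_mul, e, Complex.norm_real, Real.norm_of_nonneg (Real.sqrt_nonneg δ), ← div_eq_mul_inv,
      ← Real.sqrt_div hδ.le]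
    refine Real.sqrt_le_sqrt ?_
    calc δ / ‖1 - contourPoint m δ s ^ 2‖ ≤ δ / (m * δ / 2) := by gcongr
      _ = 2 / m := by field_simp
  have b3 : ‖contourAmplitude (δ ^ 3)⁻¹ (1 + α * δ - m * δ) (q * δ) (m * δ) (contourPoint m δ s) /
      (δ : ℂ) ^ 2‖ ≤
      4 / m + q ^ 2 * (1 + 4 / m ^ 2 * |s|) + (4 / m * |s| + (2 * m + |α|)) ^ 2 := by
    have hd2 : ‖(δ : ℂ) ^ 2‖ = δ ^ 2 := by
      rw [norm_pow, Complex.norm_real, Real.norm_of_nonneg hδ.le]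
    rw [norm_div, hd2, div_le_iff₀ (by positivity), contourAmplitude]
    refine (norm_add₃_le).trans ?_
    have c1 : ‖(1 / ((δ ^ 3)⁻¹ : ℝ) : ℂ) * (1 / (1 - contourPoint m δ s) +
        contourPoint m δ s / (1 - contourPoint m δ s ^ 2))‖ ≤ 4 / m * δ ^ 2 := by
      have d1 : ‖1 / (1 - contourPoint m δ s)‖ ≤ 1 / (m * δ / 2) := by
        rw [norm_div, norm_one]
        exact one_div_le_one_div_of_le (by positivity) h1
      have d2 : ‖contourPoint m δ s / (1 - contourPoint m δ s ^ 2)‖ ≤ 1 / (m * δ / 2) := by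
        rw [norm_div]
        exact div_le_div₀ zero_le_one hn1 (by positivity) h2
      rw [norm_mul, norm_div, norm_one, Complex.norm_real, norm_inv, norm_pow,
        Real.norm_of_nonneg hδ.le, one_div, inv_inv]
      calc δ ^ 3 * ‖1 / (1 - contourPoint m δ s) +
            contourPoint m δ s / (1 - contourPoint m δ s ^ 2)‖ ≤
          δ ^ 3 * (1 / (m * δ / 2) + 1 / (m * δ / 2)) := by
            gcongr
            exact (norm_add_le _ _).trans (add_le_add d1 d2)
        _ = 4 / m * δ ^ 2 := by field_simp; norm_num
    have c2 : ‖((q * δ : ℝ) : ℂ) ^ 2 / (1 + contourPoint m δ s) ^ 2‖ ≤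
        q ^ 2 * (1 + 4 / m ^ 2 * |s|) * δ ^ 2 := by
      rw [norm_div, norm_pow, norm_pow, Complex.norm_real, Real.norm_eq_abs, sq_abs, div_eq_mul_inv]
      have := mul_le_mul_of_nonneg_left (norm_one_add_contourPoint_sq_inv_le (s := s) hm hδ hmδ)
        (by positivity : 0 ≤ (q * δ) ^ 2)
      linarith
    have c3 : ‖(((m * δ : ℝ) : ℂ) / (1 - contourPoint m δ s) - ((1 + α * δ - m * δ : ℝ) : ℂ)) ^ 2‖ ≤
        (4 / m * |s| + (2 * m + |α|)) ^ 2 * δ ^ 2 := by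
      rw [norm_pow]
      have := pow_le_pow_left₀ (norm_nonneg _) (norm_div_one_sub_sub_le (s := s) α hm hδ hmδ) 2
      rw [mul_pow] at this
      linarith
    linarith
  rw [saddleAmplitude, norm_mul, norm_mul, amplitudeBound]
  exact mul_le_mul (mul_le_mul b1 b2 (norm_nonneg _) (by positivity)) b3 (norm_nonneg _)
    (by positivity)

end RankOneGUE
end

/-! ### Dominated convergence and the Gaussian integral in s -/

noncomputable section
namespace RankOneGUE
variable {m : ℝ}

lemma integrable_comp_abs {f : ℝ → ℝ} (hf : IntegrableOn f (Set.Ioi 0)) :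
    Integrable fun x => f |x| := by
  have h1 : IntegrableOn (fun x => f |x|) (Set.Ioi 0) :=
    hf.congr_fun (fun x hx => by rw [abs_of_pos hx]) measurableSet_Ioi
  have h2 : IntegrableOn (fun x => f |x|) (Set.Iic 0) := by
    rw [← Measure.map_neg_eq_self (volume : Measure ℝ)]
    have e : MeasurableEmbedding fun x : ℝ => -x := (Homeomorph.neg ℝ).measurableEmbedding
    rw [e.integrableOn_map_iff]
    simp_rw [Function.comp_def, abs_neg, Set.neg_preimage, Set.neg_Iic, neg_zero]
    exact Iff.mpr integrableOn_Ici_iff_integrableOn_Ioi h1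
  rw [← integrableOn_univ, ← Set.Iic_union_Ioi (a := (0 : ℝ))]
  exact h2.union h1

/-- The dominating function of the rescaled contour integral. -/
def saddleBound (α q m K s : ℝ) : ℝ :=
  amplitudeBound α q m s * Real.exp (K - m / 15 * (s ^ 2 / (m ^ 2 + Real.pi * |s|)))

lemma continuous_amplitudeBound (α q m : ℝ) : Continuous (amplitudeBound α q m) := by
  unfold amplitudeBound
  fun_prop

lemma amplitudeBound_nonneg (α q : ℝ) (hm : 0 < m) (s : ℝ) : 0 ≤ amplitudeBound α q m s := by
  unfold amplitudeBound
  positivity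

lemma integrable_saddleBound (α q : ℝ) (hm : 0 < m) (K : ℝ) :
    Integrable (saddleBound α q m K) := by
  have hpi := Real.pi_pos
  set b : ℝ := m / 15 / (m ^ 2 + Real.pi) with hb
  have hb0 : 0 < b := by positivity
  have hcont : Continuous (saddleBound α q m K) := by
    have h1 := continuous_amplitudeBound α q m
    have h2 : Continuous fun s : ℝ => s ^ 2 / (m ^ 2 + Real.pi * |s|) :=
      Continuous.div (by fun_prop) (by fun_prop) fun s => by positivity
    unfold saddleBound
    fun_prop
  set c : ℝ := 2 / m * √(2 / m)
  set p : ℝ → ℝ := fun t => c * (4 / m + q ^ 2 + (2 * m + |α|) ^ 2) * (t ^ 0 * Real.exp (-b * t)) +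
    c * (q ^ 2 * (4 / m ^ 2) + 2 * (4 / m) * (2 * m + |α|)) * (t ^ 1 * Real.exp (-b * t)) +
    c * (4 / m) ^ 2 * (t ^ 2 * Real.exp (-b * t)) with hp
  have hpI : IntegrableOn p (Set.Ioi 0) :=
    (((integrableOn_pow_mul_exp_neg hb0 0).const_mul _).add
      ((integrableOn_pow_mul_exp_neg hb0 1).const_mul _)).add
      ((integrableOn_pow_mul_exp_neg hb0 2).const_mul _)
  have hI := (integrable_comp_abs hpI).const_mul (Real.exp (K + b))
  refine hI.mono' hcont.aestronglyMeasurable (ae_of_all _ fun s => ?_)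
  have hA := amplitudeBound_nonneg α q hm s
  have hpe : p |s| = amplitudeBound α q m s * Real.exp (-b * |s|) := by
    simp only [hp, amplitudeBound, c]
    ring
  rw [hpe, saddleBound, Real.norm_of_nonneg (by positivity), mul_left_comm, ← Real.exp_add]
  refine mul_le_mul_of_nonneg_left (Real.exp_le_exp.2 ?_) hA
  -- The exponent grows at least linearly in |s| up to an additive constant, so the bound is
  -- dominated by a quadratic polynomial in |s| times exp(-b|s|).
  have key : b * (|s| - 1) ≤ m / 15 * (s ^ 2 / (m ^ 2 + Real.pi * |s|)) := by
    have hden : 0 < m ^ 2 + Real.pi * |s| := by positivity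
    rw [hb, div_mul_eq_mul_div, mul_div_assoc]
    refine mul_le_mul_of_nonneg_left ?_ (by positivity)
    rw [div_le_div_iff₀ (by positivity) hden, ← sq_abs s]
    have ha := abs_nonneg s
    generalize |s| = a at *
    nlinarith [sq_nonneg (a - 1), mul_nonneg hpi.le ha, mul_nonneg (sq_nonneg m)
        (sq_nonneg (a - 1)),
      mul_nonneg (sq_nonneg m) ha]
  linarith

lemma measurable_saddleIntegrand (α q m δ : ℝ) :
    Measurable fun s => saddleAmplitude α q m δ s * Complex.exp (saddleExponent α q m δ s) := by
  have hl : Measurable fun s => contourLog m δ s := by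
    unfold contourLog
    fun_prop
  have ht : Measurable fun s => contourPoint m δ s := hl.neg.cexp
  have hA : Measurable fun s => saddleAmplitude α q m δ s := by
    unfold saddleAmplitude contourAmplitude
    have : Measurable fun s => Complex.log (1 - contourPoint m δ s ^ 2) :=
      (measurable_const.sub (ht.pow_const 2)).clog
    fun_prop
  have hE : Measurable fun s => saddleExponent α q m δ s := by
    unfold saddleExponent
    fun_prop
  exact hA.mul hE.cexp

/-- The limit of the rescaled integrand. -/
def limitIntegrand (α q m s : ℝ) : ℂ :=
  1 / m * ((√(2 * m))⁻¹ : ℝ) *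
    (3 / (2 * m) + q ^ 2 / 4 + (3 * m / 2 - α + s * Complex.I / m) ^ 2) *
    Complex.exp ((-m * (q ^ 2 / 4 + (α - m / 2) ^ 2) - s ^ 2 / m : ℝ) : ℂ)

lemma tendsto_saddleIntegral (α q : ℝ) (hm : 0 < m) :
    Tendsto (fun δ : ℝ => ∫ s in (-(Real.pi / δ ^ 2))..(Real.pi / δ ^ 2),
      saddleAmplitude α q m δ s * Complex.exp (saddleExponent α q m δ s)) (𝓝[>] 0)
      (𝓝 (∫ s, limitIntegrand α q m s)) := by
  have hpi := Real.pi_pos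
  have hrw : ∀ᶠ δ : ℝ in 𝓝[>] 0,
      ∫ s, (Set.Ioc (-(Real.pi / δ ^ 2)) (Real.pi / δ ^ 2)).indicator
        (fun s => saddleAmplitude α q m δ s * Complex.exp (saddleExponent α q m δ s)) s =
      ∫ s in (-(Real.pi / δ ^ 2))..(Real.pi / δ ^ 2),
      saddleAmplitude α q m δ s * Complex.exp (saddleExponent α q m δ s) := by
    filter_upwards [self_mem_nhdsWithin] with δ hδ
    have hδ : 0 < δ := hδ
    have : 0 < Real.pi / δ ^ 2 := by positivity
    rw [intervalIntegral.integral_of_le (by linarith), integral_indicator measurableSet_Ioc]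
  refine Tendsto.congr' hrw ?_
  have hW := (Complex.continuous_re.tendsto _).comp (tendsto_saddleExponent α 0 hm 0)
  -- The limit of the real part at q = 0, s = 0, plus 1; the extra 1 makes it an upper bound for all
  -- small δ.
  set K : ℝ := ((-m * (0 ^ 2 / 4 + (α - m / 2) ^ 2) - 0 ^ 2 / m : ℝ) : ℂ).re + 1 with hK
  have hWe : ∀ᶠ δ : ℝ in 𝓝[>] 0, (saddleExponent α 0 m δ 0).re ≤ K :=
    (hW.eventually_lt_const (by rw [hK]; linarith)).mono fun _ h => le_of_lt h
  have hsmall : ∀ᶠ δ : ℝ in 𝓝[>] 0, m * δ ≤ 1 := by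
    have : Tendsto (fun δ : ℝ => m * δ) (𝓝[>] 0) (𝓝 0) := by
      simpa using tendsto_id_nhdsGT.const_mul m
    exact (this.eventually_lt_const one_pos).mono fun _ h => le_of_lt h
  refine tendsto_integral_filter_of_dominated_convergence (saddleBound α q m K) ?_ ?_
    (integrable_saddleBound α q hm K) ?_
  · exact Eventually.of_forall fun δ =>
      ((measurable_saddleIntegrand α q m δ).indicator measurableSet_Ioc).aestronglyMeasurable
  · filter_upwards [self_mem_nhdsWithin, hWe, hsmall] with δ hδ hWδ hmδ
    have hδ : 0 < δ := hδ
    refine ae_of_all _ fun s => ?_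
    have hA := amplitudeBound_nonneg α q hm s
    by_cases hs : s ∈ Set.Ioc (-(Real.pi / δ ^ 2)) (Real.pi / δ ^ 2)
    · rw [Set.indicator_of_mem hs, norm_mul, Complex.norm_exp, saddleBound]
      have hE := re_saddleExponent_le α q hm hδ hmδ (abs_le.2 ⟨hs.1.le, hs.2⟩)
      refine mul_le_mul (norm_saddleAmplitude_le α q hm hδ hmδ s) (Real.exp_le_exp.2 ?_)
        (Real.exp_pos _).le hA
      linarith
    · rw [Set.indicator_of_notMem hs, norm_zero, saddleBound]
      positivity
  · refine ae_of_all _ fun s => ?_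
    have hlim := (tendsto_saddleAmplitude α q hm s).mul (tendsto_saddleExponent α q hm s).cexp
    refine hlim.congr' ?_
    -- For fixed s the truncation at π/δ² is eventually inactive.
    have h2 : Tendsto (fun δ : ℝ => δ ^ 2 * (|s| + 1)) (𝓝[>] 0) (𝓝 0) := by
      simpa using (tendsto_id_nhdsGT.pow 2).mul_const (|s| + 1)
    filter_upwards [self_mem_nhdsWithin, h2.eventually_lt_const hpi] with δ hδ hδs
    have hδ : 0 < δ := hδ
    have hs : |s| + 1 < Real.pi / δ ^ 2 := by
      rw [lt_div_iff₀ (by positivity), mul_comm]; exact hδs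
    have h3 := abs_lt.1 (lt_trans (lt_add_one |s|) hs)
    have hmem : s ∈ Set.Ioc (-(Real.pi / δ ^ 2)) (Real.pi / δ ^ 2) := ⟨h3.1, h3.2.le⟩
    rw [Set.indicator_of_mem hmem]

lemma integrable_sq_mul_exp_neg {b : ℝ} (hb : 0 < b) :
    Integrable fun x : ℝ => x ^ 2 * Real.exp (-b * x ^ 2) := by
  have := integrable_rpow_mul_exp_neg_mul_sq hb (s := 2) (by norm_num)
  simpa using this

/-- The derivative of x exp(-bx²) has integral zero, which expresses the second moment through the
Gaussian integral. -/
lemma integral_sq_mul_exp_neg {b : ℝ} (hb : 0 < b) :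
    ∫ x : ℝ, x ^ 2 * Real.exp (-b * x ^ 2) = 1 / (2 * b) * √(Real.pi / b) := by
  have h := integral_eq_zero_of_hasDerivAt_of_integrable
    (f := fun x : ℝ => x * Real.exp (-b * x ^ 2))
    (f' := fun x : ℝ => Real.exp (-b * x ^ 2) - 2 * b * (x ^ 2 * Real.exp (-b * x ^ 2)))
    (fun x => by
      have h1 := (hasDerivAt_id x).mul (((hasDerivAt_pow 2 x).const_mul (-b)).exp)
      refine h1.congr_deriv ?_
      simp only [id]
      push_cast
      ring)
    ((integrable_exp_neg_mul_sq hb).sub ((integrable_sq_mul_exp_neg hb).const_mul _))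
    (integrable_mul_exp_neg_mul_sq hb)
  rw [integral_sub (integrable_exp_neg_mul_sq hb) ((integrable_sq_mul_exp_neg hb).const_mul _),
    integral_const_mul, integral_gaussian] at h
  generalize ∫ x : ℝ, x ^ 2 * Real.exp (-b * x ^ 2) = J at h ⊢
  field_simp
  linarith

/-- The cross term of the square is purely imaginary and drops out of the real part. The term
-s²/m², averaged against a Gaussian of variance m/2, contributes -1/(2m) and turns 3/(2m) into 1/m.
-/
lemma re_integral_limitIntegrand (α q : ℝ) (hm : 0 < m) :
    (√(2 * Real.pi) * (2 * Real.pi))⁻¹ * (∫ s, limitIntegrand α q m s).re =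
      limitDensity α q m := by
  have hpi := Real.pi_pos
  set L := -m * (q ^ 2 / 4 + (α - m / 2) ^ 2) with hL
  set C : ℝ := 1 / m * (√(2 * m))⁻¹ * Real.exp L with hC
  set K : ℝ := 3 / (2 * m) + q ^ 2 / 4 + (3 * m / 2 - α) ^ 2 with hK
  have hb : 0 < 1 / m := by positivity
  have i0 := integrable_exp_neg_mul_sq hb
  have i1 := integrable_mul_exp_neg_mul_sq hb
  have i2 := integrable_sq_mul_exp_neg hb
  set u : ℝ → ℝ := fun s => C * K * Real.exp (-(1 / m) * s ^ 2) -
    C / m ^ 2 * (s ^ 2 * Real.exp (-(1 / m) * s ^ 2)) with hu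
  set v : ℝ → ℝ := fun s => C * (2 * (3 * m / 2 - α) / m) * (s * Real.exp (-(1 / m) * s ^ 2))
      with hv
  have hui : Integrable u := (i0.const_mul _).sub (i2.const_mul _)
  have hvi : Integrable v := i1.const_mul _
  have hsplit : ∀ s, limitIntegrand α q m s = (u s : ℂ) + (v s : ℂ) * Complex.I := by
    intro s
    have he : Complex.exp ((L - s ^ 2 / m : ℝ) : ℂ) =
        ((Real.exp L * Real.exp (-(1 / m) * s ^ 2) : ℝ) : ℂ) := by
      rw [← Real.exp_add, ← Complex.ofReal_exp]
      congr 2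
      ring
    have hmc : (m : ℂ) ≠ 0 := by exact_mod_cast hm.ne'
    have hI : (3 * m / 2 - α + s * Complex.I / m : ℂ) ^ 2 =
        (3 * m / 2 - α) ^ 2 - s ^ 2 / m ^ 2 + 2 * (3 * m / 2 - α) / m * s * Complex.I := by
      have : (s * Complex.I / m : ℂ) ^ 2 = - (s ^ 2 / m ^ 2) := by
        rw [div_pow, mul_pow, Complex.I_sq]; ring
      linear_combination this
    rw [limitIntegrand, ← hL, he, hI, hu, hv]
    simp only [hC, hK]
    generalize Real.exp L = e1
    generalize Real.exp (-(1 / m) * s ^ 2) = e2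
    generalize √(2 * m) = e3
    push_cast
    ring
  have hintegral : ∫ s, limitIntegrand α q m s = ((∫ s, u s : ℝ) : ℂ) + ((∫ s, v s : ℝ) : ℂ)
      * Complex.I := by
    simp only [hsplit]
    rw [integral_add hui.ofReal (hvi.ofReal.mul_const _), integral_mul_const,
      integral_complex_ofReal, integral_complex_ofReal]
  have hre : (∫ s, limitIntegrand α q m s).re = ∫ s, u s := by
    rw [hintegral]; simp
  rw [hre, hu, integral_sub (i0.const_mul _) (i2.const_mul _), integral_const_mul,
    integral_const_mul, integral_gaussian, integral_sq_mul_exp_neg hb, limitDensity]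
  have hs1 : √(Real.pi / (1 / m)) = √Real.pi * √m := by
    rw [← Real.sqrt_mul hpi.le]; congr 1; field_simp
  have hs2 : √(2 * m) = √2 * √m := Real.sqrt_mul (by norm_num) m
  have hs3 : √(2 * Real.pi) = √2 * √Real.pi := Real.sqrt_mul (by norm_num) _
  have h2 : √2 * √2 = 2 := Real.mul_self_sqrt (by norm_num)
  have q2 : √2 ≠ 0 := by positivity
  have qm : √m ≠ 0 := by positivity
  have qp : √Real.pi ≠ 0 := by positivity
  rw [hs1, hs3, hC, hs2, hK, ← hL]
  have h22 : (√2)⁻¹ * (√2)⁻¹ = 1 / 2 := by rw [← mul_inv, h2]; norm_num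
  have hgoal : (√2 * √Real.pi * (2 * Real.pi))⁻¹ *
      (1 / m * (√2 * √m)⁻¹ * Real.exp L * (3 / (2 * m) + q ^ 2 / 4 + (3 * m / 2 - α) ^ 2) *
        (√Real.pi * √m) - 1 / m * (√2 * √m)⁻¹ * Real.exp L / m ^ 2 *
        (1 / (2 * (1 / m)) * (√Real.pi * √m))) =
      ((√2)⁻¹ * (√2)⁻¹) * (1 / (2 * Real.pi * m) *
        (1 / m + q ^ 2 / 4 + (3 * m / 2 - α) ^ 2) * Real.exp L) := by
    generalize √2 = w at *
    generalize √m = w' at *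
    generalize √Real.pi = w'' at *
    field_simp
    ring
  rw [hgoal, h22]
  ring

end RankOneGUE
end

/-! ### Uniqueness of the density, the limit, and the marginal in q -/

noncomputable section
namespace RankOneGUE

lemma isOpen_upperHalf : IsOpen upperHalf := isOpen_lt continuous_const continuous_snd

/-- Outside U the product vanishes identically near each point, so continuity of ρ on U alone is
enough. -/
lemma continuous_mul_of_tsupport_subset {X : Type*} [TopologicalSpace X] {U : Set X}
    (hU : IsOpen U) {g ρ : X → ℝ} (hg : Continuous g) (hgU : tsupport g ⊆ U)
    (hρ : ContinuousOn ρ U) : Continuous fun p => g p * ρ p := by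
  refine continuous_iff_continuousAt.2 fun p => ?_
  by_cases hp : p ∈ U
  · exact hg.continuousAt.mul (hρ.continuousAt (hU.mem_nhds hp))
  · have hz : (fun p => g p * ρ p) =ᶠ[𝓝 p] fun _ => 0 := by
      have h0 := notMem_tsupport_iff_eventuallyEq.1 fun h => hp (hgU h)
      filter_upwards [h0] with x hx
      rw [hx]
      simp
    exact continuousAt_const.congr hz.symm

/-- The mean eigenvalue density is unique on the upper half-plane. -/
lemma IsMeanEigenvalueDensity.eqOn {N : ℕ} {γ : ℝ} {ρ₁ ρ₂ : ℝ × ℝ → ℝ}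
    (h₁ : IsMeanEigenvalueDensity N γ ρ₁) (h₂ : IsMeanEigenvalueDensity N γ ρ₂) :
    Set.EqOn ρ₁ ρ₂ upperHalf := by
  have hintegral {g ρ : ℝ × ℝ → ℝ} (hg : Continuous g) (hc : HasCompactSupport g)
      (hgU : tsupport g ⊆ upperHalf) (hρ : ContinuousOn ρ upperHalf) :
      Integrable fun p => g p * ρ p :=
    (continuous_mul_of_tsupport_subset isOpen_upperHalf hg hgU hρ).integrable_of_hasCompactSupport
      hc.mul_right
  have h := isOpen_upperHalf.ae_eq_zero_of_integral_contDiff_smul_eq_zero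
    (f := fun p => ρ₁ p - ρ₂ p) (μ := volume)
    ((h₁.1.sub h₂.1).locallyIntegrableOn isOpen_upperHalf.measurableSet) fun g hg hc hgU => by
      simp only [smul_eq_mul, mul_sub]
      rw [integral_sub (hintegral hg.continuous hc hgU h₁.1) (hintegral hg.continuous hc hgU h₂.1),
        ← h₁.2 g hg.continuous hc hgU, ← h₂.2 g hg.continuous hc hgU, sub_self]
  refine Measure.eqOn_open_of_ae_eq (μ := volume) ?_ isOpen_upperHalf h₁.1 h₂.1
  rw [Filter.EventuallyEq, ae_restrict_iff' isOpen_upperHalf.measurableSet]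
  filter_upwards [h] with p hp hpU
  exact sub_eq_zero.1 (hp hpU)

lemma tendsto_inv_rpow_third :
    Tendsto (fun N : ℕ => ((N : ℝ) ^ (1 / 3 : ℝ))⁻¹) atTop (𝓝[>] 0) := by
  refine tendsto_inv_atTop_nhdsGT_zero.comp ?_
  exact (tendsto_rpow_atTop (by norm_num)).comp tendsto_natCast_atTop_atTop

lemma tendsto_one_add_mul_inv_rpow (α : ℝ) :
    Tendsto (fun N : ℕ => 1 + α * ((N : ℝ) ^ (1 / 3 : ℝ))⁻¹) atTop (𝓝 1) := by
  have h := (tendsto_nhds_of_tendsto_nhdsWithin tendsto_inv_rpow_third).const_mul α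
  simpa using h.const_add 1

lemma eventually_isMeanEigenvalueDensity (α : ℝ) :
    ∀ᶠ N : ℕ in atTop,
      IsMeanEigenvalueDensity N (criticalGamma α N) (meanDensity (N - 2) (criticalGamma α N)) := by
  -- Requiring N ≥ 3 makes n = N - 2 nonzero, as the density formula needs.
  filter_upwards [eventually_ge_atTop 3,
    (tendsto_one_add_mul_inv_rpow α).eventually_const_lt zero_lt_one] with N hN hγ
  obtain ⟨n, rfl⟩ : ∃ n, N = n + 2 := ⟨N - 2, by omega⟩
  rw [Nat.add_sub_cancel]
  refine isMeanEigenvalueDensity_meanDensity (by omega) ?_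
  rwa [criticalGamma, div_eq_mul_inv]

lemma tendsto_rescaledDensity_meanDensity (α q : ℝ) {m : ℝ} (hm : 0 < m) :
    Tendsto (fun N : ℕ => rescaledDensity N (meanDensity (N - 2) (criticalGamma α N)) q m) atTop
      (𝓝 (limitDensity α q m)) := by
  have hδ := tendsto_nhds_of_tendsto_nhdsWithin tendsto_inv_rpow_third
  have hγ := tendsto_one_add_mul_inv_rpow α
  have hI := (Complex.continuous_re.tendsto _).comp
    ((tendsto_saddleIntegral α q hm).comp tendsto_inv_rpow_third)
  have hc := ((hγ.const_mul (√(2 * Real.pi) * (2 * Real.pi))).inv₀ (by positivity)).mul hI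
  rw [mul_one, re_integral_limitIntegrand α q hm] at hc
  refine hc.congr' ?_
  have hmδ := hδ.const_mul m
  rw [mul_zero] at hmδ
  -- Eventually mδ < 1 + αδ, so the evaluation point lies below the height γ and the contour formula
  -- applies.
  filter_upwards [eventually_ge_atTop 3, hmδ.eventually_lt hγ zero_lt_one] with N hN hlt
  obtain ⟨n, rfl⟩ : ∃ n, N = n + 2 := ⟨N - 2, by omega⟩
  rw [Nat.add_sub_cancel]
  exact (rescaledDensity_meanDensity_eq α q hm n rfl hlt).symm

lemma limitDensity_eq (α q m : ℝ) :
    limitDensity α q m =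
      Real.exp (-m * (α - m / 2) ^ 2) / (4 * Real.pi * m) *
        ((1 / m + (3 * m / 2 - α) ^ 2) * Real.exp (-(m / 4) * q ^ 2) +
          1 / 4 * (q ^ 2 * Real.exp (-(m / 4) * q ^ 2))) := by
  have he : Real.exp (-m * (q ^ 2 / 4 + (α - m / 2) ^ 2)) =
      Real.exp (-m * (α - m / 2) ^ 2) * Real.exp (-(m / 4) * q ^ 2) := by
    rw [← Real.exp_add]
    ring_nf
  rw [limitDensity, he]
  ring

lemma integrable_limitDensity (α : ℝ) {m : ℝ} (hm : 0 < m) :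
    Integrable fun q : ℝ => limitDensity α q m := by
  have hb : 0 < m / 4 := by positivity
  simp only [limitDensity_eq α _ m]
  exact (((integrable_exp_neg_mul_sq hb).const_mul _).add
    ((integrable_sq_mul_exp_neg hb).const_mul _)).const_mul _

lemma integral_limitDensity (α : ℝ) {m : ℝ} (hm : 0 < m) :
    ∫ q : ℝ, limitDensity α q m = limitImDensity α m := by
  have hb : 0 < m / 4 := by positivity
  have hpi := Real.pi_pos
  simp only [limitDensity_eq α _ m]
  rw [integral_const_mul, integral_add ((integrable_exp_neg_mul_sq hb).const_mul _)
    ((integrable_sq_mul_exp_neg hb).const_mul _), integral_const_mul, integral_const_mul,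
    integral_gaussian, integral_sq_mul_exp_neg hb, limitImDensity]
  have hs : √(Real.pi / (m / 4)) = 2 * √Real.pi / √m := by
    rw [show Real.pi / (m / 4) = 2 ^ 2 * Real.pi / m by field_simp; norm_num,
      Real.sqrt_div (by positivity), Real.sqrt_mul (by positivity),
      Real.sqrt_sq (by norm_num)]
  have hm32 : m ^ (3 / 2 : ℝ) = m * √m := by
    rw [show (3 / 2 : ℝ) = 1 + 1 / 2 by norm_num, Real.rpow_add hm, Real.rpow_one,
      ← Real.sqrt_eq_rpow]
  rw [hs, hm32]
  have hp : Real.pi = √Real.pi * √Real.pi := (Real.mul_self_sqrt hpi.le).symm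
  have qm : √m ≠ 0 := by positivity
  have qp : √Real.pi ≠ 0 := by positivity
  generalize Real.exp (-m * (α - m / 2) ^ 2) = e
  generalize √Real.pi = w at *
  rw [hp]
  generalize √m = v at *
  field_simp
  ring

end RankOneGUE
end

open RankOneGUE in
theorem theorem2p3 (α : ℝ) :
    (∀ᶠ N : ℕ in atTop, ∃ ρ : ℝ × ℝ → ℝ,
      IsMeanEigenvalueDensity N (criticalGamma α N) ρ) ∧
    (∀ ρ : ℕ → ℝ × ℝ → ℝ,
      (∀ᶠ N : ℕ in atTop, IsMeanEigenvalueDensity N (criticalGamma α N) (ρ N)) →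
      ∀ q m : ℝ, 0 < m →
        Tendsto (fun N : ℕ => rescaledDensity N (ρ N) q m) atTop (𝓝 (limitDensity α q m))) ∧
    (∀ m : ℝ, 0 < m →
      Integrable (fun q : ℝ => limitDensity α q m) ∧
      ∫ q : ℝ, limitDensity α q m = limitImDensity α m) := by
  refine ⟨(eventually_isMeanEigenvalueDensity α).mono fun N hN => ⟨_, hN⟩,
    fun ρ hρ q m hm => ?_,
    fun m hm => ⟨integrable_limitDensity α hm, integral_limitDensity α hm⟩⟩
  -- Any admissible density agrees with the explicit one on the open half-plane, and the evaluation
  -- point lies there because m > 0.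
  refine (tendsto_rescaledDensity_meanDensity α q hm).congr' ?_
  filter_upwards [hρ, eventually_isMeanEigenvalueDensity α, eventually_gt_atTop 0]
    with N h₁ h₂ hN
  have hmem : (q / (N : ℝ) ^ (1 / 3 : ℝ), m / (N : ℝ) ^ (1 / 3 : ℝ)) ∈ upperHalf := by
    change 0 < m / (N : ℝ) ^ (1 / 3 : ℝ)
    positivity
  rw [rescaledDensity, rescaledDensity, h₂.eqOn h₁ hmem]
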